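/- Let $\Omega\subset\mathbb{R}^d$ be a bounded connected polygonal open set, and let $\Omega_1,\Omega_2\subset\Omega$ be disjoint connected polygonal open sets with $\overline\Omega_1\cup\overline\Omega_2=\overline\Omega$ (polygonal: the boundary lies in finitely many hyperplanes and the set is the interior of its closure). Let $\Gamma=\partial\Omega_1\cap\partial\Omega_2\cap\Omega$ be the interface and let $T>0$. For $i=1,2$ let $\phi_i\in(0,1)$; let $\pi_i\in C^1([0,1])$ with $\pi_i'>0$ on $(0,1)$; let $\eta_{o,i},\eta_{w,i}\in C^0([0,1],\mathbb{R}_+)$ be respectively strictly increasing with $\eta_{o,i}(0)=0$ and strictly decreasing with $\eta_{w,i}(1)=0$. Let $u_0\in L^\infty(\Omega)$ with $0\le u_0\le1$. Put $$\alpha_i=\pi_i(0),\quad \beta_i=\pi_i(1),\quad \lambda_i=\frac{\eta_{o,i}\,\eta_{w,i}}{\eta_{o,i}+\eta_{w,i}},\quad \varphi_i(s)=\int_0^s\lambda_i(a)\pi_i'(a)\,da ,$$ and let $\tilde\pi_i$ be the monotone graph $\tilde\pi_i(0)=(-\infty,\alpha_i]$, $\tilde\pi_i(s)=\{\pi_i(s)\}$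 for $0<s<1$, $\tilde\pi_i(1)=[\beta_i,+\infty)$. Assume $\alpha:=\max(\alpha_1,\alpha_2)<\beta:=\min(\beta_1,\beta_2)$, and define the truncated capillary pressures $\hat\pi_i=\min(\beta,\max(\alpha,\pi_i))$ and $$\Psi(p)=\int_\alpha^p\min_{j=1,2}\lambda_j(\pi_j^{-1}(a))\,da,\qquad p\in[\alpha,\beta].$$ For a function $u$ on $\Omega\times(0,T)$, with restrictions $u_i$ to $\Omega_i\times(0,T)$, consider the following conditions. (1) $u\in L^\infty(\Omega\times(0,T))$ and $0\le u\le1$ a.e. (2) $\varphi_i(u_i)\in L^2(0,T;H^1(\Omega_i))$ for $i=1,2$. (3) $\tilde\pi_1(u_1)\cap\tilde\pi_2(u_2)\ne\emptyset$ a.e. on $\Gamma\times(0,T)$, where the trace of $u_i$ on $\Gamma$ is $\varphi_i^{-1}$ of the trace of $\varphi_i(u_i)$. ($\tilde 3$) The function $w$ defined by $w=\Psi\circ\hat\pi_i(u_i)$ on $\Omega_i\times(0,T)$, $i=1,2$, belongs to $L^2(0,T;H^1(\Omega))$. (4) For all $\psi\in\mathcal{D}(\overline\Omega\times[0,T))$,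 $$\sum_{i=1}^2\int_{\Omega_i}\int_0^T\phi_iu_i\,\partial_t\psi\,dt\,dx+\sum_{i=1}^2\int_{\Omega_i}\phi_iu_0\,\psi(\cdot,0)\,dx-\sum_{i=1}^2\int_{\Omega_i}\int_0^T\nabla\varphi_i(u_i)\cdot\nabla\psi\,dt\,dx=0 .$$ Call $u$ a weak solution of $(\mathcal{P})$ if (1), (2), (3), (4) hold, and a weak solution of $(\widetilde{\mathcal{P}})$ if (1), (2), ($\tilde3$), (4) hold. Then $u$ is a weak solution of $(\mathcal{P})$ if and only if it is a weak solution of $(\widetilde{\mathcal{P}})$. -/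

import Mathlib

namespace TwoPhaseFlow

open MeasureTheory Set Filter Topology
open scoped ContDiff

noncomputable section

/-- The physical space `ℝ^d` with its Euclidean structure. -/
abbrev Space (d : ℕ) : Type := EuclideanSpace ℝ (Fin d)

/-! ### Geometry -/

/-- A (bounded) polygonal domain of `ℝ^d`: a nonempty bounded connected open set that lies on only
one side of its boundary (it is the interior of its closure, so there are no slits), and whose
boundary is contained in a finite union of affine hyperplanes `{x | ⟪a, x⟫ = b}`, `a ≠ 0`. -/
structure IsPolygonalDomain {d : ℕ} (U : Set (Space d)) : Prop where
  isOpen : IsOpen U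
  isConnected : IsConnected U
  isBounded : Bornology.IsBounded U
  interior_closure : interior (closure U) = U
  flat_boundary : ∃ H : Finset (Space d × ℝ), (∀ h ∈ H, h.1 ≠ 0) ∧
    frontier U ⊆ ⋃ h ∈ H, {x : Space d | inner ℝ h.1 x = h.2}

/-! ### Sobolev spaces and traces -/

/-- `G` is the weak (distributional) gradient of `v` in the open set `U`. -/
def HasWeakGradient {d : ℕ} (U : Set (Space d)) (v : Space d → ℝ) (G : Space d → Space d) : Prop :=
  ∀ θ : Space d → ℝ, ContDiff ℝ ∞ θ → HasCompactSupport θ → tsupport θ ⊆ U →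
    ∫ x in U, v x • gradient θ x = - ∫ x in U, θ x • G x

/-- `v` belongs to `L²(0,T;H¹(U))` and `G` is its spatial weak gradient: `v` and `G` are square
integrable on `U × (0,T)` and, for a.e. `t ∈ (0,T)`, `G(·,t)` is the weak gradient of `v(·,t)`. -/
structure IsL2H1 {d : ℕ} (U : Set (Space d)) (T : ℝ) (v : Space d × ℝ → ℝ)
    (G : Space d × ℝ → Space d) : Prop where
  memLp : MemLp v 2 (volume.restrict (U ×ˢ Ioo 0 T))
  memLp_grad : MemLp G 2 (volume.restrict (U ×ˢ Ioo 0 T))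
  hasWeakGradient : ∀ᵐ t ∂(volume.restrict (Ioo 0 T)),
    HasWeakGradient U (fun x => v (x, t)) (fun x => G (x, t))

/-- `v ∈ L²(0,T;H¹(U))`. -/
def MemL2H1 {d : ℕ} (U : Set (Space d)) (T : ℝ) (v : Space d × ℝ → ℝ) : Prop :=
  ∃ G : Space d × ℝ → Space d, IsL2H1 U T v G

/-- `g` is the trace at the boundary point `x` of the function `v` defined in `U`, in the sense of
one-sided Lebesgue limits: the mean of `|v - g|` over `U ∩ B(x,r)` tends to `0` as `r → 0⁺`.
At a point of continuity of `v` up to the boundary this is the boundary value, and for a function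
of `H¹(U)`, `U` polygonal, such a `g` exists at almost every boundary point (for the surface
measure) and is the usual Sobolev trace. -/
def IsTraceAt {d : ℕ} (U : Set (Space d)) (v : Space d → ℝ) (x : Space d) (g : ℝ) : Prop :=
  Tendsto (fun r : ℝ => ⨍ y in U ∩ Metric.ball x r, |v y - g|) (𝓝[>] 0) (𝓝 0)

/-! ### The porous medium and the data -/

/-- A bounded polygonal porous medium `Ω ⊆ ℝ^d` divided into `N` homogeneous polygonal media `Ω i`,
the time horizon `T`, and the data of the flow. Functions of the saturation are only
used on `[0,1]`. -/
structure Medium (d N : ℕ) where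
  /-- the whole medium -/
  Ω : Set (Space d)
  /-- the homogeneous subdomains -/
  sub : Fin N → Set (Space d)
  /-- the final time -/
  T : ℝ
  /-- the porosities -/
  porosity : Fin N → ℝ
  /-- the capillary pressures `π_i` -/
  cap : Fin N → ℝ → ℝ
  /-- the oil mobilities -/
  ηo : Fin N → ℝ → ℝ
  /-- the water mobilities -/
  ηw : Fin N → ℝ → ℝ
  /-- the initial saturation -/
  u₀ : Space d → ℝ
  polygonal : IsPolygonalDomain Ω
  sub_polygonal : ∀ i, IsPolygonalDomain (sub i)
  sub_subset : ∀ i, sub i ⊆ Ω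
  iUnion_closure : ⋃ i, closure (sub i) = closure Ω
  sub_disjoint : ∀ i j, i ≠ j → Disjoint (sub i) (sub j)
  T_pos : 0 < T
  porosity_mem : ∀ i, porosity i ∈ Ioo (0 : ℝ) 1
  cap_contDiffOn : ∀ i, ContDiffOn ℝ 1 (cap i) (Icc 0 1)
  cap_deriv_pos : ∀ i, ∀ s ∈ Ioo (0 : ℝ) 1, 0 < derivWithin (cap i) (Icc 0 1) s
  ηo_continuousOn : ∀ i, ContinuousOn (ηo i) (Icc 0 1)
  ηo_strictMonoOn : ∀ i, StrictMonoOn (ηo i) (Icc 0 1)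
  ηo_zero : ∀ i, ηo i 0 = 0
  ηw_continuousOn : ∀ i, ContinuousOn (ηw i) (Icc 0 1)
  ηw_strictAntiOn : ∀ i, StrictAntiOn (ηw i) (Icc 0 1)
  ηw_one : ∀ i, ηw i 1 = 0
  u₀_memLp : MemLp u₀ ⊤ (volume.restrict Ω)
  u₀_mem : ∀ᵐ x ∂(volume.restrict Ω), u₀ x ∈ Icc (0 : ℝ) 1

namespace Medium

variable {d N : ℕ} (M : Medium d N)

/-- The interface `Γ_{i,j}` between `Ω_i` and `Ω_j`, inside `Ω`. -/
def interface (i j : Fin N) : Set (Space d) :=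
  frontier (M.sub i) ∩ frontier (M.sub j) ∩ M.Ω

/-- The limit of `π_i` at `0`; it is the value at `0` as `π_i` is continuous on `[0,1]`. -/
def α (i : Fin N) : ℝ := M.cap i 0

/-- The limit of `π_i` at `1`; it is the value at `1` as `π_i` is continuous on `[0,1]`. -/
def β (i : Fin N) : ℝ := M.cap i 1

/-- The maximal monotone graph `π̃_i` extending the capillary pressure: `π_i(s)` for `0 < s < 1`,
`]-∞, α_i]` for `s = 0` and `[β_i, +∞[` for `s = 1`. -/
def capGraph (i : Fin N) (s : ℝ) : Set ℝ :=
  if s = 0 then Iic (M.α i) else if s = 1 then Ici (M.β i) else {M.cap i s}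

/-- The global mobility `λ_i`. -/
def mobility (i : Fin N) (s : ℝ) : ℝ :=
  M.ηo i s * M.ηw i s / (M.ηo i s + M.ηw i s)

/-- The function `φ_i(s) = ∫₀ˢ λ_i(a) π_i'(a) da`, `s ∈ [0,1]`. -/
def φ (i : Fin N) (s : ℝ) : ℝ :=
  ∫ a in (0 : ℝ)..s, M.mobility i a * derivWithin (M.cap i) (Icc 0 1) a

/-- The function `φ_i(u)`, used on `Ω_i × (0,T)`. -/
def φu (u : Space d × ℝ → ℝ) (i : Fin N) : Space d × ℝ → ℝ := fun p => M.φ i (u p)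

/-- `u ∈ L^∞(Ω × (0,T))` with `0 ≤ u ≤ 1` a.e. -/
def IsSaturation (u : Space d × ℝ → ℝ) : Prop :=
  MemLp u ⊤ (volume.restrict (M.Ω ×ˢ Ioo 0 M.T)) ∧
    ∀ᵐ p ∂(volume.restrict (M.Ω ×ˢ Ioo 0 M.T)), u p ∈ Icc (0 : ℝ) 1

/-- The weak formulation of the equations, of the flux conditions and of the initial condition, with
`G i` standing for `∇φ_i(u_i)`. The test functions of `𝒟(closure Ω × [0,T))` are the restrictions of
the smooth functions on `ℝ^d × ℝ` with compact support in `ℝ^d × (-∞,T)`. -/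
def WeakFormulation (u : Space d × ℝ → ℝ) (G : Fin N → Space d × ℝ → Space d) : Prop :=
  ∀ ψ : Space d × ℝ → ℝ, ContDiff ℝ ∞ ψ → HasCompactSupport ψ →
    tsupport ψ ⊆ {p | p.2 < M.T} →
    (∑ i, ∫ p in M.sub i ×ˢ Ioo 0 M.T,
        M.porosity i * u p * deriv (fun s => ψ (p.1, s)) p.2)
      + (∑ i, ∫ x in M.sub i, M.porosity i * M.u₀ x * ψ (x, 0))
      - (∑ i, ∫ p in M.sub i ×ˢ Ioo 0 M.T,
        inner ℝ (G i p) (gradient (fun y => ψ (y, p.2)) p.1)) = 0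

/-- `φ_i(u_i) ∈ L²(0,T;H¹(Ω_i))` for all `i`, and the weak formulation holds with the weak
gradients `∇φ_i(u_i)`. -/
def SolvesWeakly (u : Space d × ℝ → ℝ) : Prop :=
  ∃ G : Fin N → Space d × ℝ → Space d,
    (∀ i, IsL2H1 (M.sub i) M.T (M.φu u i) (G i)) ∧ M.WeakFormulation u G

/-- `s ∈ [0,1]` is the trace of `u_i` at the point `x` of the boundary of `Ω_i` at time `t`, that
is `s = φ_i⁻¹(g)` where `g` is the trace of `φ_i(u_i(·,t))`. -/
def IsSaturationTrace (u : Space d × ℝ → ℝ) (i : Fin N) (x : Space d) (t s : ℝ) : Prop :=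
  s ∈ Icc (0 : ℝ) 1 ∧ IsTraceAt (M.sub i) (fun y => M.φu u i (y, t)) x (M.φ i s)

/-- `π̃_i(u_i) ∩ π̃_j(u_j) ≠ ∅` for the traces, a.e. on `Γ_{i,j} × (0,T)`: for almost every time,
almost everywhere on `Γ_{i,j}` for the `(d-1)`-dimensional Hausdorff measure. -/
def GraphCondition (u : Space d × ℝ → ℝ) (i j : Fin N) : Prop :=
  ∀ᵐ t ∂(volume.restrict (Ioo 0 M.T)),
    ∀ᵐ x ∂((Measure.hausdorffMeasure ((d : ℝ) - 1)).restrict (M.interface i j)),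
      ∃ si sj : ℝ, M.IsSaturationTrace u i x t si ∧ M.IsSaturationTrace u j x t sj ∧
        (M.capGraph i si ∩ M.capGraph j sj).Nonempty

/-- Weak solutions of the problem `(𝒫)`, with the capillary pressures connected in the sense of
graphs. -/
structure IsWeakSolution (u : Space d × ℝ → ℝ) : Prop where
  isSaturation : M.IsSaturation u
  graphCondition : ∀ i j, i ≠ j → M.GraphCondition u i j
  solves : M.SolvesWeakly u

/-- The inverse function `π_i⁻¹ : [α_i, β_i] → [0,1]` of the capillary pressure. -/
def capInv (i : Fin N) : ℝ → ℝ := Function.invFunOn (M.cap i) (Icc 0 1)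

end Medium

namespace Medium

variable {d : ℕ} (M : Medium d 2)

/-- `α = max (α₁, α₂)`. -/
def αmax : ℝ := max (M.α 0) (M.α 1)

/-- `β = min (β₁, β₂)`. -/
def βmin : ℝ := min (M.β 0) (M.β 1)

/-- The capillary pressure `π_i` truncated to `[α, β]`. When the media are numbered so that
`α₁ ≤ α₂` and `β₁ ≤ β₂`, this is `max (α, π₁)` for the first and `min (β, π₂)` for the second. -/
def truncCap (i : Fin 2) (s : ℝ) : ℝ := min M.βmin (max M.αmax (M.cap i s))

/-- `Ψ(p) = ∫_α^p min_j λ_j(π_j⁻¹(a)) da`, `p ∈ [α, β]`. -/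
def Ψ (p : ℝ) : ℝ :=
  ∫ a in M.αmax..p, min (M.mobility 0 (M.capInv 0 a)) (M.mobility 1 (M.capInv 1 a))

/-- The function `w` equal to `Ψ(π̂_i(u))` on `Ω_i × (0,T)`, `i = 1, 2`. -/
def w (u : Space d × ℝ → ℝ) (p : Space d × ℝ) : ℝ :=
  ∑ i, (M.sub i).indicator (fun x => M.Ψ (M.truncCap i (u (x, p.2)))) p.1

/-- Weak solutions of the problem `(𝒫̃)`, with the truncated capillary pressures connected through
`w ∈ L²(0,T;H¹(Ω))`. -/
structure IsTruncatedWeakSolution (u : Space d × ℝ → ℝ) : Prop where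
  isSaturation : M.IsSaturation u
  memL2H1 : MemL2H1 M.Ω M.T (M.w u)
  solves : M.SolvesWeakly u

end Medium

end

end TwoPhaseFlow

namespace TwoPhaseFlow

open MeasureTheory Set Filter Topology
open scoped ContDiff

set_option linter.unusedSectionVars false

/-! ### Weak directional derivatives and integration along segments -/

section WeakDeriv

variable {E : Type*} [NormedAddCommGroup E] [NormedSpace ℝ E] [FiniteDimensional ℝ E]
  [MeasurableSpace E] [BorelSpace E] {μ : Measure E} [μ.IsAddHaarMeasure]

/-! The two notions of solution share the conditions (1), (2) and (4), so what has to be shown is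
that, given these, connecting the capillary pressures on the interface is the same as `w` being in
`L²(0,T;H¹(Ω))`. By Fubini this reduces to a statement about almost every time slice.

Inside one subdomain nothing is at stake. The substitution `a = π_i(s)` and `min_j λ_j ≤ λ_i` show
that `Ψ(π̂_i(s))` varies no more than `φ_i(s)`, so it equals `F_i(φ_i(s))` with `F_i` 1-Lipschitz
and differentiable off four points (`exists_lipschitz_transition`). The chain rule
`HasWeakDeriv.comp_lipschitz` then gives `w` a gradient in `Ω_i`, bounded by that of `φ_i(u_i)`.
Pointwise, the monotone graphs at two saturations meet exactly when the truncated pressures agree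
(`capGraph_inter_nonempty_iff`). As `Ψ` is strictly increasing, the graph condition says that `w`
has the same trace from both sides of the interface. What remains is the classical fact that a
piecewise `H¹` function is `H¹` across the interface exactly when its traces agree.

Traces are handled as Lebesgue limits (`LebLim`): the integral of `|v - c|` over the part of a small
ball is `o(r^d)`. Two facts carry the argument. First, a function with an integrable weak derivative
transverse to a hyperplane is, in flat coordinates, `γ(y)` plus a primitive in the normal variable,
so it has a Lebesgue limit at almost every point of the hyperplane, from one side or from both
(`HasWeakDeriv.ae_hyperplane_exists_lebLim`). Second, a hyperplane is removable for a bounded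
function that has two-sided Lebesgue limits at almost all its points
(`HasWeakDeriv.of_diff_hyperplane'`): cutting off a layer of width `ε` produces an error weighted by
a profile of mean zero, which does not see the limit value.

If the graphs meet, `w` has two-sided limits almost everywhere on the hyperplanes carrying the
boundaries, and these are removed one by one. Conversely, at almost every point of the interface a
single hyperplane passes and the subdomains are its two sides locally (`ae_interface_sides`). There
`φ_i(u_i)` has one-sided limits, the limit of `w` restricts to both sides, and uniqueness of limits
at points of positive density gives equal values of `Ψ ∘ π̂_i`. -/

/-- `g` is the weak derivative of `v` in the direction `e` on the open set `U`. The integrals are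
over the whole space: only the values of `v` and `g` on `U` matter. -/
def HasWeakDeriv (μ : Measure E) (U : Set E) (v g : E → ℝ) (e : E) : Prop :=
  ∀ θ : E → ℝ, ContDiff ℝ ∞ θ → HasCompactSupport θ → tsupport θ ⊆ U →
    ∫ x, v x * fderiv ℝ θ x e ∂μ = - ∫ x, g x * θ x ∂μ

lemma HasWeakDeriv.mono {U V : Set E} {v g : E → ℝ} {e : E} (h : HasWeakDeriv μ U v g e)
    (hVU : V ⊆ U) : HasWeakDeriv μ V v g e :=
  fun θ h1 h2 h3 => h θ h1 h2 (h3.trans hVU)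

instance isFiniteMeasure_restrict_uIoc (a b : ℝ) : IsFiniteMeasure (volume.restrict (uIoc a b)) := by
  rw [uIoc]; infer_instance

/-- Each slice `x ↦ x + s • e` is a translation. This supplies the joint integrability behind every
exchange of `∫ ds` and `∫ dx`. -/
lemma measurePreserving_shear (e : E) (h : ℝ) :
    MeasurePreserving (fun p : ℝ × E => (p.1, p.2 + p.1 • e))
      ((volume.restrict (uIoc 0 h)).prod μ) ((volume.restrict (uIoc 0 h)).prod μ) := by
  refine (MeasurePreserving.id _).skew_product (g := fun s x => x + s • e) ?_ ?_
  · fun_prop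
  · exact ae_of_all _ fun s => (measurePreserving_add_right μ (s • e)).map_eq

lemma integrable_comp_add_smul {g : E → ℝ} (hg : Integrable g μ) (e : E) (h : ℝ) :
    Integrable (fun p : ℝ × E => g (p.2 + p.1 • e)) ((volume.restrict (uIoc 0 h)).prod μ) := by
  have h1 : Integrable (fun p : ℝ × E => g p.2) ((volume.restrict (uIoc 0 h)).prod μ) :=
    hg.comp_snd _
  exact (measurePreserving_shear e h).integrable_comp_of_integrable h1

lemma integrable_integral_add_smul {g : E → ℝ} (hg : Integrable g μ) (e : E) (h : ℝ) :
    Integrable (fun x : E => ∫ s in (0 : ℝ)..h, g (x + s • e)) μ := by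
  simp_rw [intervalIntegral.intervalIntegral_eq_integral_uIoc]
  exact ((integrable_comp_add_smul hg e h).integral_prod_right).smul (if 0 ≤ h then (1:ℝ) else -1)

lemma tsupport_comp_sub {θ : E → ℝ} (a : E) :
    tsupport (fun x => θ (x - a)) = (fun x => x - a) ⁻¹' tsupport θ := by
  have := tsupport_comp_eq_preimage θ (Homeomorph.subRight a)
  exact this

lemma exists_bound_of_hasCompactSupport {F : Type*} [NormedAddCommGroup F] {θ : E → F}
    (hc : Continuous θ) (hs : HasCompactSupport θ) : ∃ C, 0 ≤ C ∧ ∀ x, ‖θ x‖ ≤ C := by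
  obtain ⟨C, hC⟩ := hs.exists_bound_of_continuous hc
  exact ⟨C, (norm_nonneg _).trans (hC 0), hC⟩

/-- Integrating a weak derivative along a segment. -/
theorem HasWeakDeriv.sub_eq_integral {U V : Set E} {v g : E → ℝ} {e : E}
    (hw : HasWeakDeriv μ U v g e) (hv : Integrable v μ) (hg : Integrable g μ) (hV : IsOpen V)
    {h : ℝ} (hUV : ∀ x ∈ V, ∀ s ∈ uIcc 0 h, x + s • e ∈ U) :
    ∀ᵐ x ∂μ, x ∈ V → v (x + h • e) - v x = ∫ s in (0 : ℝ)..h, g (x + s • e) := by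
  have hR := integrable_integral_add_smul hg e h
  have hvh : Integrable (fun x => v (x + h • e)) μ := hv.comp_add_right (h • e)
  have key : ∀ᵐ x ∂μ, x ∈ V → (v (x + h • e) - v x - ∫ s in (0 : ℝ)..h, g (x + s • e)) = 0 := by
    refine hV.ae_eq_zero_of_integral_contDiff_smul_eq_zero
      (((hvh.sub hv).sub hR).locallyIntegrable.locallyIntegrableOn _) ?_
    intro θ hθ hθc hθV
    obtain ⟨C, hC0, hC⟩ := exists_bound_of_hasCompactSupport hθ.continuous hθc
    have hdθ : Continuous (fun x => fderiv ℝ θ x e) :=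
      (hθ.continuous_fderiv (by simp)).clm_apply continuous_const
    obtain ⟨C', hC'0, hC'⟩ := exists_bound_of_hasCompactSupport hdθ
      ((hθc.fderiv (𝕜 := ℝ)).comp_left (g := fun (L : E →L[ℝ] ℝ) => L e) rfl)
    have hmul : ∀ {f : E → ℝ}, Integrable f μ → Integrable (fun x => θ x * f x) μ := fun hf =>
      hf.bdd_mul hθ.continuous.aestronglyMeasurable (ae_of_all _ hC)
    simp only [smul_eq_mul]
    have e1 : ∫ x, θ x * (v (x + h • e) - v x - (∫ s in (0 : ℝ)..h, g (x + s • e))) ∂μ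
        = (∫ x, θ x * v (x + h • e) ∂μ) - (∫ x, θ x * v x ∂μ)
          - ∫ x, θ x * (∫ s in (0 : ℝ)..h, g (x + s • e)) ∂μ := by
      have i1 : Integrable (fun x => θ x * v (x + h • e) - θ x * v x) μ := (hmul hvh).sub (hmul hv)
      simp_rw [mul_sub]
      rw [integral_sub i1 (hmul hR), integral_sub (hmul hvh) (hmul hv)]
    have e2 : ∫ x, θ x * v (x + h • e) ∂μ = ∫ x, θ (x - h • e) * v x ∂μ := by
      rw [← integral_add_right_eq_self (fun x => θ (x - h • e) * v x) (h • e)]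
      simp
    -- the segment derivative of the translated test function
    have e3 : ∀ x, θ (x - h • e) - θ x = - ∫ s in (0 : ℝ)..h, fderiv ℝ θ (x - s • e) e := by
      intro x
      have hd : ∀ s ∈ uIcc 0 h,
          HasDerivAt (fun s : ℝ => θ (x - s • e)) (-(fderiv ℝ θ (x - s • e) e)) s := by
        intro s _
        have h1 : HasDerivAt (fun s : ℝ => x - s • e) (-e) s := by
          simpa using ((hasDerivAt_id s).smul_const e).const_sub x
        have h2 := ((hθ.differentiable (by simp)) (x - s • e)).hasFDerivAt.comp_hasDerivAt s h1
        rw [map_neg] at h2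
        exact h2
      have := intervalIntegral.integral_eq_sub_of_hasDerivAt hd
        (Continuous.intervalIntegrable (by fun_prop) _ _)
      rw [intervalIntegral.integral_neg] at this
      simp only [zero_smul, sub_zero] at this
      exact this.symm
    have hsub : (∫ x, θ (x - h • e) * v x ∂μ) - (∫ x, θ x * v x ∂μ)
        = - ∫ x, (∫ s in (0 : ℝ)..h, v x * fderiv ℝ θ (x - s • e) e) ∂μ := by
      have hm : Integrable (fun x => θ (x - h • e) * v x) μ :=
        hv.bdd_mul (by fun_prop) (ae_of_all _ fun x => hC _)
      rw [← integral_sub hm (hmul hv), ← integral_neg]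
      congr 1; funext x
      rw [intervalIntegral.integral_const_mul, ← sub_mul, e3 x]; ring
    have hfub : Integrable (fun p : ℝ × E => v p.2 * fderiv ℝ θ (p.2 - p.1 • e) e)
        ((volume.restrict (uIoc 0 h)).prod μ) := by
      refine (hv.comp_snd _).mul_bdd (c := C') ?_ (ae_of_all _ fun x => hC' _)
      exact (hdθ.comp (by fun_prop : Continuous fun p : ℝ × E => p.2 - p.1 • e)).aestronglyMeasurable
    have hfub2 : Integrable (fun p : ℝ × E => θ p.2 * g (p.2 + p.1 • e))
        ((volume.restrict (uIoc 0 h)).prod μ) := by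
      refine (integrable_comp_add_smul hg e h).bdd_mul (c := C) ?_ (ae_of_all _ fun x => hC _)
      exact (hθ.continuous.comp continuous_snd).aestronglyMeasurable
    have e4 : ∫ x, (∫ s in (0 : ℝ)..h, v x * fderiv ℝ θ (x - s • e) e) ∂μ
        = ∫ s in (0 : ℝ)..h, (∫ x, v x * fderiv ℝ θ (x - s • e) e ∂μ) :=
      (intervalIntegral_integral_swap hfub).symm
    have e5 : ∫ x, θ x * (∫ s in (0 : ℝ)..h, g (x + s • e)) ∂μ
        = ∫ s in (0 : ℝ)..h, ∫ x, θ x * g (x + s • e) ∂μ := by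
      simp_rw [← intervalIntegral.integral_const_mul]
      exact (intervalIntegral_integral_swap hfub2).symm
    -- The hypothesis on `V` makes every translate `θ (· - s • e)`, `s` between `0` and `h`, an
    -- admissible test function on `U`.
    have e6 : ∀ s ∈ uIcc 0 h, ∫ x, v x * fderiv ℝ θ (x - s • e) e ∂μ
        = - ∫ x, θ x * g (x + s • e) ∂μ := by
      intro s hs
      have := hw (fun x => θ (x - s • e)) (hθ.comp (contDiff_id.sub contDiff_const))
        (hθc.comp_homeomorph (Homeomorph.subRight (s • e))) (by
          rw [tsupport_comp_sub]
          intro x hx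
          have := hUV _ (hθV hx) s hs
          simpa using this)
      simp_rw [fderiv_comp_sub] at this
      rw [this]
      congr 1
      rw [← integral_add_right_eq_self (fun x => g x * θ (x - s • e)) (s • e)]
      simp [mul_comm]
    rw [e1, e2, hsub, e4, e5, intervalIntegral.integral_congr e6, intervalIntegral.integral_neg]
    ring
  filter_upwards [key] with x hx hxV
  linarith [hx hxV]

end WeakDeriv

/-! ### Difference quotients and the chain rule for Lipschitz functions with corners -/

section Chain

variable {E : Type*} [NormedAddCommGroup E] [NormedSpace ℝ E] [FiniteDimensional ℝ E]
  [MeasurableSpace E] [BorelSpace E] {μ : Measure E} [μ.IsAddHaarMeasure]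

/-- Translations are continuous in `L¹`. -/
lemma tendsto_integral_norm_translate_sub {f : E → ℝ} (hf : Integrable f μ) :
    Tendsto (fun a : E => ∫ x, ‖f (x + a) - f x‖ ∂μ) (𝓝 0) (𝓝 0) := by
  have : Fact ((1 : ENNReal) ≠ ⊤) := ⟨ENNReal.one_ne_top⟩
  have hc : Continuous fun a : E => (DomAddAct.mk a) +ᵥ (hf.toL1 f) :=
    (DomAddAct.continuous_mk).vadd continuous_const
  have h0 : Tendsto (fun a : E => ‖(DomAddAct.mk a +ᵥ hf.toL1 f) - hf.toL1 f‖) (𝓝 0) (𝓝 0) := by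
    have := ((hc.sub (continuous_const (y := hf.toL1 f))).norm).tendsto 0
    simpa using this
  refine h0.congr fun a => ?_
  rw [L1.norm_eq_integral_norm]
  refine integral_congr_ae ?_
  have hmp : MeasurePreserving (fun x : E => a + x) μ μ := measurePreserving_add_left μ a
  have h1 := DomAddAct.vadd_Lp_ae_eq (DomAddAct.mk a) (hf.toL1 f)
  have h2 := hmp.quasiMeasurePreserving.ae_eq_comp hf.coeFn_toL1
  filter_upwards [Lp.coeFn_sub (DomAddAct.mk a +ᵥ hf.toL1 f) (hf.toL1 f), h1, h2, hf.coeFn_toL1]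
    with x e1 e2 e3 e4
  simp only [Pi.sub_apply, Function.comp, vadd_eq_add, Equiv.symm_apply_apply] at e1 e2 e3 e4
  rw [e1, e2, e4, e3, add_comm]

lemma exists_subseq_tendsto_ae {X : Type*} [MeasurableSpace X] {ν : Measure X} {f : ℕ → X → ℝ}
    {g : X → ℝ} (hf : ∀ n, Integrable (f n) ν) (hg : Integrable g ν)
    (h : Tendsto (fun n => ∫ x, |f n x - g x| ∂ν) atTop (𝓝 0)) :
    ∃ ns : ℕ → ℕ, StrictMono ns ∧
      ∀ᵐ x ∂ν, Tendsto (fun k => f (ns k) x) atTop (𝓝 (g x)) := by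
  refine TendstoInMeasure.exists_seq_tendsto_ae (tendstoInMeasure_of_tendsto_eLpNorm
    (p := 1) one_ne_zero (fun n => (hf n).aestronglyMeasurable) hg.aestronglyMeasurable ?_)
  have := ENNReal.tendsto_ofReal h
  rw [ENNReal.ofReal_zero] at this
  refine this.congr fun n => ?_
  rw [eLpNorm_one_eq_lintegral_enorm, ← ofReal_integral_norm_eq_lintegral_enorm ((hf n).sub hg)]
  rfl

/-- Difference quotients converge to the weak derivative in `L¹`. -/
lemma HasWeakDeriv.tendsto_diffQuot {U V : Set E} {v g : E → ℝ} {e : E}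
    (hw : HasWeakDeriv μ U v g e) (hv : Integrable v μ) (hg : Integrable g μ) (hV : IsOpen V)
    {η : ℝ} (hη : 0 < η) (hUV : ∀ x ∈ V, ∀ s ∈ Icc 0 η, x + s • e ∈ U) :
    Tendsto (fun h : ℝ => ∫ x in V, |h⁻¹ * (v (x + h • e) - v x) - g x| ∂μ) (𝓝[>] 0) (𝓝 0) := by
  rw [Metric.tendsto_nhds]
  intro ε hε
  have h1 : Tendsto (fun s : ℝ => ∫ x, ‖g (x + s • e) - g x‖ ∂μ) (𝓝 0) (𝓝 0) := by
    refine (tendsto_integral_norm_translate_sub hg).comp ?_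
    have : Continuous fun s : ℝ => s • e := by fun_prop
    simpa using this.tendsto 0
  have h2 := (Metric.tendsto_nhds.1 h1) (ε / 2) (by positivity)
  obtain ⟨δ, hδ, hδε⟩ := Metric.eventually_nhds_iff.1 h2
  filter_upwards [Ioo_mem_nhdsGT (lt_min hη hδ)] with h hh
  obtain ⟨hh0, hh1⟩ := hh
  have hhη : h < η := hh1.trans_le (min_le_left _ _)
  have hhδ : h < δ := hh1.trans_le (min_le_right _ _)
  have hae := hw.sub_eq_integral hv hg hV (h := h) (fun x hx s hs => hUV x hx s (by
    rw [uIcc_of_le hh0.le] at hs; exact ⟨hs.1, hs.2.trans hhη.le⟩))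
  have hI1 : Integrable (fun p : ℝ × E => g (p.2 + p.1 • e) - g p.2)
      ((volume.restrict (uIoc 0 h)).prod μ) :=
    (integrable_comp_add_smul hg e h).sub (hg.comp_snd _)
  have hI2 : Integrable (fun x => ∫ s in (0 : ℝ)..h, ‖g (x + s • e) - g x‖) μ := by
    simp_rw [intervalIntegral.intervalIntegral_eq_integral_uIoc]
    exact (hI1.norm.integral_prod_right).smul (if 0 ≤ h then (1:ℝ) else -1)
  have hslice : ∀ᵐ x ∂μ, Integrable (fun s => g (x + s • e)) (volume.restrict (uIoc 0 h)) :=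
    (integrable_comp_add_smul hg e h).prod_left_ae
  have hle : ∀ᵐ x ∂(μ.restrict V), |h⁻¹ * (v (x + h • e) - v x) - g x|
      ≤ h⁻¹ * ∫ s in (0 : ℝ)..h, ‖g (x + s • e) - g x‖ := by
    refine (ae_restrict_iff' hV.measurableSet).2 ?_
    filter_upwards [hae, hslice] with x hx hx2 hxV
    have hii : IntervalIntegrable (fun s => g (x + s • e)) volume 0 h :=
      intervalIntegrable_iff.2 hx2
    have : h⁻¹ * (v (x + h • e) - v x) - g x = h⁻¹ * ∫ s in (0 : ℝ)..h, (g (x + s • e) - g x) := by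
      rw [intervalIntegral.integral_sub hii intervalIntegrable_const, ← hx hxV]
      simp; field_simp
    rw [this, abs_mul, abs_of_pos (inv_pos.2 hh0)]
    gcongr
    exact intervalIntegral.norm_integral_le_integral_norm (f := fun s => g (x + s • e) - g x) hh0.le
  -- The error is at most the mean over `s ∈ (0,h)` of the `L¹` distance from `g` to its translate
  -- by `s • e`.
  have hfin : ∫ x in V, |h⁻¹ * (v (x + h • e) - v x) - g x| ∂μ ≤ ε / 2 := by
    calc _ ≤ ∫ x in V, h⁻¹ * (∫ s in (0 : ℝ)..h, ‖g (x + s • e) - g x‖) ∂μ := by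
          refine integral_mono_of_nonneg (ae_of_all _ fun x => abs_nonneg _)
            (hI2.restrict.const_mul _) hle
      _ ≤ ∫ x, h⁻¹ * (∫ s in (0 : ℝ)..h, ‖g (x + s • e) - g x‖) ∂μ := by
          refine setIntegral_le_integral (hI2.const_mul _) (ae_of_all _ fun x => ?_)
          exact mul_nonneg (inv_pos.2 hh0).le
            (intervalIntegral.integral_nonneg hh0.le fun _ _ => norm_nonneg _)
      _ = h⁻¹ * ∫ s in (0 : ℝ)..h, (∫ x, ‖g (x + s • e) - g x‖ ∂μ) := by
          rw [integral_const_mul]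
          congr 1
          exact (intervalIntegral_integral_swap hI1.norm).symm
      _ ≤ h⁻¹ * (ε / 2 * |h - 0|) := by
          gcongr
          refine (Real.le_norm_self _).trans
            (intervalIntegral.norm_integral_le_of_norm_le_const fun s hs => ?_)
          rw [uIoc_of_le hh0.le] at hs
          have : |s| < δ := by rw [abs_of_pos hs.1]; exact hs.2.trans_lt hhδ
          have := @hδε s (by simpa using this)
          rw [dist_zero_right] at this
          exact this.le
      _ = ε / 2 := by rw [sub_zero, abs_of_pos hh0]; field_simp
  rw [dist_zero_right, Real.norm_eq_abs, abs_of_nonneg (integral_nonneg fun _ => abs_nonneg _)]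
  linarith

/-- At a point of differentiability this is the ordinary chain rule. At a corner `a ∈ S`, the values
`b n` lie in the finite set `S` and tend to `a`, hence are eventually equal to `a`. Then `q = 0` and
both sides vanish, whatever `deriv F a` is. -/
lemma tendsto_diffQuot_comp {F : ℝ → ℝ} {S : Set ℝ} (hS : S.Finite)
    (hd : ∀ p ∉ S, DifferentiableAt ℝ F p) {a q : ℝ} {h b : ℕ → ℝ} (hpos : ∀ n, 0 < h n)
    (hh : Tendsto h atTop (𝓝 0))
    (hq : Tendsto (fun n => (h n)⁻¹ * (b n - a)) atTop (𝓝 q))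
    (hSb : a ∈ S → ∀ᶠ n in atTop, b n ∈ S) :
    Tendsto (fun n => (h n)⁻¹ * (F (b n) - F a)) atTop (𝓝 (deriv F a * q)) := by
  have hb : Tendsto b atTop (𝓝 a) := by
    have h1 : Tendsto (fun n => a + h n * ((h n)⁻¹ * (b n - a))) atTop (𝓝 (a + 0 * q)) :=
      tendsto_const_nhds.add (hh.mul hq)
    rw [zero_mul, add_zero] at h1
    refine h1.congr fun n => ?_
    have := (hpos n).ne'
    field_simp; ring
  by_cases ha : a ∈ S
  · have h1 : ∀ᶠ n in atTop, b n = a := by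
      have h2 : (S \ {a})ᶜ ∈ 𝓝 a :=
        (hS.subset sdiff_subset).isClosed.isOpen_compl.mem_nhds (by simp)
      filter_upwards [hSb ha, hb h2] with n h3 h4
      by_contra hne
      exact h4 ⟨h3, hne⟩
    have hq0 : q = 0 := by
      refine tendsto_nhds_unique hq (tendsto_const_nhds.congr' ?_)
      filter_upwards [h1] with n hn
      simp [hn]
    rw [hq0, mul_zero]
    refine tendsto_const_nhds.congr' ?_
    filter_upwards [h1] with n hn
    simp [hn]
  · have h3 := (hd a ha).hasDerivAt.hasFDerivAt.hasFDerivWithinAt (s := univ) |>.lim (l := atTop)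
      (c := fun n => (h n)⁻¹) (d := fun n => b n - a) (v := q) ?_ (by simp) ?_
    · simpa [mul_comm] using h3
    · simpa using hb.sub_const a
    · simpa using hq

/-- Chain rule for a Lipschitz function with finitely many corners. -/
theorem HasWeakDeriv.comp_lipschitz {U : Set E} (hU : IsOpen U) (hμU : μ U ≠ ⊤) {v g : E → ℝ}
    {e : E} (hw : HasWeakDeriv μ U v g e) (hv : Integrable v μ) (hg : Integrable g μ)
    {F : ℝ → ℝ} (hF : LipschitzWith 1 F) (hF0 : F 0 = 0) {S : Set ℝ} (hS : S.Finite)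
    (hd : ∀ p ∉ S, DifferentiableAt ℝ F p) :
    HasWeakDeriv μ U (fun x => F (v x)) (fun x => deriv F (v x) * g x) e := by
  intro θ hθ hθc hθU
  obtain ⟨δ, hδ, hδU⟩ := hθc.isCompact.exists_cthickening_subset_open hU hθU
  set V := Metric.thickening (δ / 2) (tsupport θ) with hVdef
  have hV : IsOpen V := Metric.isOpen_thickening
  have hθV : tsupport θ ⊆ V := Metric.self_subset_thickening (by positivity) _
  -- Steps of length at most `η` move a point by at most `δ / 2`. The `+ 1` covers `e = 0`.
  set η := δ / (2 * (‖e‖ + 1)) with hηdef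
  have hη : 0 < η := by positivity
  have hUV : ∀ x ∈ V, ∀ s ∈ Icc 0 η, x + s • e ∈ U := by
    intro x hx s hs
    apply hδU
    apply Metric.thickening_subset_cthickening
    obtain ⟨z, hz, hxz⟩ := Metric.mem_thickening_iff.1 hx
    refine Metric.mem_thickening_iff.2 ⟨z, hz, ?_⟩
    have h1 : dist (x + s • e) x ≤ δ / 2 := by
      rw [dist_eq_norm, add_sub_cancel_left, norm_smul, Real.norm_eq_abs, abs_of_nonneg hs.1]
      calc s * ‖e‖ ≤ η * (‖e‖ + 1) := by
            have := hs.2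
            gcongr
            linarith
        _ = δ / 2 := by rw [hηdef]; field_simp
    linarith [dist_triangle (x + s • e) x z]
  -- the points of `V` whose value is a corner of `F`
  obtain ⟨v', hv'm, hvv'⟩ := hv.aestronglyMeasurable
  set A : Set E := {x ∈ U | v' x ∈ S} with hA
  have hAm : MeasurableSet A := hU.measurableSet.inter (hv'm.measurable hS.measurableSet)
  have hAi : Integrable (A.indicator fun _ => (1 : ℝ)) μ :=
    (integrable_indicator_iff hAm).2 (integrableOn_const
      (measure_ne_top_of_subset (fun x hx => hx.1) hμU))
  let h₀ : ℕ → ℝ := fun n => η / (n + 1)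
  have h₀pos : ∀ n, 0 < h₀ n := fun n => by positivity
  have h₀le : ∀ n, h₀ n ≤ η := fun n => by
    apply div_le_self hη.le; simp
  have h₀lim : Tendsto h₀ atTop (𝓝 0) := by
    have := (tendsto_one_div_add_atTop_nhds_zero_nat (𝕜 := ℝ)).const_mul η
    simpa [h₀, div_eq_mul_inv] using this
  have h₀lim' : Tendsto h₀ atTop (𝓝[>] 0) := tendsto_nhdsWithin_iff.2 ⟨h₀lim, .of_forall h₀pos⟩
  have hvi : ∀ h : ℝ, Integrable (fun x => v (x + h • e)) μ := fun h => hv.comp_add_right (h • e)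
  -- Along a subsequence the translated indicators of `A` converge almost everywhere, so for almost
  -- every `x ∈ A` the shifted points are eventually in `A`. This is the hypothesis of
  -- `tendsto_diffQuot_comp` at the corners.
  obtain ⟨n₁, hn₁, hA₁⟩ := exists_subseq_tendsto_ae (ν := μ)
    (f := fun n x => A.indicator (fun _ => (1 : ℝ)) (x + h₀ n • e))
    (fun n => hAi.comp_add_right (h₀ n • e)) hAi (by
      refine (tendsto_integral_norm_translate_sub hAi).comp (f := fun n => h₀ n • e) ?_
      simpa using h₀lim.smul_const e)
  have hq := hw.tendsto_diffQuot hv hg hV hη hUV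
  obtain ⟨n₂, hn₂, hq₂⟩ := exists_subseq_tendsto_ae (ν := μ.restrict V)
    (f := fun n x => (h₀ (n₁ n))⁻¹ * (v (x + h₀ (n₁ n) • e) - v x))
    (fun n => ((((hvi _).sub hv).const_mul _).restrict)) hg.restrict
    (hq.comp (h₀lim'.comp hn₁.tendsto_atTop))
  set h : ℕ → ℝ := fun k => h₀ (n₁ (n₂ k)) with hh
  have hsub : Tendsto (fun k => n₁ (n₂ k)) atTop atTop :=
    hn₁.tendsto_atTop.comp hn₂.tendsto_atTop
  have hpos : ∀ k, 0 < h k := fun k => h₀pos _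
  have hle : ∀ k, h k ≤ η := fun k => h₀le _
  have hlim : Tendsto h atTop (𝓝 0) := h₀lim.comp hsub
  have hlim' : Tendsto h atTop (𝓝[>] 0) := h₀lim'.comp hsub
  set q : ℕ → E → ℝ := fun k x => (h k)⁻¹ * (v (x + h k • e) - v x) with hqdef
  set D : ℕ → E → ℝ := fun k x => (h k)⁻¹ * (F (v (x + h k • e)) - F (v x)) with hDdef
  set m : E → ℝ := fun x => deriv F (v x) * g x with hmdef
  have hqint : ∀ k, Integrable (q k) μ := fun k => ((hvi _).sub hv).const_mul _
  have hFv : Integrable (fun x => F (v x)) μ := by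
    refine hv.mono (hF.continuous.comp_aestronglyMeasurable hv.aestronglyMeasurable)
      (ae_of_all _ fun x => ?_)
    simpa [hF0] using hF.norm_sub_le (v x) 0
  have hDint : ∀ k, Integrable (D k) μ := fun k =>
    ((hFv.comp_add_right (h k • e)).sub hFv).const_mul _
  have hderiv : ∀ p, ‖deriv F p‖ ≤ 1 := fun p => by
    simpa using norm_deriv_le_of_lipschitz (x₀ := p) hF
  have hmint : Integrable m μ := by
    refine hg.bdd_mul (c := 1) ?_ (ae_of_all _ fun x => hderiv _)
    exact ((measurable_deriv F).comp_aemeasurable hv.aemeasurable).aestronglyMeasurable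
  have hDq : ∀ k x, |D k x| ≤ |q k x| := by
    intro k x
    simp only [hDdef, hqdef, abs_mul]
    refine mul_le_mul_of_nonneg_left ?_ (abs_nonneg _)
    simpa using hF.norm_sub_le (v (x + h k • e)) (v x)
  have hml : ∀ x, |m x| ≤ |g x| := by
    intro x
    simp only [hmdef, abs_mul]
    exact mul_le_of_le_one_left (abs_nonneg _) (hderiv _)
  have hDlim : ∀ᵐ x ∂(μ.restrict V), Tendsto (fun k => D k x) atTop (𝓝 (m x)) := by
    have hshift : ∀ᵐ x ∂(μ.restrict V), ∀ k, v (x + h k • e) = v' (x + h k • e) := by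
      refine ae_restrict_of_ae (ae_all_iff.2 fun k => ?_)
      exact (measurePreserving_add_right μ (h k • e)).quasiMeasurePreserving.ae_eq_comp hvv'
    filter_upwards [hq₂, ae_restrict_of_ae hA₁, ae_restrict_mem hV.measurableSet, hshift,
      ae_restrict_of_ae hvv'] with x h1 h2 h3 h4 h5
    refine tendsto_diffQuot_comp (b := fun k => v (x + h k • e)) hS hd hpos hlim h1 fun h6 => ?_
    have hxA : x ∈ A := ⟨by simpa using hUV x h3 0 ⟨le_rfl, hη.le⟩, by rwa [← h5]⟩
    rw [indicator_of_mem hxA] at h2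
    have h7 := h2.comp hn₂.tendsto_atTop
    filter_upwards [h7.eventually (lt_mem_nhds (zero_lt_one))] with k hk
    rw [h4 k]
    by_contra hcon
    have : x + h k • e ∉ A := fun hmem => hcon hmem.2
    simp only [Function.comp] at hk
    rw [indicator_of_notMem this] at hk
    exact lt_irrefl _ hk
  have hqlim : Tendsto (fun k => ∫ x in V, |q k x - g x| ∂μ) atTop (𝓝 0) := hq.comp hlim'
  have hZ : Tendsto (fun k => ∫ x in V, |D k x - m x| ∂μ) atTop (𝓝 0) := by
    -- The quotients `D k` have no fixed majorant, but `|D k| ≤ |q k|` and `q k → g` in `L¹`. The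
    -- excess of `|D k - m|` over `|q k - g|` is dominated by `2 |g|` and tends to `0` almost
    -- everywhere.
    have hY : Tendsto (fun k => ∫ x in V, max (|D k x - m x| - |q k x - g x|) 0 ∂μ) atTop
        (𝓝 (∫ x in V, 0 ∂μ)) := by
      refine tendsto_integral_of_dominated_convergence (fun x => 2 * |g x|) (fun k => ?_)
        (hg.abs.const_mul 2).restrict (fun k => ae_of_all _ fun x => ?_) ?_
      · exact (((((hDint k).sub hmint).abs.sub ((hqint k).sub hg).abs).sup
          (integrable_zero E ℝ μ)).aestronglyMeasurable).restrict
      · rw [Real.norm_eq_abs, abs_of_nonneg (le_max_right _ _)]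
        refine max_le ?_ (by positivity)
        have a1 := abs_sub (D k x) (m x)
        have a2 := hDq k x
        have a3 := hml x
        have a4 : |q k x| ≤ |q k x - g x| + |g x| := by
          simpa using abs_add_le (q k x - g x) (g x)
        linarith
      · filter_upwards [hDlim] with x hx
        refine squeeze_zero (fun k => le_max_right _ _) (fun k => ?_)
          (by simpa using (hx.sub_const (m x)).abs)
        exact max_le (by linarith [abs_nonneg (q k x - g x)]) (abs_nonneg _)
    rw [integral_zero] at hY
    refine squeeze_zero (fun k => integral_nonneg fun _ => abs_nonneg _) (fun k => ?_)
      (by simpa using hY.add hqlim)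
    rw [← integral_add]
    · refine integral_mono ((hDint k).sub hmint).abs.restrict ?_ fun x => ?_
      · exact (((((hDint k).sub hmint).abs.sub ((hqint k).sub hg).abs).sup
          (integrable_zero E ℝ μ)).add ((hqint k).sub hg).abs).restrict
      · have := le_max_left (|D k x - m x| - |q k x - g x|) 0
        linarith
    · exact ((((hDint k).sub hmint).abs.sub ((hqint k).sub hg).abs).sup
          (integrable_zero E ℝ μ)).restrict
    · exact ((hqint k).sub hg).abs.restrict
  obtain ⟨C, hC0, hC⟩ := exists_bound_of_hasCompactSupport hθ.continuous hθc
  have hmul : ∀ {f : E → ℝ}, Integrable f μ → Integrable (fun x => θ x * f x) μ := fun hf =>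
    hf.bdd_mul hθ.continuous.aestronglyMeasurable (ae_of_all _ hC)
  have hlim1 : Tendsto (fun k => ∫ x, θ x * D k x ∂μ) atTop (𝓝 (∫ x, θ x * m x ∂μ)) := by
    rw [tendsto_iff_norm_sub_tendsto_zero]
    refine squeeze_zero (fun _ => norm_nonneg _) (fun k => ?_) (by simpa using hZ.const_mul C)
    rw [← integral_sub (hmul (hDint k)) (hmul hmint), ← integral_const_mul]
    have e1 : ∫ x, (θ x * D k x - θ x * m x) ∂μ = ∫ x in V, (θ x * D k x - θ x * m x) ∂μ := by
      refine (setIntegral_eq_integral_of_forall_compl_eq_zero fun x hx => ?_).symm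
      have : θ x = 0 := image_eq_zero_of_notMem_tsupport fun h => hx (hθV h)
      simp [this]
    rw [e1]
    refine norm_integral_le_of_norm_le (((hDint k).sub hmint).abs.const_mul C).restrict
      (ae_of_all _ fun x => ?_)
    rw [← mul_sub, norm_mul]
    exact mul_le_mul_of_nonneg_right (hC x) (norm_nonneg _)
  -- Discrete integration by parts: the difference quotient is moved to the test function, where it
  -- converges to `-∂_e θ`.
  have hlim2 : Tendsto (fun k => ∫ x, θ x * D k x ∂μ) atTop
      (𝓝 (∫ x, F (v x) * (-(fderiv ℝ θ x e)) ∂μ)) := by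
    have e1 : ∀ k, ∫ x, θ x * D k x ∂μ
        = ∫ x, F (v x) * ((h k)⁻¹ * (θ (x - h k • e) - θ x)) ∂μ := by
      intro k
      have i1 : Integrable (fun x => θ x * F (v (x + h k • e))) μ :=
        hmul (hFv.comp_add_right (h k • e))
      have i2 : Integrable (fun x => θ (x - h k • e) * F (v x)) μ :=
        hFv.bdd_mul (c := C) (by have := hθ.continuous; fun_prop) (ae_of_all _ fun x => hC _)
      have e2 : ∫ x, θ x * F (v (x + h k • e)) ∂μ = ∫ x, θ (x - h k • e) * F (v x) ∂μ := by
        rw [← integral_add_right_eq_self (fun x => θ (x - h k • e) * F (v x)) (h k • e)]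
        simp
      calc ∫ x, θ x * D k x ∂μ
          = ∫ x, (h k)⁻¹ * (θ x * F (v (x + h k • e)) - θ x * F (v x)) ∂μ := by
            congr 1; ext x; simp only [hDdef]; ring
        _ = (h k)⁻¹ * ((∫ x, θ x * F (v (x + h k • e)) ∂μ) - ∫ x, θ x * F (v x) ∂μ) := by
            rw [integral_const_mul, integral_sub i1 (hmul hFv)]
        _ = ∫ x, (h k)⁻¹ * (θ (x - h k • e) * F (v x) - θ x * F (v x)) ∂μ := by
            rw [integral_const_mul, e2, integral_sub i2 (hmul hFv)]
        _ = _ := by congr 1; ext x; ring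
    simp_rw [e1]
    obtain ⟨L, hL⟩ := hθ.lipschitzWith_of_hasCompactSupport hθc (by simp)
    refine tendsto_integral_of_dominated_convergence (fun x => |F (v x)| * (L * ‖e‖)) (fun k => ?_)
      (hFv.abs.mul_const _) (fun k => ae_of_all _ fun x => ?_) (ae_of_all _ fun x => ?_)
    · exact hFv.aestronglyMeasurable.mul (Continuous.aestronglyMeasurable
        (by have := hθ.continuous; fun_prop))
    · rw [norm_mul, Real.norm_eq_abs]
      gcongr
      rw [norm_mul, norm_inv, Real.norm_eq_abs, abs_of_pos (hpos k)]
      have := hL.norm_sub_le (x - h k • e) x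
      rw [sub_sub_cancel_left, norm_neg, norm_smul, Real.norm_of_nonneg (hpos k).le] at this
      calc (h k)⁻¹ * ‖θ (x - h k • e) - θ x‖ ≤ (h k)⁻¹ * (L * (h k * ‖e‖)) := by
            have := (inv_pos.2 (hpos k)).le
            gcongr
        _ = L * ‖e‖ := by have := (hpos k).ne'; field_simp
    · refine Tendsto.const_mul _ ?_
      have h3 := (hθ.differentiable (by simp) x).hasFDerivAt.hasFDerivWithinAt (s := univ) |>.lim
        (l := atTop) (c := fun k => (h k)⁻¹) (d := fun k => -(h k • e)) (v := -e)
        (by simpa using (hlim.smul_const e).neg) (by simp) (by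
          refine tendsto_const_nhds.congr fun k => ?_
          rw [smul_neg, smul_smul, inv_mul_cancel₀ (hpos k).ne', one_smul])
      simpa [sub_eq_add_neg] using h3
  have := tendsto_nhds_unique hlim1 hlim2
  simp only [mul_neg, integral_neg] at this
  have e9 : ∫ x, θ x * m x ∂μ = ∫ x, m x * θ x ∂μ := by simp_rw [mul_comm]
  rw [e9] at this
  linarith

end Chain

/-! ### Existence of Lebesgue limits on the hyperplane `F × {0}` -/

/-- `c` is the limit at `x` of `v` restricted to `S`, in the sense of Lebesgue: the integral of
`|v - c|` over `S ∩ B(x,r)` is `o(rⁿ)`, where `n` is the dimension of the space. -/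
def LebLim {E : Type*} [PseudoMetricSpace E] [MeasurableSpace E] (μ : Measure E) (n : ℕ)
    (S : Set E) (v : E → ℝ) (x : E) (c : ℝ) : Prop :=
  (fun r : ℝ => ∫ y in S ∩ Metric.ball x r, |v y - c| ∂μ) =o[𝓝[>] 0] fun r => r ^ n

section FlatTrace

variable {F : Type*} [NormedAddCommGroup F] [NormedSpace ℝ F] [FiniteDimensional ℝ F]
  [MeasurableSpace F] [BorelSpace F] {μ : Measure F} [μ.IsAddHaarMeasure]

/-- The moving endpoint is put into the integrand: the interval integral is a difference of two
integrals over the line of `g` times indicators of sets measurable in all the variables. -/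
lemma stronglyMeasurable_primitive {g : F × ℝ → ℝ} (hg : StronglyMeasurable g) :
    StronglyMeasurable fun p : F × ℝ => ∫ σ in (0 : ℝ)..p.2, g (p.1, σ) := by
  have hmeas : ∀ A : Set ((F × ℝ) × ℝ), MeasurableSet A →
      StronglyMeasurable fun p : F × ℝ => ∫ σ, A.indicator (fun z => g (z.1.1, z.2)) (p, σ) := by
    intro A hA
    refine StronglyMeasurable.integral_prod_right'
      (f := A.indicator (fun z : (F × ℝ) × ℝ => g (z.1.1, z.2))) ?_
    exact (hg.comp_measurable (by fun_prop)).indicator hA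
  have h1 := hmeas ({z | 0 < z.2} ∩ {z | z.2 ≤ z.1.2})
    ((measurableSet_lt (by fun_prop) (by fun_prop)).inter
      (measurableSet_le (by fun_prop) (by fun_prop)))
  have h2 := hmeas ({z | z.1.2 < z.2} ∩ {z | z.2 ≤ 0})
    ((measurableSet_lt (by fun_prop) (by fun_prop)).inter
      (measurableSet_le (by fun_prop) (by fun_prop)))
  convert h1.sub h2 using 1
  ext p
  rw [intervalIntegral, ← integral_indicator measurableSet_Ioc,
    ← integral_indicator measurableSet_Ioc]
  rfl

lemma integrable_primitive {g : F × ℝ → ℝ} (hg : StronglyMeasurable g)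
    (hgi : Integrable g (μ.prod volume)) (l₁ l₂ : ℝ) :
    Integrable (fun p : F × ℝ => ∫ σ in (0 : ℝ)..p.2, g (p.1, σ))
      (μ.prod (volume.restrict (Ioo l₁ l₂))) := by
  have h1 : Integrable (fun p : F × ℝ => ∫ σ, ‖g (p.1, σ)‖)
      (μ.prod (volume.restrict (Ioo l₁ l₂))) := hgi.norm.integral_prod_left.comp_fst _
  have h2 : ∀ᵐ y ∂μ, Integrable (fun σ => g (y, σ)) := hgi.prod_right_ae
  refine h1.mono (stronglyMeasurable_primitive hg).aestronglyMeasurable ?_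
  have h3 : ∀ᵐ p ∂(μ.prod (volume.restrict (Ioo l₁ l₂))), Integrable (fun σ => g (p.1, σ)) :=
    Measure.quasiMeasurePreserving_fst.ae h2
  filter_upwards [h3] with p hp
  rw [Real.norm_of_nonneg (integral_nonneg fun _ => norm_nonneg _)]
  exact (intervalIntegral.norm_integral_le_integral_norm_uIoc).trans
    (setIntegral_le_integral hp.norm (ae_of_all _ fun _ => norm_nonneg _))

/-- On a cylinder, a function with an integrable weak vertical derivative is the sum of a function
of the horizontal variable and of the vertical primitive of its derivative. -/
lemma exists_eq_add_primitive {U : Set (F × ℝ)} {v g : F × ℝ → ℝ}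
    (hw : HasWeakDeriv (μ.prod volume) U v g (0, 1)) (hvm : StronglyMeasurable v)
    (hgm : StronglyMeasurable g) (hv : Integrable v (μ.prod volume))
    (hg : Integrable g (μ.prod volume)) {B : Set F} (hB : IsOpen B) {l₁ l₂ : ℝ} (hl : l₁ < l₂)
    (hU : B ×ˢ Ioo l₁ l₂ ⊆ U) :
    ∃ γ : F → ℝ, Integrable γ μ ∧ ∀ᵐ p ∂(μ.prod volume), p ∈ B ×ˢ Ioo l₁ l₂ →
      v p = γ p.1 + ∫ σ in (0 : ℝ)..p.2, g (p.1, σ) := by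
  set J := Ioo l₁ l₂
  set z : F × ℝ → ℝ := fun p => v p - ∫ σ in (0 : ℝ)..p.2, g (p.1, σ) with hz
  have hzm : StronglyMeasurable z := hvm.sub (stronglyMeasurable_primitive hgm)
  have hle : μ.prod (volume.restrict J) ≤ μ.prod volume :=
    Measure.prod_mono le_rfl Measure.restrict_le_self
  have hzi : Integrable z (μ.prod (volume.restrict J)) :=
    (hv.mono_measure hle).sub (integrable_primitive hgm hg l₁ l₂)
  have hgy : ∀ᵐ p : F × ℝ ∂(μ.prod volume), Integrable (fun σ => g (p.1, σ)) :=
    Measure.quasiMeasurePreserving_fst.ae hg.prod_right_ae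
  -- Subtracting the primitive leaves a function invariant under vertical translations, with an
  -- exceptional set that depends on `h`. Fubini (`hae`) exchanges the quantifiers, so that almost
  -- every vertical slice of `z` is almost everywhere constant on `J`.
  have hstep : ∀ h : ℝ, ∀ᵐ p ∂(μ.prod volume), p.1 ∈ B ∧ p.2 ∈ J ∧ p.2 + h ∈ J →
      z (p.1, p.2 + h) = z p := by
    intro h
    have hVo : IsOpen {p : F × ℝ | p.1 ∈ B ∧ p.2 ∈ J ∧ p.2 + h ∈ J} :=
      (hB.preimage continuous_fst).inter ((isOpen_Ioo.preimage continuous_snd).inter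
        (isOpen_Ioo.preimage (continuous_snd.add continuous_const)))
    have key := hw.sub_eq_integral hv hg hVo (h := h) (by
      rintro p ⟨h1, h2, h3⟩ s hs
      refine hU ⟨by simpa using h1, ?_⟩
      have hcv : OrdConnected J := ordConnected_Ioo
      refine hcv.uIcc_subset h2 h3 ?_
      have : p.2 + s ∈ uIcc (p.2 + 0) (p.2 + h) := by
        rw [← image_const_add_uIcc]
        exact mem_image_of_mem _ hs
      simpa using this)
    filter_upwards [key, hgy] with p h1 h2 h3
    have h4 := h1 h3
    have e1 : p + h • ((0, 1) : F × ℝ) = (p.1, p.2 + h) := by ext <;> simp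
    have e2 : ∀ s : ℝ, p + s • ((0, 1) : F × ℝ) = (p.1, p.2 + s) := fun s => by ext <;> simp
    simp_rw [e2] at h4
    rw [intervalIntegral.integral_comp_add_left (fun s => g (p.1, s)), add_zero] at h4
    have h5 := intervalIntegral.integral_add_adjacent_intervals
      (h2.intervalIntegrable (a := 0) (b := p.2)) (h2.intervalIntegrable (a := p.2) (b := p.2 + h))
    simp only [hz]
    linarith
  have hms : MeasurableSet {x : ℝ × (F × ℝ) | x.2.1 ∈ B ∧ x.2.2 ∈ J ∧ x.2.2 + x.1 ∈ J →
      z (x.2.1, x.2.2 + x.1) = z x.2} := by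
    have m1 : MeasurableSet {x : ℝ × (F × ℝ) | x.2.1 ∈ B ∧ x.2.2 ∈ J ∧ x.2.2 + x.1 ∈ J} :=
      ((hB.measurableSet.preimage (by fun_prop)).inter
        ((measurableSet_Ioo.preimage (by fun_prop : Measurable fun x : ℝ × (F × ℝ) => x.2.2)).inter
        (measurableSet_Ioo.preimage
          (by fun_prop : Measurable fun x : ℝ × (F × ℝ) => x.2.2 + x.1))))
    have m2 : MeasurableSet {x : ℝ × (F × ℝ) | z (x.2.1, x.2.2 + x.1) = z x.2} :=
      measurableSet_eq_fun (hzm.measurable.comp (by fun_prop)) (hzm.measurable.comp (by fun_prop))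
    exact m1.imp m2
  have hae := (Measure.ae_ae_comm (μ := volume) (ν := μ.prod volume)
    (p := fun (h : ℝ) (p : F × ℝ) => p.1 ∈ B ∧ p.2 ∈ J ∧ p.2 + h ∈ J →
      z (p.1, p.2 + h) = z p) hms).1 (ae_of_all _ hstep)
  -- The constant of a slice is recovered as its mean over `J`, which is measurable and integrable
  -- in `y`.
  refine ⟨fun y => (l₂ - l₁)⁻¹ * ∫ t in J, z (y, t), hzi.integral_prod_left.const_mul _, ?_⟩
  filter_upwards [hae] with p hp hpB
  have h1 : ∀ᵐ t, t ∈ J → z (p.1, t) = z p := by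
    have := (measurePreserving_sub_right volume p.2).quasiMeasurePreserving.ae hp
    filter_upwards [this] with t ht htJ
    have := ht ⟨hpB.1, hpB.2, by simpa using htJ⟩
    simpa using this
  have h2 : ∫ t in J, z (p.1, t) = (l₂ - l₁) * z p := by
    rw [setIntegral_congr_ae measurableSet_Ioo h1]
    simp [hl.le]
  rw [h2, inv_mul_cancel_left₀ (sub_pos.2 hl).ne']
  simp [hz]

end FlatTrace

section FlatTrace

variable {F : Type*} [NormedAddCommGroup F] [NormedSpace ℝ F] [FiniteDimensional ℝ F]
  [MeasurableSpace F] [BorelSpace F] {μ : Measure F} [μ.IsAddHaarMeasure]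

lemma ball_prod_zero (y : F) (ρ : ℝ) (K : Set ℝ) :
    (univ ×ˢ K) ∩ Metric.ball (y, (0 : ℝ)) ρ = Metric.ball y ρ ×ˢ (K ∩ Ioo (-ρ) ρ) := by
  rw [← ball_prod_same, Real.ball_eq_Ioo, prod_inter_prod, univ_inter, zero_sub, zero_add]

lemma setIntegral_closedBall_prod (f : F → ℝ) (y : F) {ρ : ℝ} (hρ : 0 < ρ) :
    ∫ p in Metric.closedBall y ρ ×ˢ Icc (-ρ) ρ, f p.1 ∂(μ.prod volume)
      = 2 * μ.real (Metric.ball 0 1) * ρ ^ (Module.finrank ℝ F + 1)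
        * ⨍ z in Metric.closedBall y ρ, f z ∂μ := by
  have h1 := setIntegral_prod_mul (μ := μ) (ν := volume) f (fun _ => (1 : ℝ))
    (Metric.closedBall y ρ) (Icc (-ρ) ρ)
  simp only [mul_one] at h1
  have h2 : μ.real (Metric.closedBall y ρ) = ρ ^ Module.finrank ℝ F * μ.real (Metric.ball 0 1) := by
    rw [Measure.real, Measure.addHaar_closedBall μ y hρ.le, ENNReal.toReal_mul,
      ENNReal.toReal_ofReal (by positivity)]
    rfl
  have h3 : 0 < μ.real (Metric.ball (0 : F) 1) :=
    ENNReal.toReal_pos (Metric.measure_ball_pos μ 0 one_pos).ne' measure_ball_lt_top.ne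
  rw [h1, setAverage_eq, h2]
  have h4 : ∫ _ in Icc (-ρ) ρ, (1 : ℝ) = 2 * ρ := by simp; rw [max_eq_left (by linarith)]; ring
  rw [h4, smul_eq_mul]
  have := pow_pos hρ (Module.finrank ℝ F)
  field_simp
  ring

/-- For `|p.2| ≤ δ k` the primitive is bounded by `G k p.1`, the integral of `|g (p.1, ·)|` over
`[-δ k, δ k]`. Take `y` to be a Lebesgue point of `γ` and of all the countably many `G k`, with `g
(y, ·)` integrable, so that `G k y → 0`. Choosing `k` first and the radius afterwards makes the mean
of `|v - γ y|` small. -/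
lemma lebLim_of_eq_add_primitive {v g : F × ℝ → ℝ}
    (hg : Integrable g (μ.prod volume)) {B : Set F} (hB : IsOpen B) {J : Set ℝ} {γ : F → ℝ} (hγ : Integrable γ μ)
    (hae : ∀ᵐ p ∂(μ.prod volume), p ∈ B ×ˢ J → v p = γ p.1 + ∫ σ in (0 : ℝ)..p.2, g (p.1, σ))
    {K : Set ℝ} (hKm : MeasurableSet K) {ρ₀ : ℝ} (hρ₀ : 0 < ρ₀) (hK : K ∩ Ioo (-ρ₀) ρ₀ ⊆ J) :
    ∀ᵐ y ∂μ, y ∈ B →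
      LebLim (μ.prod volume) (Module.finrank ℝ F + 1) (univ ×ˢ K) v (y, 0) (γ y) := by
  set δ : ℕ → ℝ := fun k => 1 / ((k : ℝ) + 1) with hδ
  have hδpos : ∀ k, 0 < δ k := fun k => by positivity
  have hδlim : Tendsto δ atTop (𝓝 0) := tendsto_one_div_add_atTop_nhds_zero_nat
  set G : ℕ → F → ℝ := fun k y => ∫ σ in Icc (-δ k) (δ k), ‖g (y, σ)‖ with hG
  have hGi : ∀ k, Integrable (G k) μ := fun k => by
    have : Integrable (fun p => ‖g p‖) (μ.prod (volume.restrict (Icc (-δ k) (δ k)))) :=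
      hg.norm.mono_measure (Measure.prod_mono le_rfl Measure.restrict_le_self)
    exact this.integral_prod_left
  have hGnn : ∀ k y, 0 ≤ G k y := fun k y => integral_nonneg fun _ => norm_nonneg _
  have hLγ := IsUnifLocDoublingMeasure.ae_tendsto_average_norm_sub μ hγ.locallyIntegrable 0
  have hLG : ∀ᵐ y ∂μ, ∀ k, _ := ae_all_iff.2 fun k =>
    IsUnifLocDoublingMeasure.ae_tendsto_average_norm_sub μ (hGi k).locallyIntegrable 0
  have hgy : ∀ᵐ p : F × ℝ ∂(μ.prod volume), Integrable (fun σ => g (p.1, σ)) :=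
    Measure.quasiMeasurePreserving_fst.ae hg.prod_right_ae
  filter_upwards [hLγ, hLG, hg.prod_right_ae] with y hy1 hy2 hy3 hyB
  have a1 : Tendsto (fun ρ => ⨍ z in Metric.closedBall y ρ, ‖γ z - γ y‖ ∂μ) (𝓝[>] 0) (𝓝 0) :=
    hy1 (fun _ => y) (fun ρ => ρ) tendsto_id (by simp)
  have a2 : ∀ k, Tendsto (fun ρ => ⨍ z in Metric.closedBall y ρ, ‖G k z - G k y‖ ∂μ)
      (𝓝[>] 0) (𝓝 0) :=
    fun k => hy2 k (fun _ => y) (fun ρ => ρ) tendsto_id (by simp)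
  have a3 : Tendsto (fun k => G k y) atTop (𝓝 0) := by
    have h1 := tendsto_setIntegral_of_antitone (μ := volume) (f := fun σ => ‖g (y, σ)‖)
      (s := fun k => Icc (-δ k) (δ k)) (fun k => measurableSet_Icc) (by
        intro i j hij
        have : δ j ≤ δ i := by simp only [hδ]; gcongr
        exact Icc_subset_Icc (by linarith) this) ⟨0, hy3.norm.integrableOn⟩
    have h2 : ⋂ k, Icc (-δ k) (δ k) = {(0 : ℝ)} := by
      ext x
      simp only [mem_iInter, mem_Icc, mem_singleton_iff]
      constructor
      · intro h
        have u1 := ge_of_tendsto' hδlim (fun k => (h k).2)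
        have u2 := le_of_tendsto' (by simpa using hδlim.neg) (fun k => (h k).1)
        linarith
      · rintro rfl k
        constructor <;> linarith [hδpos k]
    rw [h2] at h1
    simpa [hG] using h1
  set κ := μ.real (Metric.ball (0 : F) 1) with hκ
  have hκpos : 0 < κ :=
    ENNReal.toReal_pos (Metric.measure_ball_pos μ 0 one_pos).ne' measure_ball_lt_top.ne
  rw [LebLim, Asymptotics.isLittleO_iff]
  intro c hc
  -- The majorant `f` has three terms, each allotted a third. The factor `2 * κ` is the volume of
  -- the cylinder divided by `ρ ^ (finrank + 1)`.
  obtain ⟨k, hk⟩ := (a3.eventually (gt_mem_nhds (by positivity : 0 < c / (2 * κ) / 3))).exists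
  obtain ⟨r₀, hr₀, hr₀B⟩ := Metric.isOpen_iff.1 hB y hyB
  filter_upwards [a1.eventually (gt_mem_nhds (by positivity : 0 < c / (2 * κ) / 3)),
    (a2 k).eventually (gt_mem_nhds (by positivity : 0 < c / (2 * κ) / 3)),
    Ioo_mem_nhdsGT (lt_min hr₀ (lt_min hρ₀ (hδpos k)))] with ρ h1 h2 hρ
  obtain ⟨hρ0, hρ1⟩ := hρ
  have hρr : ρ < r₀ := hρ1.trans_le (min_le_left _ _)
  have hρρ : ρ < ρ₀ := hρ1.trans_le ((min_le_right _ _).trans (min_le_left _ _))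
  have hρδ : ρ < δ k := hρ1.trans_le ((min_le_right _ _).trans (min_le_right _ _))
  rw [Real.norm_of_nonneg (integral_nonneg fun _ => abs_nonneg _),
    Real.norm_of_nonneg (by positivity), ball_prod_zero]
  set f : F → ℝ := fun z => ‖γ z - γ y‖ + ‖G k z - G k y‖ + G k y with hf
  have hfi : ∀ s : Set F, μ s ≠ ⊤ → IntegrableOn f s μ := fun s hs =>
    ((hγ.integrableOn.sub (integrableOn_const hs)).norm.add
      ((hGi k).integrableOn.sub (integrableOn_const hs)).norm).add (integrableOn_const hs)
  have hfi' : IntegrableOn (fun p : F × ℝ => f p.1) (Metric.closedBall y ρ ×ˢ Icc (-ρ) ρ)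
      (μ.prod volume) := by
    rw [IntegrableOn, ← Measure.prod_restrict]
    exact Integrable.comp_fst (hfi _ measure_closedBall_lt_top.ne) _
  have hsub : Metric.ball y ρ ×ˢ (K ∩ Ioo (-ρ) ρ) ⊆ Metric.closedBall y ρ ×ˢ Icc (-ρ) ρ :=
    prod_mono Metric.ball_subset_closedBall (inter_subset_right.trans Ioo_subset_Icc_self)
  calc ∫ p in Metric.ball y ρ ×ˢ (K ∩ Ioo (-ρ) ρ), |v p - γ y| ∂(μ.prod volume)
      ≤ ∫ p in Metric.ball y ρ ×ˢ (K ∩ Ioo (-ρ) ρ), f p.1 ∂(μ.prod volume) := by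
        refine integral_mono_of_nonneg (ae_of_all _ fun _ => abs_nonneg _)
          (hfi'.mono_set hsub) ?_
        refine (ae_restrict_iff' (Metric.isOpen_ball.measurableSet.prod
          (hKm.inter measurableSet_Ioo))).2 ?_
        filter_upwards [hae, hgy] with p hp1 hp2 hp3
        have hpJ : p.2 ∈ J := hK ⟨hp3.2.1, by linarith [hp3.2.2.1], by linarith [hp3.2.2.2]⟩
        have hpB : p.1 ∈ B := hr₀B (Metric.ball_subset_ball hρr.le hp3.1)
        have hle : ‖∫ σ in (0 : ℝ)..p.2, g (p.1, σ)‖ ≤ G k p.1 := by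
          refine intervalIntegral.norm_integral_le_integral_norm_uIoc.trans ?_
          refine setIntegral_mono_set hp2.norm.integrableOn (ae_of_all _ fun _ => norm_nonneg _)
            (LE.le.eventuallyLE (uIoc_subset_uIcc.trans
              (uIcc_subset_Icc ?_ ?_)))
          · constructor <;> linarith [hδpos k]
          · constructor <;> linarith [hp3.2.2.1, hp3.2.2.2]
        rw [hp1 ⟨hpB, hpJ⟩]
        rw [Real.norm_eq_abs] at hle
        have u1 := abs_add_le (γ p.1 - γ y) (∫ σ in (0 : ℝ)..p.2, g (p.1, σ))
        have u2 : G k p.1 ≤ |G k p.1 - G k y| + G k y := by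
          linarith [le_abs_self (G k p.1 - G k y)]
        have u3 : γ p.1 + (∫ σ in (0 : ℝ)..p.2, g (p.1, σ)) - γ y
          = (γ p.1 - γ y) + ∫ σ in (0 : ℝ)..p.2, g (p.1, σ) := by ring
        simp only [hf, Real.norm_eq_abs]
        rw [u3]
        linarith
    _ ≤ ∫ p in Metric.closedBall y ρ ×ˢ Icc (-ρ) ρ, f p.1 ∂(μ.prod volume) := by
        refine setIntegral_mono_set hfi' (ae_of_all _ fun p => ?_)
          (LE.le.eventuallyLE hsub)
        have := hGnn k y
        simp only [hf, Pi.zero_apply]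
        positivity
    _ = 2 * κ * ρ ^ (Module.finrank ℝ F + 1) * ⨍ z in Metric.closedBall y ρ, f z ∂μ :=
        setIntegral_closedBall_prod f y hρ0
    _ ≤ 2 * κ * ρ ^ (Module.finrank ℝ F + 1) * (c / (2 * κ)) := by
        gcongr
        have hμ := (measure_closedBall_lt_top (μ := μ) (x := y) (r := ρ)).ne
        have hμ0 : μ (Metric.closedBall y ρ) ≠ 0 := (Metric.measure_closedBall_pos μ y hρ0).ne'
        have hμr : μ.real (Metric.closedBall y ρ) ≠ 0 := (ENNReal.toReal_pos hμ0 hμ).ne'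
        have i1 : IntegrableOn (fun z => ‖γ z - γ y‖) (Metric.closedBall y ρ) μ :=
          (hγ.integrableOn.sub (integrableOn_const hμ)).norm
        have i2 : IntegrableOn (fun z => ‖G k z - G k y‖) (Metric.closedBall y ρ) μ :=
          ((hGi k).integrableOn.sub (integrableOn_const hμ)).norm
        have e1 : ⨍ z in Metric.closedBall y ρ, f z ∂μ
            = (⨍ z in Metric.closedBall y ρ, ‖γ z - γ y‖ ∂μ)
              + (⨍ z in Metric.closedBall y ρ, ‖G k z - G k y‖ ∂μ) + G k y := by
          simp only [setAverage_eq, hf]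
          have i3 : IntegrableOn (fun z => ‖γ z - γ y‖ + ‖G k z - G k y‖)
            (Metric.closedBall y ρ) μ := i1.add i2
          rw [integral_add i3 (integrableOn_const hμ), integral_add i1 i2, setIntegral_const]
          simp only [smul_eq_mul]
          field_simp
        rw [e1]
        linarith
    _ = c * ρ ^ (Module.finrank ℝ F + 1) := by field_simp

lemma LebLim.congr_ae {E : Type*} [PseudoMetricSpace E] [MeasurableSpace E] {ν : Measure E} {n : ℕ}
    {S : Set E} {v w : E → ℝ} {x : E} {c : ℝ} (h : LebLim ν n S v x c) (hvw : v =ᵐ[ν] w) :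
    LebLim ν n S w x c := by
  refine Asymptotics.IsLittleO.congr_left h fun r => integral_congr_ae (ae_restrict_of_ae ?_)
  filter_upwards [hvw] with y hy
  rw [hy]

lemma HasWeakDeriv.congr_ae {E : Type*} [NormedAddCommGroup E] [NormedSpace ℝ E]
    [MeasurableSpace E] {ν : Measure E} {U : Set E} {v w g k : E → ℝ} {e : E}
    (h : HasWeakDeriv ν U v g e) (hvw : v =ᵐ[ν] w) (hgk : g =ᵐ[ν] k) : HasWeakDeriv ν U w k e := by
  intro θ h1 h2 h3
  have := h θ h1 h2 h3
  have e1 : ∫ x, v x * fderiv ℝ θ x e ∂ν = ∫ x, w x * fderiv ℝ θ x e ∂ν := integral_congr_ae (by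
    filter_upwards [hvw] with x hx
    rw [hx])
  have e2 : ∫ x, g x * θ x ∂ν = ∫ x, k x * θ x ∂ν := integral_congr_ae (by
    filter_upwards [hgk] with x hx
    rw [hx])
  rw [← e1, ← e2]
  exact this

/-- A function with an integrable weak vertical derivative on an open set `U` has a limit in the
sense of Lebesgue at almost every point of the hyperplane `F × {0}` near which `U` contains the
cylinder (or half cylinder) `F × K`. -/
theorem HasWeakDeriv.ae_exists_lebLim {U : Set (F × ℝ)} {v g : F × ℝ → ℝ}
    (hw : HasWeakDeriv (μ.prod volume) U v g (0, 1)) (hv : Integrable v (μ.prod volume))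
    (hg : Integrable g (μ.prod volume)) {K : Set ℝ} (hKm : MeasurableSet K)
    (hK : ∀ ρ > 0, ∃ l₁ l₂, l₁ < l₂ ∧ K ∩ Ioo (-ρ) ρ = Ioo l₁ l₂) :
    ∀ᵐ y ∂μ, (∃ r > 0, (univ ×ˢ K) ∩ Metric.ball (y, 0) r ⊆ U) →
      ∃ c, LebLim (μ.prod volume) (Module.finrank ℝ F + 1) (univ ×ˢ K) v (y, 0) c := by
  obtain ⟨v', hv'm, hvv'⟩ := hv.aestronglyMeasurable
  obtain ⟨g', hg'm, hgg'⟩ := hg.aestronglyMeasurable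
  have hw' := hw.congr_ae hvv' hgg'
  have hv' := hv.congr hvv'
  have hg' := hg.congr hgg'
  -- The cylinder contained in `U` depends on `y`. Cylinders over balls of radius `1 / (k + 1)`
  -- around a dense sequence suffice, so only countably many null sets are discarded.
  have key : ∀ i k : ℕ, ∀ᵐ y ∂μ, y ∈ Metric.ball (TopologicalSpace.denseSeq F i) (1 / ((k : ℝ) + 1)) →
      Metric.ball (TopologicalSpace.denseSeq F i) (1 / ((k : ℝ) + 1)) ×ˢ
        (K ∩ Ioo (-(1 / ((k : ℝ) + 1))) (1 / ((k : ℝ) + 1))) ⊆ U →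
      ∃ c, LebLim (μ.prod volume) (Module.finrank ℝ F + 1) (univ ×ˢ K) v (y, 0) c := by
    intro i k
    have hpos : (0 : ℝ) < 1 / ((k : ℝ) + 1) := by positivity
    obtain ⟨l₁, l₂, hl, hKl⟩ := hK _ hpos
    by_cases hU : Metric.ball (TopologicalSpace.denseSeq F i) (1 / ((k : ℝ) + 1)) ×ˢ
        (K ∩ Ioo (-(1 / ((k : ℝ) + 1))) (1 / ((k : ℝ) + 1))) ⊆ U
    · rw [hKl] at hU
      obtain ⟨γ, hγ, hae⟩ := exists_eq_add_primitive hw' hv'm hg'm hv' hg' Metric.isOpen_ball hl hU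
      filter_upwards [lebLim_of_eq_add_primitive hg' Metric.isOpen_ball hγ hae
        hKm hpos hKl.subset] with y hy hyB _
      exact ⟨γ y, (hy hyB).congr_ae hvv'.symm⟩
    · exact ae_of_all _ fun y _ h => absurd h hU
  have key' := ae_all_iff.2 fun i => ae_all_iff.2 (key i)
  filter_upwards [key'] with y hy
  rintro ⟨r, hr, hrU⟩
  obtain ⟨k, hk⟩ := exists_nat_one_div_lt (show 0 < r / 2 by positivity)
  have hpos : (0 : ℝ) < 1 / ((k : ℝ) + 1) := by positivity
  obtain ⟨i, hi⟩ := (TopologicalSpace.denseRange_denseSeq F).exists_dist_lt y hpos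
  refine hy i k hi (Subset.trans ?_ hrU)
  rw [ball_prod_zero]
  refine prod_mono (Metric.ball_subset_ball' ?_) (inter_subset_inter_right _
    (Ioo_subset_Ioo (by linarith) (by linarith)))
  rw [dist_comm] at hi
  linarith

end FlatTrace

/-! ### Removability of the hyperplane `F × {0}` -/

section Removability

variable {F : Type*} [NormedAddCommGroup F] [NormedSpace ℝ F] [FiniteDimensional ℝ F]
  [MeasurableSpace F] [BorelSpace F] {μ : Measure F} [μ.IsAddHaarMeasure]

/-- Averaging over small balls does not change an integral. -/
lemma integral_average_ball {k : F → ℝ} (hk : Integrable k μ) {ε : ℝ} (hε : 0 < ε) :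
    Integrable (fun y => (μ.real (Metric.ball 0 ε))⁻¹ * ∫ z in Metric.ball y ε, k z ∂μ) μ ∧
      ∫ y, (μ.real (Metric.ball 0 ε))⁻¹ * (∫ z in Metric.ball y ε, k z ∂μ) ∂μ = ∫ y, k y ∂μ := by
  set m := μ.real (Metric.ball (0 : F) ε) with hm
  have hmpos : 0 < m :=
    ENNReal.toReal_pos (Metric.measure_ball_pos μ 0 hε).ne' measure_ball_lt_top.ne
  set b : F → ℝ := (Metric.ball 0 ε).indicator fun _ => m⁻¹ with hb
  have hbi : Integrable b μ := (integrable_indicator_iff Metric.isOpen_ball.measurableSet).2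
    (integrableOn_const measure_ball_lt_top.ne)
  have hbint : ∫ x, b x ∂μ = 1 := by
    rw [hb, integral_indicator Metric.isOpen_ball.measurableSet, setIntegral_const, smul_eq_mul,
      ← hm, mul_inv_cancel₀ hmpos.ne']
  have e1 : (fun y => m⁻¹ * ∫ z in Metric.ball y ε, k z ∂μ)
      = convolution k b (ContinuousLinearMap.mul ℝ ℝ) μ := by
    ext y
    simp only [convolution, ContinuousLinearMap.mul_apply']
    rw [← integral_const_mul, ← integral_indicator Metric.isOpen_ball.measurableSet]
    congr 1; ext z
    by_cases hz : z ∈ Metric.ball y ε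
    · have : y - z ∈ Metric.ball (0 : F) ε := by
        rw [mem_ball_zero_iff, ← dist_eq_norm, dist_comm]; exact hz
      rw [indicator_of_mem hz, hb, indicator_of_mem this, mul_comm]
    · have : y - z ∉ Metric.ball (0 : F) ε := by
        rw [mem_ball_zero_iff, ← dist_eq_norm, dist_comm]; exact hz
      rw [indicator_of_notMem hz, hb, indicator_of_notMem this, mul_zero]
  rw [e1]
  refine ⟨hk.integrable_convolution _ hbi, ?_⟩
  rw [integral_convolution _ hk hbi, hbint]
  simp

/-- Since `ζ` has mean zero, any constant may be subtracted from `f` on a vertical slice, in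
particular the limit `c` at a point `(y, 0)` close to it. The slice integrals are thus controlled by
the integral of `|f - c|` over a ball of radius `3 * ε`, which is `o` of its volume. Boundedness and
bounded horizontal support of `f` give the domination. -/
lemma tendsto_integral_mul_layer {f : F × ℝ → ℝ} (hf : Integrable f (μ.prod volume)) {M R : ℝ}
    (hM : ∀ p, |f p| ≤ M) (hR : ∀ p : F × ℝ, R ≤ ‖p.1‖ → f p = 0)
    (hL : ∀ᵐ y ∂μ, ∃ c, LebLim (μ.prod volume) (Module.finrank ℝ F + 1) univ f (y, 0) c)
    {ζ : ℝ → ℝ} (hζ : Continuous ζ) {Z : ℝ} (hZ : ∀ s, |ζ s| ≤ Z)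
    (hζs : ∀ s, s ∉ Ioo (-3 : ℝ) 3 → ζ s = 0) (hζ0 : ∫ s, ζ s = 0) :
    Tendsto (fun ε : ℝ => ∫ p, f p * (ε⁻¹ * ζ (p.2 / ε)) ∂(μ.prod volume)) (𝓝[>] 0) (𝓝 0) := by
  have hZ0 : 0 ≤ Z := (abs_nonneg _).trans (hZ 0)
  have hM0 : 0 ≤ M := (abs_nonneg _).trans (hM 0)
  set k : ℝ → F → ℝ := fun ε y => ∫ s, f (y, s) * (ε⁻¹ * ζ (s / ε)) with hk
  have hfζ : ∀ ε : ℝ, Integrable (fun p : F × ℝ => f p * (ε⁻¹ * ζ (p.2 / ε))) (μ.prod volume) :=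
    fun ε => hf.mul_bdd (c := |ε⁻¹| * Z) (by fun_prop)
      (ae_of_all _ fun p => by rw [norm_mul]; exact mul_le_mul_of_nonneg_left (hZ _) (norm_nonneg _))
  have hki : ∀ ε, Integrable (k ε) μ := fun ε => (hfζ ε).integral_prod_left
  have hζε : ∀ ε > 0, ∀ s, s ∉ Ioo (-(3 * ε)) (3 * ε) → ζ (s / ε) = 0 := by
    intro ε hε s hs
    refine hζs _ fun h => hs ?_
    have h1 := (lt_div_iff₀ hε).1 h.1
    have h2 := (div_lt_iff₀ hε).1 h.2
    exact ⟨by linarith, h2⟩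
  -- a bound for the slices, with a constant subtracted
  have hslice : ∀ ε > 0, ∀ c : ℝ, ∀ z, Integrable (fun s => f (z, s)) →
      |k ε z| ≤ ε⁻¹ * Z * ∫ s in Ioo (-(3 * ε)) (3 * ε), |f (z, s) - c| := by
    intro ε hε c z hz
    have e0 : ∫ s, c * (ε⁻¹ * ζ (s / ε)) = 0 := by
      rw [integral_const_mul, integral_const_mul, Measure.integral_comp_div ζ ε, hζ0]
      simp
    have hζi : Integrable (fun s => ζ (s / ε)) := by
      have : HasCompactSupport (fun s => ζ (s / ε)) := by
        refine HasCompactSupport.intro (isCompact_Icc (a := -(3 * ε)) (b := 3 * ε)) fun s hs => ?_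
        exact hζε ε hε s fun h => hs (Ioo_subset_Icc_self h)
      exact (hζ.comp (continuous_id.div_const ε)).integrable_of_hasCompactSupport this
    have i1 : Integrable (fun s => f (z, s) * (ε⁻¹ * ζ (s / ε))) :=
      hz.mul_bdd (c := |ε⁻¹| * Z) (by fun_prop) (ae_of_all _ fun p => by
        rw [norm_mul]; exact mul_le_mul_of_nonneg_left (hZ _) (norm_nonneg _))
    have i2 : Integrable (fun s => c * (ε⁻¹ * ζ (s / ε))) := (hζi.const_mul _).const_mul _
    have e1 : k ε z = ∫ s in Ioo (-(3 * ε)) (3 * ε), (f (z, s) - c) * (ε⁻¹ * ζ (s / ε)) := by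
      rw [setIntegral_eq_integral_of_forall_compl_eq_zero fun s hs => by
        rw [hζε ε hε s hs]; simp]
      simp_rw [sub_mul]
      rw [integral_sub i1 i2, e0, sub_zero]
    rw [e1, ← integral_const_mul, ← Real.norm_eq_abs]
    have hfin : volume (Ioo (-(3 * ε)) (3 * ε)) ≠ ⊤ := measure_Ioo_lt_top.ne
    refine norm_integral_le_of_norm_le
      ((hz.integrableOn.sub (integrableOn_const hfin)).abs.const_mul _) (ae_of_all _ fun s => ?_)
    rw [norm_mul, norm_mul, Real.norm_of_nonneg (inv_pos.2 hε).le, Real.norm_eq_abs,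
      Real.norm_eq_abs]
    have := mul_le_mul_of_nonneg_left (hZ (s / ε))
      (mul_nonneg (inv_pos.2 hε).le (abs_nonneg (f (z, s) - c)))
    linarith
  have hkb : ∀ ε > 0, ∀ z, Integrable (fun s => f (z, s)) → |k ε z| ≤ 6 * Z * M := by
    intro ε hε z hz
    refine (hslice ε hε 0 z hz).trans ?_
    have h1 : ∫ s in Ioo (-(3 * ε)) (3 * ε), |f (z, s) - 0| ≤ M * (6 * ε) := by
      have := norm_setIntegral_le_of_norm_le_const (μ := volume) (s := Ioo (-(3 * ε)) (3 * ε))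
        (f := fun s => |f (z, s) - 0|) (C := M) measure_Ioo_lt_top
        (fun s _ => by simpa using hM (z, s))
      rw [Real.volume_real_Ioo_of_le (by linarith)] at this
      calc _ ≤ _ := Real.le_norm_self _
        _ ≤ _ := this
        _ = _ := by ring
    calc _ ≤ ε⁻¹ * Z * (M * (6 * ε)) := by
          have := inv_pos.2 hε
          gcongr
      _ = 6 * Z * M := by field_simp
  have hk0 : ∀ ε z, R ≤ ‖z‖ → k ε z = 0 := fun ε z hz => by
    simp only [hk]
    refine integral_eq_zero_of_ae (ae_of_all _ fun s => ?_)
    simp [hR (z, s) hz]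
  have hfsl : ∀ᵐ z ∂μ, Integrable (fun s => f (z, s)) := hf.prod_right_ae
  set m : ℝ → ℝ := fun ε => μ.real (Metric.ball (0 : F) ε) with hm
  have hmpos : ∀ ε > 0, 0 < m ε := fun ε hε =>
    ENNReal.toReal_pos (Metric.measure_ball_pos μ 0 hε).ne' measure_ball_lt_top.ne
  have hmball : ∀ ε (y : F), μ.real (Metric.ball y ε) = m ε := fun ε y => by
    simp only [hm, Measure.real, Measure.addHaar_ball_center]
  -- A Lebesgue limit says nothing about a single slice. Averaging the slices over horizontal balls
  -- of radius `ε` does not change the total integral and brings in full-dimensional neighbourhoods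
  -- of `(y, 0)`.
  set a : ℝ → F → ℝ := fun ε y => (m ε)⁻¹ * ∫ z in Metric.ball y ε, k ε z ∂μ with ha
  have e1 : ∀ ε > 0, ∫ p, f p * (ε⁻¹ * ζ (p.2 / ε)) ∂(μ.prod volume) = ∫ y, a ε y ∂μ := by
    intro ε hε
    rw [integral_prod _ (hfζ ε)]
    exact (integral_average_ball (hki ε) hε).2.symm
  have hlim : Tendsto (fun ε => ∫ y, a ε y ∂μ) (𝓝[>] 0) (𝓝 (∫ _, (0 : ℝ) ∂μ)) := by
    refine tendsto_integral_filter_of_dominated_convergence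
      ((Metric.ball (0 : F) (R + 1)).indicator fun _ => 6 * Z * M) ?_ ?_ ?_ ?_
    · filter_upwards [self_mem_nhdsWithin] with ε hε
      exact (integral_average_ball (hki ε) hε).1.aestronglyMeasurable
    · filter_upwards [Ioo_mem_nhdsGT (zero_lt_one' ℝ)] with ε hε
      refine ae_of_all _ fun y => ?_
      by_cases hy : y ∈ Metric.ball (0 : F) (R + 1)
      · rw [indicator_of_mem hy, norm_mul, norm_inv, Real.norm_of_nonneg (hmpos ε hε.1).le]
        have := norm_setIntegral_le_of_norm_le_const_ae (μ := μ) (s := Metric.ball y ε)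
          (f := k ε) (C := 6 * Z * M) measure_ball_lt_top
          (by filter_upwards [ae_restrict_of_ae hfsl] with z hz using hkb ε hε.1 z hz)
        rw [hmball] at this
        calc _ ≤ (m ε)⁻¹ * (6 * Z * M * m ε) := by
              have := inv_pos.2 (hmpos ε hε.1)
              gcongr
          _ = 6 * Z * M := by have := (hmpos ε hε.1).ne'; field_simp
      · rw [indicator_of_notMem hy]
        have : ∫ z in Metric.ball y ε, k ε z ∂μ = 0 := by
          refine setIntegral_eq_zero_of_forall_eq_zero fun z hz => hk0 ε z ?_
          rw [mem_ball_zero_iff, not_lt] at hy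
          rw [Metric.mem_ball, dist_eq_norm] at hz
          have h3 := norm_sub_norm_le y (y - z)
          rw [sub_sub_cancel] at h3
          rw [norm_sub_rev] at hz
          linarith [hε.2]
        simp [ha, this]
    · exact (integrable_indicator_iff Metric.isOpen_ball.measurableSet).2
        (integrableOn_const measure_ball_lt_top.ne)
    · filter_upwards [hL] with y hy
      obtain ⟨c, hc⟩ := hy
      have h3 : Tendsto (fun ε : ℝ => 3 * ε) (𝓝[>] 0) (𝓝[>] 0) := by
        refine tendsto_nhdsWithin_iff.2 ⟨?_, ?_⟩
        · have : Tendsto (fun ε : ℝ => 3 * ε) (𝓝 0) (𝓝 (3 * 0)) := tendsto_id.const_mul 3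
          rw [mul_zero] at this
          exact this.mono_left nhdsWithin_le_nhds
        · filter_upwards [self_mem_nhdsWithin] with ε hε
          exact mul_pos three_pos (mem_Ioi.1 hε)
      have h4 := (Asymptotics.IsLittleO.comp_tendsto hc h3).tendsto_div_nhds_zero
      set κ := μ.real (Metric.ball (0 : F) 1) with hκ
      have hκpos : 0 < κ := hmpos 1 one_pos
      have h5 := h4.const_mul (Z * 3 ^ (Module.finrank ℝ F + 1) * κ⁻¹)
      rw [mul_zero] at h5
      refine squeeze_zero_norm' ?_ h5
      filter_upwards [self_mem_nhdsWithin] with ε hε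
      have hε : 0 < ε := hε
      have hmε : m ε = ε ^ Module.finrank ℝ F * κ := by
        simp only [hm, hκ]
        rw [Measure.real, Measure.addHaar_ball_of_pos μ 0 hε, ENNReal.toReal_mul,
          ENNReal.toReal_ofReal (by positivity)]
        rfl
      have hQ : Metric.ball y ε ×ˢ Ioo (-(3 * ε)) (3 * ε) ⊆ univ ∩ Metric.ball (y, (0 : ℝ)) (3 * ε) := by
        rw [univ_inter, ← ball_prod_same, Real.ball_eq_Ioo, zero_sub, zero_add]
        exact prod_mono (Metric.ball_subset_ball (by linarith)) le_rfl
      have hBi : IntegrableOn (fun p => |f p - c|) (univ ∩ Metric.ball (y, (0 : ℝ)) (3 * ε))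
          (μ.prod volume) := by
        rw [univ_inter]
        exact (hf.integrableOn.sub (integrableOn_const measure_ball_lt_top.ne)).abs
      have hQi := hBi.mono_set hQ
      have hQi' := hQi
      rw [IntegrableOn, ← Measure.prod_restrict] at hQi'
      have hle : |∫ z in Metric.ball y ε, k ε z ∂μ|
          ≤ ε⁻¹ * Z * ∫ p in univ ∩ Metric.ball (y, (0 : ℝ)) (3 * ε), |f p - c| ∂(μ.prod volume) := by
        calc |∫ z in Metric.ball y ε, k ε z ∂μ|
            ≤ ∫ z in Metric.ball y ε, ε⁻¹ * Z * (∫ s in Ioo (-(3 * ε)) (3 * ε), |f (z, s) - c|) ∂μ := by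
              rw [← Real.norm_eq_abs]
              refine norm_integral_le_of_norm_le (hQi'.integral_prod_left.const_mul _) ?_
              filter_upwards [ae_restrict_of_ae hfsl] with z hz using hslice ε hε c z hz
          _ = ε⁻¹ * Z * ∫ p in Metric.ball y ε ×ˢ Ioo (-(3 * ε)) (3 * ε), |f p - c| ∂(μ.prod volume) := by
              rw [integral_const_mul, setIntegral_prod _ hQi]
          _ ≤ _ := by
              have := inv_pos.2 hε
              gcongr ε⁻¹ * Z * ?_
              exact setIntegral_mono_set hBi (ae_of_all _ fun _ => abs_nonneg _)
                (LE.le.eventuallyLE hQ)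
      simp only [ha, Function.comp, norm_mul, norm_inv, Real.norm_of_nonneg (hmpos ε hε).le]
      rw [Real.norm_eq_abs]
      calc _ ≤ (m ε)⁻¹ * (ε⁻¹ * Z * ∫ p in univ ∩ Metric.ball (y, (0 : ℝ)) (3 * ε), |f p - c| ∂(μ.prod volume)) := by
            have := inv_pos.2 (hmpos ε hε)
            gcongr
        _ = _ := by
            rw [hmε, mul_pow, pow_succ ε]
            have := pow_pos hε (Module.finrank ℝ F)
            field_simp
  rw [integral_zero] at hlim
  refine hlim.congr' ?_
  filter_upwards [self_mem_nhdsWithin] with ε hε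
  exact (e1 ε hε).symm

end Removability

section Removability

variable {F : Type*} [NormedAddCommGroup F] [NormedSpace ℝ F] [FiniteDimensional ℝ F]
  [MeasurableSpace F] [BorelSpace F] {μ : Measure F} [μ.IsAddHaarMeasure]

/-- A bounded function with limits in the sense of Lebesgue at almost every point of a hyperplane,
weakly differentiable off the hyperplane, is weakly differentiable across it. -/
theorem HasWeakDeriv.of_diff_hyperplane {U : Set (F × ℝ)} {w g : F × ℝ → ℝ}
    {e : F × ℝ} (hw : HasWeakDeriv (μ.prod volume) (U \ {p | p.2 = 0}) w g e)
    (hwi : Integrable w (μ.prod volume)) (hg : Integrable g (μ.prod volume)) {M : ℝ}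
    (hM : ∀ p, |w p| ≤ M)
    (hL : ∀ᵐ y ∂μ, (y, (0 : ℝ)) ∈ U →
      ∃ c, LebLim (μ.prod volume) (Module.finrank ℝ F + 1) univ w (y, 0) c) :
    HasWeakDeriv (μ.prod volume) U w g e := by
  intro θ hθ hθc hθU
  let χ : ContDiffBump (0 : ℝ) := ⟨1, 2, one_pos, one_lt_two⟩
  have hχ : ContDiff ℝ ∞ χ := χ.contDiff
  have hχ0 : ∀ s : ℝ, 2 ≤ |s| → χ s = 0 := fun s hs => χ.zero_of_le_dist (by simpa using hs)
  have hχd : Continuous (deriv χ) := hχ.continuous_deriv (by simp)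
  obtain ⟨Z, hZ0, hZ⟩ := exists_bound_of_hasCompactSupport hχd χ.hasCompactSupport.deriv
  obtain ⟨C, hC0, hC⟩ := exists_bound_of_hasCompactSupport hθ.continuous hθc
  have hdθ : Continuous (fun x => fderiv ℝ θ x e) :=
    (hθ.continuous_fderiv (by simp)).clm_apply continuous_const
  obtain ⟨C', hC'0, hC'⟩ := exists_bound_of_hasCompactSupport hdθ
    ((hθc.fderiv (𝕜 := ℝ)).comp_left (g := fun (L : F × ℝ →L[ℝ] ℝ) => L e) rfl)
  set cut : ℝ → F × ℝ → ℝ := fun ε p => 1 - χ (p.2 / ε) with hcut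
  have hcutc : ∀ ε, Continuous (cut ε) := fun ε =>
    continuous_const.sub (χ.continuous.comp (continuous_snd.div_const ε))
  have hcutb : ∀ ε p, ‖cut ε p‖ ≤ 1 := fun ε p => by
    rw [Real.norm_eq_abs, abs_le]
    have h1 := χ.nonneg (x := p.2 / ε)
    have h2 := χ.le_one (x := p.2 / ε)
    constructor <;> simp only [hcut] <;> linarith
  have hne : ∀ᵐ p ∂(μ.prod (volume : Measure ℝ)), p.2 ≠ 0 :=
    Measure.quasiMeasurePreserving_snd.ae (Measure.ae_ne volume 0)
  have hcutlim : ∀ p : F × ℝ, p.2 ≠ 0 → Tendsto (fun ε => cut ε p) (𝓝[>] 0) (𝓝 1) := by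
    intro p hp
    refine tendsto_const_nhds.congr' ?_
    filter_upwards [Ioo_mem_nhdsGT (show 0 < |p.2| / 2 by positivity)] with ε hε
    have : χ (p.2 / ε) = 0 := hχ0 _ (by
      rw [abs_div, abs_of_pos hε.1, le_div_iff₀ hε.1]; linarith [hε.2])
    simp [hcut, this]
  -- The function `cut ε` vanishes for `|p.2| ≤ ε`, so `cut ε * θ` is a test function off the
  -- hyperplane. Differentiating the cutoff produces the layer term, with profile `deriv χ`.
  have id1 : ∀ ε > 0, ∫ p, w p * (cut ε p * fderiv ℝ θ p e) ∂(μ.prod volume)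
      - e.2 * ∫ p, (w p * θ p) * (ε⁻¹ * deriv χ (p.2 / ε)) ∂(μ.prod volume)
      = - ∫ p, g p * (cut ε p * θ p) ∂(μ.prod volume) := by
    intro ε hε
    have hcd : ContDiff ℝ ∞ (cut ε) :=
      contDiff_const.sub (hχ.comp (contDiff_snd.div_const ε))
    have h1 := hw (fun p => cut ε p * θ p) (hcd.mul hθ) hθc.mul_left (by
      have hcl : IsClosed {p : F × ℝ | ε ≤ |p.2|} :=
        isClosed_le continuous_const continuous_snd.abs
      have hsub : tsupport (fun p => cut ε p * θ p) ⊆ {p : F × ℝ | ε ≤ |p.2|} := by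
        refine closure_minimal (fun p hp => ?_) hcl
        by_contra hlt
        simp only [mem_ofPred_eq, not_le] at hlt
        refine hp ?_
        have : χ (p.2 / ε) = 1 := χ.one_of_mem_closedBall (by
          rw [mem_closedBall_zero_iff, Real.norm_eq_abs, abs_div, abs_of_pos hε, div_le_iff₀ hε]
          simpa [χ] using hlt.le)
        simp [hcut, this]
      intro p hp
      refine ⟨hθU (tsupport_mul_subset_right hp), fun h0 => ?_⟩
      have h2 : ε ≤ |p.2| := hsub hp
      have h3 : p.2 = 0 := h0
      rw [h3, abs_zero] at h2
      linarith)
    have hd : ∀ p : F × ℝ, fderiv ℝ (fun p => cut ε p * θ p) p e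
        = cut ε p * fderiv ℝ θ p e - θ p * (e.2 * (ε⁻¹ * deriv χ (p.2 / ε))) := by
      intro p
      have d1 : HasFDerivAt (fun p : F × ℝ => p.2 / ε)
          (ε⁻¹ • ContinuousLinearMap.snd ℝ F ℝ) p := by
        have := (hasFDerivAt_snd (𝕜 := ℝ) (p := p)).const_mul ε⁻¹
        simpa only [div_eq_inv_mul] using this
      have d2 : HasDerivAt χ (deriv χ (p.2 / ε)) (p.2 / ε) :=
        (hχ.differentiable (by simp) _).hasDerivAt
      have d3 : HasFDerivAt (cut ε)
          (-(deriv χ (p.2 / ε) • ε⁻¹ • ContinuousLinearMap.snd ℝ F ℝ)) p := by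
        have := (d2.comp_hasFDerivAt p d1).const_sub 1
        exact this
      have d4 := (d3.mul (hθ.differentiable (by simp) p).hasFDerivAt).fderiv
      have d5 : fderiv ℝ (fun p => cut ε p * θ p) p = _ := d4
      rw [d5]
      simp
      ring
    simp_rw [hd] at h1
    rw [← h1, ← integral_const_mul, ← integral_sub]
    · congr 1; ext p; ring
    · refine hwi.mul_bdd (c := C') ((hcutc ε).mul hdθ).aestronglyMeasurable
        (ae_of_all _ fun p => ?_)
      rw [norm_mul]
      exact (mul_le_mul (hcutb ε p) (hC' p) (norm_nonneg _) zero_le_one).trans (one_mul _).le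
    · refine (Integrable.mul_bdd (c := |ε⁻¹| * Z) (hwi.mul_bdd (c := C)
        hθ.continuous.aestronglyMeasurable (ae_of_all _ hC)) (by fun_prop)
        (ae_of_all _ fun p => ?_)).const_mul _
      rw [norm_mul]
      exact mul_le_mul_of_nonneg_left (hZ _) (norm_nonneg _)
  have l1 : Tendsto (fun ε => ∫ p, w p * (cut ε p * fderiv ℝ θ p e) ∂(μ.prod volume)) (𝓝[>] 0)
      (𝓝 (∫ p, w p * fderiv ℝ θ p e ∂(μ.prod volume))) := by
    refine tendsto_integral_filter_of_dominated_convergence (fun p => |w p| * C')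
      (.of_forall fun ε => hwi.aestronglyMeasurable.mul ((hcutc ε).mul hdθ).aestronglyMeasurable)
      (.of_forall fun ε => ae_of_all _ fun p => ?_) (hwi.abs.mul_const _) ?_
    · rw [norm_mul, norm_mul]
      exact mul_le_mul_of_nonneg_left ((mul_le_mul (hcutb ε p) (hC' p) (norm_nonneg _)
        zero_le_one).trans (one_mul _).le) (norm_nonneg _)
    · filter_upwards [hne] with p hp
      simpa using ((hcutlim p hp).mul_const (fderiv ℝ θ p e)).const_mul (w p)
  have l2 : Tendsto (fun ε => ∫ p, g p * (cut ε p * θ p) ∂(μ.prod volume)) (𝓝[>] 0)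
      (𝓝 (∫ p, g p * θ p ∂(μ.prod volume))) := by
    refine tendsto_integral_filter_of_dominated_convergence (fun p => |g p| * C)
      (.of_forall fun ε => hg.aestronglyMeasurable.mul
        ((hcutc ε).mul hθ.continuous).aestronglyMeasurable)
      (.of_forall fun ε => ae_of_all _ fun p => ?_) (hg.abs.mul_const _) ?_
    · rw [norm_mul, norm_mul]
      exact mul_le_mul_of_nonneg_left ((mul_le_mul (hcutb ε p) (hC p) (norm_nonneg _)
        zero_le_one).trans (one_mul _).le) (norm_nonneg _)
    · filter_upwards [hne] with p hp
      simpa using ((hcutlim p hp).mul_const (θ p)).const_mul (g p)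
  -- This is the only place where the limits of `w` on the hyperplane enter. The profile `deriv χ`
  -- has mean zero because `χ` has compact support.
  have l3 : Tendsto (fun ε : ℝ => ∫ p, (w p * θ p) * (ε⁻¹ * deriv χ (p.2 / ε)) ∂(μ.prod volume))
      (𝓝[>] 0) (𝓝 0) := by
    obtain ⟨R, hR⟩ := hθc.isCompact.isBounded.subset_ball (0 : F × ℝ)
    refine tendsto_integral_mul_layer (M := M * C) (R := R) (Z := Z) (hwi.mul_bdd (c := C)
        hθ.continuous.aestronglyMeasurable (ae_of_all _ hC)) (fun p => ?_) (fun p hp => ?_) ?_ hχd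
        hZ (fun s hs => ?_) ?_
    · rw [abs_mul]
      exact mul_le_mul (hM p) (hC p) (abs_nonneg _) ((abs_nonneg _).trans (hM p))
    · have : θ p = 0 := image_eq_zero_of_notMem_tsupport fun h => by
        have h1 := hR h
        rw [mem_ball_zero_iff] at h1
        have h2 : ‖p.1‖ ≤ ‖p‖ := norm_fst_le p
        linarith
      simp [this]
    -- The product `w * θ` has the limit `c * θ (y, 0)` by continuity of `θ`. Away from the support
    -- of `θ`, where `w` need not have a limit, the product vanishes near the point.
    · filter_upwards [hL] with y hy
      by_cases hyU : (y, (0 : ℝ)) ∈ tsupport θ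
      · obtain ⟨c, hc⟩ := hy (hθU hyU)
        refine ⟨c * θ (y, 0), ?_⟩
        rw [LebLim, Asymptotics.isLittleO_iff] at hc ⊢
        intro η hη
        set V := (μ.prod (volume : Measure ℝ)).real (Metric.ball (0 : F × ℝ) 1) with hV
        have hVnn : 0 ≤ V := ENNReal.toReal_nonneg
        have hcont := Metric.continuousAt_iff.1 (hθ.continuous.continuousAt (x := (y, (0 : ℝ))))
          (η / 2 / ((|c| + 1) * (V + 1))) (by positivity)
        obtain ⟨δ, hδ, hδθ⟩ := hcont
        filter_upwards [hc (show 0 < η / 2 / (C + 1) by positivity), Ioo_mem_nhdsGT hδ]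
          with r h1 hr
        have hball := (measure_ball_lt_top (μ := μ.prod (volume : Measure ℝ))
          (x := (y, (0 : ℝ))) (r := r)).ne
        rw [univ_inter, Real.norm_of_nonneg (integral_nonneg fun _ => abs_nonneg _),
          Real.norm_of_nonneg (pow_nonneg hr.1.le _)] at h1 ⊢
        have i1 : IntegrableOn (fun p => |w p - c|) (Metric.ball (y, (0 : ℝ)) r)
          (μ.prod volume) := (hwi.integrableOn.sub (integrableOn_const hball)).abs
        have hvol : (μ.prod (volume : Measure ℝ)).real (Metric.ball (y, (0 : ℝ)) r)
            = r ^ (Module.finrank ℝ F + 1) * V := by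
          rw [Measure.real, Measure.addHaar_ball_of_pos _ _ hr.1, ENNReal.toReal_mul,
            ENNReal.toReal_ofReal (pow_nonneg hr.1.le _)]
          simp [hV, Measure.real]
        calc ∫ p in Metric.ball (y, (0 : ℝ)) r, |w p * θ p - c * θ (y, 0)| ∂(μ.prod volume)
            ≤ ∫ p in Metric.ball (y, (0 : ℝ)) r,
                (C * |w p - c| + |c| * (η / 2 / ((|c| + 1) * (V + 1)))) ∂(μ.prod volume) := by
              refine integral_mono_of_nonneg (ae_of_all _ fun _ => abs_nonneg _)
                ((i1.const_mul _).add (integrableOn_const hball)) ?_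
              filter_upwards [ae_restrict_mem Metric.isOpen_ball.measurableSet] with p hp
              have e1 : w p * θ p - c * θ (y, 0)
                = θ p * (w p - c) + c * (θ p - θ (y, 0)) := by ring
              rw [e1]
              refine (abs_add_le _ _).trans ?_
              rw [abs_mul, abs_mul]
              have h3 := hδθ (lt_of_lt_of_le hp hr.2.le)
              rw [dist_eq_norm, Real.norm_eq_abs] at h3
              exact add_le_add (mul_le_mul_of_nonneg_right (hC p) (abs_nonneg _))
                (mul_le_mul_of_nonneg_left h3.le (abs_nonneg _))
          _ = C * (∫ p in Metric.ball (y, (0 : ℝ)) r, |w p - c| ∂(μ.prod volume))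
                + r ^ (Module.finrank ℝ F + 1) * V * (|c| * (η / 2 / ((|c| + 1) * (V + 1)))) := by
              rw [integral_add (i1.const_mul _) (integrableOn_const hball), integral_const_mul,
                setIntegral_const, hvol, smul_eq_mul]
          _ ≤ C * (η / 2 / (C + 1) * r ^ (Module.finrank ℝ F + 1))
                + r ^ (Module.finrank ℝ F + 1) * V * (|c| * (η / 2 / ((|c| + 1) * (V + 1)))) := by
              gcongr
          _ = (η / 2) * r ^ (Module.finrank ℝ F + 1) * (C / (C + 1))
              + (η / 2) * r ^ (Module.finrank ℝ F + 1) * ((|c| / (|c| + 1)) * (V / (V + 1))) := by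
              field_simp
          _ ≤ (η / 2) * r ^ (Module.finrank ℝ F + 1) * 1
              + (η / 2) * r ^ (Module.finrank ℝ F + 1) * (1 * 1) := by
              have hrp := pow_pos hr.1 (Module.finrank ℝ F + 1)
              have q1 : C / (C + 1) ≤ 1 := (div_le_one (by positivity)).2 (by linarith)
              have q2 : |c| / (|c| + 1) ≤ 1 := (div_le_one (by positivity)).2 (by linarith)
              have q3 : V / (V + 1) ≤ 1 := (div_le_one (by positivity)).2 (by linarith)
              gcongr
          _ = η * r ^ (Module.finrank ℝ F + 1) := by ring
      · refine ⟨0, ?_⟩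
        have : ∀ᶠ r in 𝓝[>] (0 : ℝ), Metric.ball (y, (0 : ℝ)) r ⊆ (tsupport θ)ᶜ := by
          obtain ⟨δ, hδ, hδθ⟩ := Metric.isOpen_iff.1 (isClosed_tsupport θ).isOpen_compl _ hyU
          filter_upwards [Ioo_mem_nhdsGT hδ] with r hr
          exact (Metric.ball_subset_ball hr.2.le).trans hδθ
        refine Asymptotics.IsLittleO.congr' (Asymptotics.isLittleO_zero _ _) ?_ EventuallyEq.rfl
        filter_upwards [this] with r hr
        refine (setIntegral_eq_zero_of_forall_eq_zero fun p hp => ?_).symm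
        rw [image_eq_zero_of_notMem_tsupport (hr hp.2)]
        simp
    · have : χ =ᶠ[𝓝 s] 0 := by
        have ho : IsOpen {s : ℝ | 2 < |s|} := isOpen_lt continuous_const continuous_abs
        have hs2 : 2 < |s| := by
          by_contra hcon
          rw [not_lt, abs_le] at hcon
          exact hs ⟨by linarith, by linarith⟩
        filter_upwards [ho.mem_nhds hs2] with x hx
        exact hχ0 x (le_of_lt hx)
      rw [this.deriv_eq]
      simp
    · refine integral_eq_zero_of_hasDerivAt_of_integrable
        (fun x => (hχ.differentiable (by simp) x).hasDerivAt)
        (hχd.integrable_of_hasCompactSupport χ.hasCompactSupport.deriv)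
        (χ.continuous.integrable_of_hasCompactSupport χ.hasCompactSupport)
  have l4 := (l1.sub (l3.const_mul e.2)).congr' (by
    filter_upwards [self_mem_nhdsWithin] with ε hε
    exact id1 ε hε)
  have := tendsto_nhds_unique l4 l2.neg
  simpa using this

end Removability

/-! ### Transport of weak derivatives and Lebesgue limits by affine maps -/

section Affine

variable {E E' : Type*} [NormedAddCommGroup E] [NormedSpace ℝ E] [FiniteDimensional ℝ E]
  [MeasurableSpace E] [BorelSpace E] {μ : Measure E} [μ.IsAddHaarMeasure]
  [NormedAddCommGroup E'] [NormedSpace ℝ E'] [FiniteDimensional ℝ E']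
  [MeasurableSpace E'] [BorelSpace E'] {ν : Measure E'} [ν.IsAddHaarMeasure]

/-- The affine homeomorphism `x ↦ L x + p`. -/
def affineHomeo (L : E ≃L[ℝ] E') (p : E') : E ≃ₜ E' :=
  L.toHomeomorph.trans (Homeomorph.addRight p)

lemma affineHomeo_apply (L : E ≃L[ℝ] E') (p : E') (x : E) : affineHomeo L p x = L x + p := rfl

lemma affineHomeo_symm (L : E ≃L[ℝ] E') (p : E') :
    ((affineHomeo L p).symm : E' → E) = affineHomeo L.symm (-(L.symm p)) := by
  ext x
  rw [Homeomorph.symm_apply_eq, affineHomeo_apply, affineHomeo_apply]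
  simp

variable (μ ν) in
-- Uniqueness of Haar measure. The factor `k` appears on both sides of the identities defining weak
-- derivatives and only as a constant in `o(rⁿ)`, so its value is irrelevant.
lemma exists_map_affineHomeo (L : E ≃L[ℝ] E') (p : E') :
    ∃ k : NNReal, k ≠ 0 ∧ μ.map (affineHomeo L p) = k • ν := by
  have h1 : μ.map (affineHomeo L p) = (μ.map L).map (fun x => x + p) := by
    rw [Measure.map_map (by fun_prop) (by fun_prop)]
    rfl
  have h2 : (μ.map L).IsAddHaarMeasure := L.isAddHaarMeasure_map μ
  rw [h1, (measurePreserving_add_right (μ.map L) p).map_eq]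
  exact ⟨_, (Measure.addHaarScalarFactor_pos_of_isAddHaarMeasure (μ.map L) ν).ne',
    Measure.isAddLeftInvariant_eq_smul (μ.map L) ν⟩

lemma integral_comp_affineHomeo {L : E ≃L[ℝ] E'} {p : E'} {k : NNReal}
    (hk : μ.map (affineHomeo L p) = k • ν) (f : E' → ℝ) :
    ∫ x, f (affineHomeo L p x) ∂μ = k * ∫ y, f y ∂ν := by
  rw [← (affineHomeo L p).measurableEmbedding.integral_map, hk, integral_smul_nnreal_measure]
  rfl

lemma integrable_comp_affineHomeo {f : E' → ℝ} (hf : Integrable f ν) (L : E ≃L[ℝ] E') (p : E') :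
    Integrable (fun x => f (affineHomeo L p x)) μ := by
  obtain ⟨k, hk0, hk⟩ := exists_map_affineHomeo μ ν L p
  have : Integrable f (μ.map (affineHomeo L p)) := by
    rw [hk]; exact hf.smul_measure_nnreal
  exact ((affineHomeo L p).measurableEmbedding.integrable_map_iff).1 this

lemma HasWeakDeriv.comp_affineHomeo {U : Set E'} {v g : E' → ℝ} {e : E} (L : E ≃L[ℝ] E') (p : E')
    (h : HasWeakDeriv ν U v g (L e)) :
    HasWeakDeriv μ (affineHomeo L p ⁻¹' U) (fun x => v (affineHomeo L p x))
      (fun x => g (affineHomeo L p x)) e := by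
  intro θ hθ hθc hθU
  obtain ⟨k, hk0, hk⟩ := exists_map_affineHomeo μ ν L p
  set A := affineHomeo L p with hA
  have hsymm : ContDiff ℝ ∞ (A.symm : E' → E) := by
    rw [hA, affineHomeo_symm]
    exact (L.symm : E' →L[ℝ] E).contDiff.add contDiff_const
  have h1 := h (θ ∘ A.symm) (hθ.comp hsymm) (hθc.comp_homeomorph A.symm) (by
    rw [tsupport_comp_eq_preimage]
    intro y hy
    have := hθU hy
    simpa using this)
  have hd : ∀ x, fderiv ℝ (θ ∘ A.symm) (A x) (L e) = fderiv ℝ θ x e := by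
    intro x
    have e1 : θ = (θ ∘ A.symm) ∘ A := by ext; simp
    have d1 : HasFDerivAt A (L : E →L[ℝ] E') x := (L : E →L[ℝ] E').hasFDerivAt.add_const p
    have d2 : HasFDerivAt (θ ∘ A.symm) (fderiv ℝ (θ ∘ A.symm) (A x)) (A x) :=
      ((hθ.comp hsymm).differentiable (by simp) _).hasFDerivAt
    have d3 := (d2.comp x d1).fderiv
    rw [← e1] at d3
    rw [d3]; rfl
  have e1 := integral_comp_affineHomeo hk (fun y => v y * fderiv ℝ (θ ∘ A.symm) y (L e))
  have e2 := integral_comp_affineHomeo hk (fun y => g y * (θ ∘ A.symm) y)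
  simp only [← hA, hd, Function.comp, Homeomorph.symm_apply_apply] at e1 e2
  rw [e1, e2]
  have h1' : ∫ x, v x * fderiv ℝ (θ ∘ A.symm) x (L e) ∂ν
    = - ∫ x, g x * θ (A.symm x) ∂ν := h1
  rw [h1']; ring

/-- The map sends the ball of radius `r` into the ball of radius `C * r`, and `o((C * r) ^ n)` is
`o(r ^ n)`. -/
lemma LebLim.comp_affineHomeo {n : ℕ} {S : Set E'} (hS : MeasurableSet S) {v : E' → ℝ}
    (hv : Integrable v ν) {x : E} {c : ℝ} (L : E ≃L[ℝ] E') (p : E')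
    (h : LebLim ν n S v (affineHomeo L p x) c) :
    LebLim μ n (affineHomeo L p ⁻¹' S) (fun x => v (affineHomeo L p x)) x c := by
  obtain ⟨k, hk0, hk⟩ := exists_map_affineHomeo μ ν L p
  set A := affineHomeo L p with hA
  set C : ℝ := ‖(L : E →L[ℝ] E')‖ + 1 with hC
  have hC0 : 0 < C := by positivity
  have hball : ∀ r > 0, Metric.ball x r ⊆ A ⁻¹' Metric.ball (A x) (C * r) := by
    intro r hr y hy
    rw [mem_preimage, Metric.mem_ball, dist_eq_norm, hA, affineHomeo_apply, affineHomeo_apply,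
      add_sub_add_right_eq_sub, ← map_sub]
    rw [Metric.mem_ball, dist_eq_norm] at hy
    have := (L : E →L[ℝ] E').le_opNorm (y - x)
    calc ‖L (y - x)‖ ≤ ‖(L : E →L[ℝ] E')‖ * ‖y - x‖ := this
      _ ≤ ‖(L : E →L[ℝ] E')‖ * r := by gcongr
      _ < C * r := by gcongr; linarith
  have hCt : Tendsto (fun r : ℝ => C * r) (𝓝[>] 0) (𝓝[>] 0) := by
    refine tendsto_nhdsWithin_iff.2 ⟨?_, ?_⟩
    · have : Tendsto (fun r : ℝ => C * r) (𝓝 0) (𝓝 (C * 0)) := tendsto_id.const_mul C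
      rw [mul_zero] at this
      exact this.mono_left nhdsWithin_le_nhds
    · filter_upwards [self_mem_nhdsWithin] with r hr
      exact mul_pos hC0 (mem_Ioi.1 hr)
  have h1 : (fun r => ∫ y in S ∩ Metric.ball (A x) (C * r), |v y - c| ∂ν)
      =o[𝓝[>] 0] fun r => (C * r) ^ n := Asymptotics.IsLittleO.comp_tendsto h hCt
  have h2 : (fun r => ∫ y in S ∩ Metric.ball (A x) (C * r), |v y - c| ∂ν)
      =o[𝓝[>] 0] fun r => r ^ n := by
    simp_rw [mul_pow] at h1
    exact (Asymptotics.isLittleO_const_mul_right_iff (pow_ne_zero _ hC0.ne')).1 h1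
  refine Asymptotics.IsBigO.trans_isLittleO (Asymptotics.IsBigO.of_bound (k : ℝ) ?_) h2
  filter_upwards [self_mem_nhdsWithin] with r hr
  rw [Real.norm_of_nonneg (integral_nonneg fun _ => abs_nonneg _),
    Real.norm_of_nonneg (integral_nonneg fun _ => abs_nonneg _)]
  have hSb : MeasurableSet (S ∩ Metric.ball (A x) (C * r)) :=
    hS.inter Metric.isOpen_ball.measurableSet
  have e1 := integral_comp_affineHomeo hk
    ((S ∩ Metric.ball (A x) (C * r)).indicator fun y => |v y - c|)
  rw [integral_indicator hSb] at e1
  have e2 : ∫ y, (S ∩ Metric.ball (A x) (C * r)).indicator (fun y => |v y - c|) (A y) ∂μ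
      = ∫ y in A ⁻¹' (S ∩ Metric.ball (A x) (C * r)), |v (A y) - c| ∂μ := by
    rw [← integral_indicator (A.measurable hSb)]
    rfl
  rw [← hA] at e1
  rw [← e1, e2]
  have hi : IntegrableOn (fun y => |v y - c|) (S ∩ Metric.ball (A x) (C * r)) ν := by
    refine IntegrableOn.mono_set ?_ inter_subset_right
    exact (hv.integrableOn.sub (integrableOn_const measure_ball_lt_top.ne)).abs
  have hi2 := integrable_comp_affineHomeo (μ := μ) ((integrable_indicator_iff hSb).2 hi) L p
  refine setIntegral_mono_set ?_ (ae_of_all _ fun _ => abs_nonneg _)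
    (LE.le.eventuallyLE (inter_subset_inter_right _ (hball r hr)))
  rw [← integrable_indicator_iff (A.measurable hSb)]
  exact hi2

end Affine

/-! ### Coordinates adapted to a hyperplane, and its Hausdorff measure -/

section Flat

variable {V : Type*} [NormedAddCommGroup V] [InnerProductSpace ℝ V] [FiniteDimensional ℝ V]
  [MeasurableSpace V] [BorelSpace V]

lemma finrank_orthogonal_add_one {a : V} (ha : a ≠ 0) :
    Module.finrank ℝ (ℝ ∙ a)ᗮ + 1 = Module.finrank ℝ V := by
  rw [← (ℝ ∙ a).finrank_add_finrank_orthogonal, finrank_span_singleton ha, add_comm]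

/-- Linear coordinates adapted to the hyperplanes orthogonal to `a`. -/
noncomputable def flatEquiv {a : V} (ha : a ≠ 0) : ((ℝ ∙ a)ᗮ × ℝ) ≃L[ℝ] V :=
  (LinearEquiv.ofInjectiveOfFinrankEq
    ((ℝ ∙ a)ᗮ.subtype.coprod (LinearMap.toSpanSingleton ℝ V a)) (by
      rw [← LinearMap.ker_eq_bot, LinearMap.ker_eq_bot']
      rintro ⟨y, s⟩ h
      have h0 : (y : V) + s • a = 0 := by simpa using h
      have hy : inner ℝ a (y : V) = 0 := (Submodule.mem_orthogonal_singleton_iff_inner_right).1 y.2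
      have h1 : inner ℝ a ((y : V) + s • a) = 0 := by rw [h0, inner_zero_right]
      rw [inner_add_right, hy, inner_smul_right, zero_add] at h1
      have hs : s = 0 := by
        rcases mul_eq_zero.1 h1 with h | h
        · exact h
        · exact absurd (inner_self_eq_zero.1 h) ha
      rw [hs, zero_smul, add_zero] at h0
      exact Prod.ext (Subtype.ext h0) hs)
    (by rw [Module.finrank_prod, Module.finrank_self, finrank_orthogonal_add_one ha])).toContinuousLinearEquiv

lemma flatEquiv_apply {a : V} (ha : a ≠ 0) (p : (ℝ ∙ a)ᗮ × ℝ) :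
    flatEquiv ha p = (p.1 : V) + p.2 • a := by
  have : flatEquiv ha p = (ℝ ∙ a)ᗮ.subtype.coprod (LinearMap.toSpanSingleton ℝ V a) p := rfl
  rw [this]
  simp

/-- Coordinates in which the hyperplane `⟪a, x⟫ = b` is `{p | p.2 = 0}`. -/
noncomputable def flat {a : V} (ha : a ≠ 0) (b : ℝ) : ((ℝ ∙ a)ᗮ × ℝ) ≃ₜ V :=
  affineHomeo (flatEquiv ha) ((b / ‖a‖ ^ 2) • a)

lemma inner_flat {a : V} (ha : a ≠ 0) (b : ℝ) (p : (ℝ ∙ a)ᗮ × ℝ) :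
    inner ℝ a (flat ha b p) = p.2 * ‖a‖ ^ 2 + b := by
  have hy : inner ℝ a (p.1 : V) = 0 :=
    (Submodule.mem_orthogonal_singleton_iff_inner_right).1 p.1.2
  have : ‖a‖ ≠ 0 := norm_ne_zero_iff.2 ha
  rw [flat, affineHomeo_apply, flatEquiv_apply, inner_add_right, inner_add_right, hy,
    inner_smul_right, inner_smul_right, real_inner_self_eq_norm_sq]
  field_simp
  ring

lemma range_flat_zero {a : V} (ha : a ≠ 0) (b : ℝ) :
    range (fun y => flat ha b (y, 0)) = {x | inner ℝ a x = b} := by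
  ext x
  constructor
  · rintro ⟨y, rfl⟩
    simp [inner_flat]
  · intro hx
    obtain ⟨p, rfl⟩ := (flat ha b).surjective x
    have h1 : p.2 * ‖a‖ ^ 2 + b = b := by rw [← inner_flat ha b p]; exact hx
    have h2 : p.2 = 0 := by
      have : ‖a‖ ^ 2 ≠ 0 := pow_ne_zero _ (norm_ne_zero_iff.2 ha)
      have h3 : p.2 * ‖a‖ ^ 2 = 0 := by linarith
      exact (mul_eq_zero.1 h3).resolve_right this
    exact ⟨p.1, by simp [← h2]⟩

/-- The full coordinates are not isometric, since `a` is not normalised and the product carries the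
sup norm. Their restriction to `p.2 = 0` is, which is all that comparing Hausdorff measures
requires. -/
lemma isometry_flat_zero {a : V} (ha : a ≠ 0) (b : ℝ) :
    Isometry (fun y => flat ha b (y, 0)) := by
  refine Isometry.of_dist_eq fun y z => ?_
  simp only [flat, affineHomeo_apply, flatEquiv_apply, dist_add_right]
  rfl

/-- Almost every point of a hyperplane, for the Hausdorff measure, is almost every point in flat
coordinates. -/
lemma ae_hyperplane_iff {a : V} (ha : a ≠ 0) (b : ℝ) {P : V → Prop} :
    (∀ᵐ x ∂((Measure.hausdorffMeasure ((Module.finrank ℝ V : ℝ) - 1)).restrict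
      {x : V | inner ℝ a x = b}), P x) ↔ ∀ᵐ y : (ℝ ∙ a)ᗮ, P (flat ha b (y, 0)) := by
  have hd : (Module.finrank ℝ V : ℝ) - 1 = (Module.finrank ℝ (ℝ ∙ a)ᗮ : ℝ) := by
    rw [← finrank_orthogonal_add_one ha]; push_cast; ring
  have hi := isometry_flat_zero ha b
  rw [← range_flat_zero ha b, hd, ← hi.map_hausdorffMeasure (Or.inl (Nat.cast_nonneg _)),
    hi.isClosedEmbedding.measurableEmbedding.ae_map_iff]
  exact ⟨fun h => (Measure.absolutelyContinuous_isAddHaarMeasure _ _).ae_le h,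
    fun h => (Measure.absolutelyContinuous_isAddHaarMeasure _ _).ae_le h⟩

end Flat

section Affine

variable {E E' : Type*} [NormedAddCommGroup E] [NormedSpace ℝ E] [FiniteDimensional ℝ E]
  [MeasurableSpace E] [BorelSpace E] {μ : Measure E} [μ.IsAddHaarMeasure]
  [NormedAddCommGroup E'] [NormedSpace ℝ E'] [FiniteDimensional ℝ E']
  [MeasurableSpace E'] [BorelSpace E'] {ν : Measure E'} [ν.IsAddHaarMeasure]

lemma affineHomeo_affineHomeo_symm (L : E ≃L[ℝ] E') (p y : E') :
    affineHomeo L p (affineHomeo L.symm (-(L.symm p)) y) = y := by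
  rw [← affineHomeo_symm, Homeomorph.apply_symm_apply]

lemma HasWeakDeriv.of_comp_affineHomeo {U : Set E'} {v g : E' → ℝ} {e : E} (L : E ≃L[ℝ] E') (p : E')
    (h : HasWeakDeriv μ (affineHomeo L p ⁻¹' U) (fun x => v (affineHomeo L p x))
      (fun x => g (affineHomeo L p x)) e) : HasWeakDeriv ν U v g (L e) := by
  have h1 := HasWeakDeriv.comp_affineHomeo (μ := ν) (e := L e) L.symm (-(L.symm p)) (by simpa using h)
  simpa only [← preimage_comp, Function.comp_def, affineHomeo_affineHomeo_symm, preimage_id']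
    using h1

lemma LebLim.of_comp_affineHomeo {n : ℕ} {S : Set E'} (hS : MeasurableSet S) {v : E' → ℝ}
    (hv : Integrable v ν) {x : E} {c : ℝ} (L : E ≃L[ℝ] E') (p : E')
    (h : LebLim μ n (affineHomeo L p ⁻¹' S) (fun x => v (affineHomeo L p x)) x c) :
    LebLim ν n S v (affineHomeo L p x) c := by
  have h1 := LebLim.comp_affineHomeo (μ := ν) (x := affineHomeo L p x)
    ((affineHomeo L p).measurable hS) (integrable_comp_affineHomeo hv L p) L.symm (-(L.symm p))
    (by rw [← affineHomeo_symm, Homeomorph.symm_apply_apply]; exact h)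
  simpa only [← preimage_comp, Function.comp_def, affineHomeo_affineHomeo_symm, preimage_id']
    using h1

end Affine

/-! ### Lebesgue limits and removability for an arbitrary hyperplane -/

section Hyperplane

variable {V : Type*} [NormedAddCommGroup V] [InnerProductSpace ℝ V] [FiniteDimensional ℝ V]
  [MeasurableSpace V] [BorelSpace V]

/-- One of the two sides of the origin in `ℝ`, or the whole line. -/
def IsSide (K : Set ℝ) : Prop := K = Ioi 0 ∨ K = Iio 0 ∨ K = univ

lemma IsSide.measurableSet {K : Set ℝ} (h : IsSide K) : MeasurableSet K := by
  rcases h with rfl | rfl | rfl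
  exacts [measurableSet_Ioi, measurableSet_Iio, MeasurableSet.univ]

lemma IsSide.inter_Ioo {K : Set ℝ} (h : IsSide K) (ρ : ℝ) (hρ : ρ > 0) :
    ∃ l₁ l₂, l₁ < l₂ ∧ K ∩ Ioo (-ρ) ρ = Ioo l₁ l₂ := by
  rcases h with rfl | rfl | rfl
  · refine ⟨0, ρ, hρ, ?_⟩
    ext x; simp only [mem_inter_iff, mem_Ioi, mem_Ioo]
    constructor
    · rintro ⟨h1, h2, h3⟩; exact ⟨h1, h3⟩
    · rintro ⟨h1, h2⟩; exact ⟨h1, by linarith, h2⟩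
  · refine ⟨-ρ, 0, by linarith, ?_⟩
    ext x; simp only [mem_inter_iff, mem_Iio, mem_Ioo]
    constructor
    · rintro ⟨h1, h2, h3⟩; exact ⟨h2, h1⟩
    · rintro ⟨h1, h2⟩; exact ⟨h2, h1, by linarith⟩
  · exact ⟨-ρ, ρ, by linarith, by simp⟩

lemma IsSide.mul_mem_iff {K : Set ℝ} (h : IsSide K) {t : ℝ} (ht : 0 < t) (s : ℝ) :
    s * t ∈ K ↔ s ∈ K := by
  rcases h with rfl | rfl | rfl
  · simp [mul_pos_iff_of_pos_right ht]
  · simp [mul_neg_iff, ht, ht.not_gt]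
  · simp

/-- The part of the space on the side `K` of the hyperplane `⟪a, x⟫ = b`. -/
def side (a : V) (b : ℝ) (K : Set ℝ) : Set V := {x | inner ℝ a x - b ∈ K}

lemma measurableSet_side (a : V) (b : ℝ) {K : Set ℝ} (hK : MeasurableSet K) :
    MeasurableSet (side a b K) :=
  hK.preimage (by fun_prop : Measurable fun x : V => inner ℝ a x - b)

lemma flat_preimage_side {a : V} (ha : a ≠ 0) (b : ℝ) {K : Set ℝ} (hK : IsSide K) :
    affineHomeo (flatEquiv ha) ((b / ‖a‖ ^ 2) • a) ⁻¹' side a b K = univ ×ˢ K := by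
  ext p
  have h1 := inner_flat ha b p
  rw [flat] at h1
  simp only [side, mem_preimage, mem_ofPred_eq, h1, add_sub_cancel_right, mem_prod, mem_univ,
    true_and]
  exact hK.mul_mem_iff (pow_pos (norm_pos_iff.2 ha) 2) _

/-- A function with an integrable weak derivative in the direction `a` has a limit in the sense of
Lebesgue at almost every point of the hyperplane `⟪a, x⟫ = b` near which it is defined. -/
theorem HasWeakDeriv.ae_hyperplane_exists_lebLim {a : V} (ha : a ≠ 0) (b : ℝ) {U : Set V}
    {v g : V → ℝ} (hw : HasWeakDeriv volume U v g a) (hv : Integrable v) (hg : Integrable g)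
    {K : Set ℝ} (hK : IsSide K) :
    ∀ᵐ x ∂((Measure.hausdorffMeasure ((Module.finrank ℝ V : ℝ) - 1)).restrict
      {x : V | inner ℝ a x = b}), (∃ r > 0, side a b K ∩ Metric.ball x r ⊆ U) →
        ∃ c, LebLim volume (Module.finrank ℝ V) (side a b K) v x c := by
  rw [ae_hyperplane_iff ha]
  set L := flatEquiv ha
  set p := (b / ‖a‖ ^ 2) • a
  have hL : L (0, 1) = a := by simp [L, flatEquiv_apply]
  rw [← hL] at hw
  have h1 := HasWeakDeriv.ae_exists_lebLim (μ := (volume : Measure (ℝ ∙ a)ᗮ))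
    (hw.comp_affineHomeo L p) (integrable_comp_affineHomeo hv L p) (integrable_comp_affineHomeo hg L p)
    hK.measurableSet hK.inter_Ioo
  filter_upwards [h1] with y hy
  rintro ⟨r, hr, hrU⟩
  have hcont := (affineHomeo L p).continuous.continuousAt (x := (y, (0 : ℝ)))
  obtain ⟨δ, hδ, hδr⟩ := Metric.continuousAt_iff.1 hcont r hr
  obtain ⟨c, hc⟩ := hy ⟨δ, hδ, fun z hz => hrU ⟨by
    have h2 : z ∈ affineHomeo L p ⁻¹' side a b K := by
      rw [flat_preimage_side ha b hK]; exact hz.1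
    exact h2, hδr hz.2⟩⟩
  refine ⟨c, ?_⟩
  rw [finrank_orthogonal_add_one ha, ← flat_preimage_side ha b hK] at hc
  exact hc.of_comp_affineHomeo (measurableSet_side a b hK.measurableSet) hv L p

theorem HasWeakDeriv.of_diff_hyperplane' {a : V} (ha : a ≠ 0) (b : ℝ) {U : Set V} {w g : V → ℝ}
    {e : V} (hw : HasWeakDeriv volume (U \ {x | inner ℝ a x = b}) w g e)
    (hwi : Integrable w) (hg : Integrable g) {M : ℝ} (hM : ∀ x, |w x| ≤ M)
    (hL : ∀ᵐ x ∂((Measure.hausdorffMeasure ((Module.finrank ℝ V : ℝ) - 1)).restrict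
      {x : V | inner ℝ a x = b}), x ∈ U → ∃ c, LebLim volume (Module.finrank ℝ V) univ w x c) :
    HasWeakDeriv volume U w g e := by
  rw [ae_hyperplane_iff ha] at hL
  set L := flatEquiv ha
  set p := (b / ‖a‖ ^ 2) • a with hp
  obtain ⟨e', rfl⟩ := L.surjective e
  refine HasWeakDeriv.of_comp_affineHomeo (μ := (volume : Measure (ℝ ∙ a)ᗮ).prod volume) L p ?_
  refine HasWeakDeriv.of_diff_hyperplane (M := M) ?_ (integrable_comp_affineHomeo hwi L p)
    (integrable_comp_affineHomeo hg L p) (fun _ => hM _) ?_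
  · have h1 := hw.comp_affineHomeo (μ := (volume : Measure (ℝ ∙ a)ᗮ).prod volume) L p
    have h2 : affineHomeo L p ⁻¹' {x | inner ℝ a x = b} = {q | q.2 = 0} := by
      ext q
      have h3 := inner_flat ha b q
      rw [flat] at h3
      simp only [mem_preimage, mem_ofPred_eq, L, hp, h3]
      simp [ha]
    rwa [preimage_sdiff, h2] at h1
  · filter_upwards [hL] with y hy hyU
    obtain ⟨c, hc⟩ := hy hyU
    refine ⟨c, ?_⟩
    rw [finrank_orthogonal_add_one ha]
    exact LebLim.comp_affineHomeo MeasurableSet.univ hwi L p hc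

end Hyperplane

/-! ### Calculus of Lebesgue limits -/

section LebLim

variable {V : Type*} [NormedAddCommGroup V] [InnerProductSpace ℝ V] [FiniteDimensional ℝ V]
  [MeasurableSpace V] [BorelSpace V] {n : ℕ}

lemma integrableOn_abs_sub {v : V → ℝ} (hv : Integrable v) (c : ℝ) (S : Set V) (x : V) (r : ℝ) :
    IntegrableOn (fun y => |v y - c|) (S ∩ Metric.ball x r) :=
  IntegrableOn.mono_set ((hv.integrableOn.sub (integrableOn_const measure_ball_lt_top.ne)).abs)
    inter_subset_right

lemma volume_inter_ball_ne_top (S : Set V) (x : V) (r : ℝ) :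
    volume (S ∩ Metric.ball x r) ≠ ⊤ :=
  measure_ne_top_of_subset inter_subset_right measure_ball_lt_top.ne

/-- Serves both to restrict a limit to a smaller set and to pass it through a 1-Lipschitz function.
-/
lemma LebLim.of_le {S T : Set V} (hT : MeasurableSet T) (hTS : T ⊆ S) {v w : V → ℝ}
    (hv : Integrable v) {x : V} {c c' : ℝ} (h : LebLim volume n S v x c)
    (hle : ∀ᵐ y, y ∈ T → |w y - c'| ≤ |v y - c|) : LebLim volume n T w x c' := by
  refine Asymptotics.IsBigO.trans_isLittleO (Asymptotics.IsBigO.of_bound 1 (.of_forall fun r => ?_)) h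
  rw [Real.norm_of_nonneg (integral_nonneg fun _ => abs_nonneg _),
    Real.norm_of_nonneg (integral_nonneg fun _ => abs_nonneg _), one_mul]
  have hi := integrableOn_abs_sub hv c S x r
  have hsub : T ∩ Metric.ball x r ⊆ S ∩ Metric.ball x r := inter_subset_inter_left _ hTS
  calc _ ≤ ∫ y in T ∩ Metric.ball x r, |v y - c| := by
        refine integral_mono_of_nonneg (ae_of_all _ fun _ => abs_nonneg _) (hi.mono_set hsub) ?_
        refine (ae_restrict_iff' (hT.inter Metric.isOpen_ball.measurableSet)).2 ?_
        filter_upwards [hle] with y hy hyT using hy hyT.1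
    _ ≤ _ := setIntegral_mono_set hi (ae_of_all _ fun _ => abs_nonneg _) (LE.le.eventuallyLE hsub)

/-- Only the values near the point matter. -/
lemma LebLim.congr_set {S T : Set V} {v : V → ℝ} {x : V} {c : ℝ} {r : ℝ} (hr : 0 < r)
    (hST : S ∩ Metric.ball x r = T ∩ Metric.ball x r) (h : LebLim volume n S v x c) :
    LebLim volume n T v x c := by
  refine Asymptotics.IsLittleO.congr' h ?_ EventuallyEq.rfl
  filter_upwards [Ioo_mem_nhdsGT hr] with s hs
  have : Metric.ball x r ∩ Metric.ball x s = Metric.ball x s :=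
    inter_eq_right.2 (Metric.ball_subset_ball hs.2.le)
  rw [← this, ← inter_assoc, ← inter_assoc, hST]

lemma LebLim.union {S T : Set V} (hST : Disjoint S T) (hT : MeasurableSet T) {v : V → ℝ}
    (hv : Integrable v) {x : V} {c : ℝ} (h : LebLim volume n S v x c)
    (h' : LebLim volume n T v x c) : LebLim volume n (S ∪ T) v x c := by
  refine (Asymptotics.IsLittleO.add h h').congr_left fun r => ?_
  rw [union_inter_distrib_right, setIntegral_union (hST.mono inter_subset_left inter_subset_left)
    (hT.inter Metric.isOpen_ball.measurableSet) (integrableOn_abs_sub hv c S x r)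
    (integrableOn_abs_sub hv c T x r)]

/-- The triangle inequality bounds `|c - c'|` times the volume of `S ∩ B(x,r)` by an `o(rⁿ)`, while
the density hypothesis bounds that volume below by `κ * rⁿ`. -/
lemma LebLim.unique {S : Set V} {v : V → ℝ} (hv : Integrable v) {x : V} {c c' κ : ℝ}
    (hκ : 0 < κ) (hS : ∀ᶠ r in 𝓝[>] 0, κ * r ^ n ≤ volume.real (S ∩ Metric.ball x r))
    (h : LebLim volume n S v x c) (h' : LebLim volume n S v x c') : c = c' := by
  by_contra hne
  have hpos : 0 < |c - c'| := abs_pos.2 (sub_ne_zero.2 hne)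
  have h1 := (Asymptotics.isLittleO_iff.1 (Asymptotics.IsLittleO.add h h'))
    (show 0 < |c - c'| * κ / 2 by positivity)
  obtain ⟨r, ⟨h2, h3⟩, hr⟩ := ((h1.and hS).and self_mem_nhdsWithin).exists
  have hr : 0 < r := hr
  rw [Real.norm_of_nonneg (add_nonneg (integral_nonneg fun _ => abs_nonneg _)
    (integral_nonneg fun _ => abs_nonneg _)), Real.norm_of_nonneg (pow_nonneg hr.le _)] at h2
  have i1 := integrableOn_abs_sub hv c S x r
  have i2 := integrableOn_abs_sub hv c' S x r
  have h4 : |c - c'| * volume.real (S ∩ Metric.ball x r)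
      ≤ (∫ y in S ∩ Metric.ball x r, |v y - c|) + ∫ y in S ∩ Metric.ball x r, |v y - c'| := by
    rw [← integral_add i1 i2]
    calc _ = ∫ y in S ∩ Metric.ball x r, |c - c'| := by
          rw [setIntegral_const, smul_eq_mul, mul_comm]
      _ ≤ _ := by
          refine integral_mono (integrableOn_const (volume_inter_ball_ne_top S x r)) (i1.add i2)
            fun y => ?_
          have := abs_sub_le c (v y) c'
          rwa [abs_sub_comm c (v y)] at this
  have hrn := pow_pos hr n
  have h5 := mul_le_mul_of_nonneg_left h3 hpos.le
  have h6 : 0 < |c - c'| * κ * r ^ n := by positivity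
  nlinarith

/-- The projection of `c` on `[p, q]` is also a limit, because the projection is 1-Lipschitz and
fixes the values of `v`. Uniqueness then gives equality. -/
lemma LebLim.mem_Icc {S : Set V} (hSm : MeasurableSet S) {v : V → ℝ} (hv : Integrable v) {x : V}
    {c κ p q : ℝ} (hκ : 0 < κ)
    (hS : ∀ᶠ r in 𝓝[>] 0, κ * r ^ n ≤ volume.real (S ∩ Metric.ball x r)) (hpq : p ≤ q)
    (hpv : ∀ᵐ y, y ∈ S → v y ∈ Icc p q) (h : LebLim volume n S v x c) : c ∈ Icc p q := by
  have h1 : LebLim volume n S v x (max p (min q c)) := by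
    refine h.of_le hSm le_rfl hv ?_
    filter_upwards [hpv] with y hy hyS
    obtain ⟨h1, h2⟩ := hy hyS
    have h3 : v y = max p (min q (v y)) := by rw [min_eq_right h2, max_eq_right h1]
    calc |v y - max p (min q c)| = |max p (min q (v y)) - max p (min q c)| := by rw [← h3]
      _ ≤ |min q (v y) - min q c| := by
        simpa [max_comm] using abs_max_sub_max_le_abs (min q (v y)) (min q c) p
      _ ≤ |v y - c| := by
        have := abs_min_sub_min_le_max q (v y) q c
        simpa using this
  rw [LebLim.unique hv hκ hS h h1]
  exact ⟨le_max_left _ _, max_le hpq (min_le_left _ _)⟩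

/-- Half spaces have positive density at the points of their boundary. -/
lemma exists_le_volume_side_inter_ball {a : V} (ha : a ≠ 0) {b : ℝ} {K : Set ℝ} (hK : IsSide K)
    {x : V} (hx : inner ℝ a x = b) :
    ∃ κ > 0, ∀ r > 0,
      κ * r ^ Module.finrank ℝ V ≤ volume.real (side a b K ∩ Metric.ball x r) := by
  have hopen : IsOpen (side a b K) := by
    have hKo : IsOpen K := by
      rcases hK with rfl | rfl | rfl
      exacts [isOpen_Ioi, isOpen_Iio, isOpen_univ]
    exact hKo.preimage (by fun_prop : Continuous fun x : V => inner ℝ a x - b)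
  have himage : ∀ r > 0, AffineMap.homothety x r '' (side a b K ∩ Metric.ball x 1)
      ⊆ side a b K ∩ Metric.ball x r := by
    rintro r hr _ ⟨z, ⟨hz1, hz2⟩, rfl⟩
    rw [AffineMap.homothety_apply, vsub_eq_sub, vadd_eq_add]
    refine ⟨?_, ?_⟩
    · have h1 : inner ℝ a (r • (z - x) + x) - b = (inner ℝ a z - b) * r := by
        rw [inner_add_right, inner_smul_right, inner_sub_right, hx]; ring
      simp only [side, mem_ofPred_eq, h1]
      exact (hK.mul_mem_iff hr _).2 hz1
    · rw [Metric.mem_ball, dist_eq_norm, add_sub_cancel_right, norm_smul, Real.norm_of_nonneg hr.le]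
      rw [Metric.mem_ball, dist_eq_norm] at hz2
      nlinarith
  refine ⟨volume.real (side a b K ∩ Metric.ball x 1), ?_, fun r hr => ?_⟩
  · refine ENNReal.toReal_pos (IsOpen.measure_pos _ (hopen.inter Metric.isOpen_ball) ?_).ne'
      (volume_inter_ball_ne_top _ _ _)
    have hna : 0 < ‖a‖ := norm_pos_iff.2 ha
    have key : ∀ s : ℝ, s ∈ K → |s| < 1 / (‖a‖) → (side a b K ∩ Metric.ball x 1).Nonempty := by
      intro s hs hs1
      refine ⟨x + s • a, ?_, ?_⟩
      · have h1 : inner ℝ a (x + s • a) - b = s * ‖a‖ ^ 2 := by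
          rw [inner_add_right, inner_smul_right, real_inner_self_eq_norm_sq, hx]; ring
        simp only [side, mem_ofPred_eq, h1]
        exact (hK.mul_mem_iff (by positivity) _).2 hs
      · rw [Metric.mem_ball, dist_eq_norm, add_sub_cancel_left, norm_smul, Real.norm_eq_abs]
        exact (lt_div_iff₀ hna).1 hs1
    have hsm : |1 / (2 * ‖a‖)| < 1 / ‖a‖ := by
      rw [abs_of_pos (by positivity)]
      exact one_div_lt_one_div_of_lt hna (by linarith)
    rcases hK with rfl | rfl | rfl
    · exact key (1 / (2 * ‖a‖)) (by simp only [mem_Ioi]; positivity) hsm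
    · exact key (-(1 / (2 * ‖a‖))) (by simp only [mem_Iio, neg_lt_zero]; positivity)
        (by rwa [abs_neg])
    · exact key (1 / (2 * ‖a‖)) (mem_univ _) hsm
  · have h1 := Measure.addHaar_image_homothety (volume : Measure V) x r
      (side a b K ∩ Metric.ball x 1)
    have h2 := measure_mono (μ := volume) (himage r hr)
    rw [h1] at h2
    have h3 := ENNReal.toReal_mono (volume_inter_ball_ne_top _ _ _) h2
    rw [ENNReal.toReal_mul, ENNReal.toReal_ofReal (abs_nonneg _),
      abs_of_nonneg (pow_nonneg hr.le _)] at h3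
    rw [mul_comm]
    exact h3

end LebLim

/-! ### Traces as means versus Lebesgue limits -/

section Trace

variable {d : ℕ}

lemma IsTraceAt.lebLim {U : Set (Space d)} {v : Space d → ℝ} {x : Space d} {g : ℝ}
    (h : IsTraceAt U v x g) : LebLim volume d U v x g := by
  rw [LebLim, Asymptotics.isLittleO_iff]
  intro c hc
  set m := (volume : Measure (Space d)).real (Metric.ball 0 1) with hm
  have hm0 : 0 ≤ m := ENNReal.toReal_nonneg
  filter_upwards [h.eventually (gt_mem_nhds (show 0 < c / (m + 1) by positivity)),
    self_mem_nhdsWithin] with r h1 hr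
  have hr : 0 < r := hr
  rw [Real.norm_of_nonneg (integral_nonneg fun _ => abs_nonneg _),
    Real.norm_of_nonneg (pow_nonneg hr.le _)]
  have h2 : volume.real (U ∩ Metric.ball x r) ≤ r ^ d * m := by
    have h3 : volume.real (Metric.ball x r) = r ^ d * m := by
      rw [Measure.real, Measure.addHaar_ball_of_pos _ _ hr, ENNReal.toReal_mul,
        ENNReal.toReal_ofReal (by positivity)]
      simp [hm, Measure.real]
    rw [← h3]
    exact measureReal_mono inter_subset_right measure_ball_lt_top.ne
  rw [← measure_smul_setAverage _ (volume_inter_ball_ne_top U x r), smul_eq_mul]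
  have h4 : 0 ≤ ⨍ y in U ∩ Metric.ball x r, |v y - g| := by
    rw [setAverage_eq]
    exact smul_nonneg (by positivity) (integral_nonneg fun _ => abs_nonneg _)
  calc _ ≤ (r ^ d * m) * (c / (m + 1)) := by gcongr
    _ = c * r ^ d * (m / (m + 1)) := by field_simp
    _ ≤ c * r ^ d * 1 := by
        have : m / (m + 1) ≤ 1 := (div_le_one (by positivity)).2 (by linarith)
        gcongr
    _ = c * r ^ d := mul_one _

/-- Unlike the converse, this needs positive density: the mean divides by the volume of `U ∩
B(x,r)`, which has to be comparable to `r ^ d`. -/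
lemma LebLim.isTraceAt {U : Set (Space d)} {v : Space d → ℝ} {x : Space d} {g κ : ℝ} (hκ : 0 < κ)
    (hU : ∀ᶠ r in 𝓝[>] 0, κ * r ^ d ≤ volume.real (U ∩ Metric.ball x r))
    (h : LebLim volume d U v x g) : IsTraceAt U v x g := by
  have h1 := (Asymptotics.IsLittleO.tendsto_div_nhds_zero h).const_mul κ⁻¹
  rw [mul_zero] at h1
  refine squeeze_zero' (.of_forall fun r => ?_) ?_ h1
  · rw [setAverage_eq]
    exact smul_nonneg (by positivity) (integral_nonneg fun _ => abs_nonneg _)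
  · filter_upwards [hU, self_mem_nhdsWithin] with r hr hr0
    have hr0 : 0 < r := hr0
    rw [setAverage_eq, smul_eq_mul]
    have h2 : 0 ≤ ∫ y in U ∩ Metric.ball x r, |v y - g| := integral_nonneg fun _ => abs_nonneg _
    have h3 : 0 < κ * r ^ d := by positivity
    calc _ ≤ (κ * r ^ d)⁻¹ * ∫ y in U ∩ Metric.ball x r, |v y - g| := by gcongr
      _ = _ := by field_simp

end Trace

/-! ### The scalar functions of one medium -/

/-- The projection of `ℝ` onto `[0,1]`. -/
noncomputable def clamp (s : ℝ) : ℝ := max 0 (min 1 s)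

lemma clamp_mem (s : ℝ) : clamp s ∈ Icc (0 : ℝ) 1 :=
  ⟨le_max_left _ _, max_le zero_le_one (min_le_left _ _)⟩

lemma clamp_of_mem {s : ℝ} (hs : s ∈ Icc (0 : ℝ) 1) : clamp s = s := by
  rw [clamp, min_eq_right hs.2, max_eq_right hs.1]

lemma clamp_of_le {s : ℝ} (hs : s ≤ 0) : clamp s = 0 :=
  max_eq_left ((min_le_right _ _).trans hs)

lemma clamp_of_ge {s : ℝ} (hs : 1 ≤ s) : clamp s = 1 := by
  rw [clamp, min_eq_left hs, max_eq_right zero_le_one]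

lemma continuous_clamp : Continuous clamp := by unfold clamp; fun_prop

/-- Extending `f` with slope one outside `[0,1]` gives a bijection of the line. Its inverse is then
globally defined and continuous, which spares all discussion of ranges for `φ_i⁻¹` and `π_i⁻¹`. -/
lemma exists_orderIso_eqOn_Icc {f : ℝ → ℝ} (hf : StrictMonoOn f (Icc 0 1))
    (hc : ContinuousOn f (Icc 0 1)) : ∃ e : ℝ ≃o ℝ, ∀ s ∈ Icc (0 : ℝ) 1, e s = f s := by
  set g : ℝ → ℝ := fun s => f (clamp s) + (s - clamp s) with hg
  have hgc : Continuous g :=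
    (hc.comp_continuous continuous_clamp clamp_mem).add (continuous_id.sub continuous_clamp)
  have hmono : StrictMono g := by
    intro s t hst
    have h1 : clamp s ≤ clamp t := max_le_max le_rfl (min_le_min le_rfl hst.le)
    have h2 : clamp t - clamp s ≤ t - s := by
      simp only [clamp]
      rcases le_total 0 (min 1 s) with h3 | h3 <;> rcases le_total 0 (min 1 t) with h4 | h4 <;>
      rcases le_total 1 s with h5 | h5 <;> rcases le_total 1 t with h6 | h6 <;>
      simp_all <;> linarith
    rcases h1.lt_or_eq with h | h
    · have := hf (clamp_mem s) (clamp_mem t) h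
      simp only [hg]; linarith
    · simp only [hg]; rw [h]; linarith
  have htop : Tendsto g atTop atTop := by
    have : ∀ᶠ s in atTop, f 1 + (s - 1) = g s := by
      filter_upwards [eventually_ge_atTop (1 : ℝ)] with s hs
      simp only [hg, clamp_of_ge hs]
    refine Tendsto.congr' this ?_
    exact tendsto_atTop_add_const_left _ _ (tendsto_atTop_add_const_right _ _ tendsto_id)
  have hbot : Tendsto g atBot atBot := by
    have : ∀ᶠ s in atBot, f 0 + (s - 0) = g s := by
      filter_upwards [eventually_le_atBot (0 : ℝ)] with s hs
      simp only [hg, clamp_of_le hs]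
    refine Tendsto.congr' this ?_
    exact tendsto_atBot_add_const_left _ _ (tendsto_atBot_add_const_right _ _ tendsto_id)
  refine ⟨hmono.orderIsoOfSurjective g (hgc.surjective htop hbot), fun s hs => ?_⟩
  simp [hg, clamp_of_mem hs]

namespace Medium

variable {d N : ℕ} (M : Medium d N) (i : Fin N)

lemma strictMonoOn_cap : StrictMonoOn (M.cap i) (Icc 0 1) := by
  refine strictMonoOn_of_deriv_pos (convex_Icc 0 1) (M.cap_contDiffOn i).continuousOn ?_
  rw [interior_Icc]
  intro s hs
  rw [← derivWithin_of_mem_nhds (Icc_mem_nhds hs.1 hs.2)]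
  exact M.cap_deriv_pos i s hs

lemma ηo_nonneg {s : ℝ} (hs : s ∈ Icc (0 : ℝ) 1) : 0 ≤ M.ηo i s := by
  rw [← M.ηo_zero i]
  exact (M.ηo_strictMonoOn i).monotoneOn ⟨le_rfl, zero_le_one⟩ hs hs.1

lemma ηw_nonneg {s : ℝ} (hs : s ∈ Icc (0 : ℝ) 1) : 0 ≤ M.ηw i s := by
  rw [← M.ηw_one i]
  exact (M.ηw_strictAntiOn i).antitoneOn hs ⟨zero_le_one, le_rfl⟩ hs.2

lemma ηo_pos {s : ℝ} (hs : s ∈ Ioc (0 : ℝ) 1) : 0 < M.ηo i s := by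
  rw [← M.ηo_zero i]
  exact M.ηo_strictMonoOn i ⟨le_rfl, zero_le_one⟩ ⟨hs.1.le, hs.2⟩ hs.1

lemma ηw_pos {s : ℝ} (hs : s ∈ Ico (0 : ℝ) 1) : 0 < M.ηw i s := by
  rw [← M.ηw_one i]
  exact M.ηw_strictAntiOn i ⟨hs.1, hs.2.le⟩ ⟨zero_le_one, le_rfl⟩ hs.2

/-- On `[0,1]` the oil mobility vanishes only at `0` and the water mobility only at `1`. -/
lemma η_add_pos {s : ℝ} (hs : s ∈ Icc (0 : ℝ) 1) : 0 < M.ηo i s + M.ηw i s := by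
  rcases hs.1.lt_or_eq with h | h
  · exact add_pos_of_pos_of_nonneg (M.ηo_pos i ⟨h, hs.2⟩) (M.ηw_nonneg i hs)
  · exact add_pos_of_nonneg_of_pos (M.ηo_nonneg i hs) (M.ηw_pos i ⟨hs.1, h ▸ zero_lt_one⟩)

lemma continuousOn_mobility : ContinuousOn (M.mobility i) (Icc 0 1) :=
  ((M.ηo_continuousOn i).mul (M.ηw_continuousOn i)).div
    ((M.ηo_continuousOn i).add (M.ηw_continuousOn i)) fun _ hs => (M.η_add_pos i hs).ne'

lemma mobility_pos {s : ℝ} (hs : s ∈ Ioo (0 : ℝ) 1) : 0 < M.mobility i s :=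
  div_pos (mul_pos (M.ηo_pos i ⟨hs.1, hs.2.le⟩) (M.ηw_pos i ⟨hs.1.le, hs.2⟩))
    (M.η_add_pos i (Ioo_subset_Icc_self hs))

lemma continuousOn_derivWithin_cap :
    ContinuousOn (derivWithin (M.cap i) (Icc 0 1)) (Icc 0 1) :=
  (M.cap_contDiffOn i).continuousOn_derivWithin (uniqueDiffOn_Icc zero_lt_one) le_rfl

lemma continuousOn_mobility_mul :
    ContinuousOn (fun a => M.mobility i a * derivWithin (M.cap i) (Icc 0 1) a) (Icc 0 1) :=
  (M.continuousOn_mobility i).mul (M.continuousOn_derivWithin_cap i)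

lemma intervalIntegrable_mobility_mul {s t : ℝ} (hs : s ∈ Icc (0 : ℝ) 1) (ht : t ∈ Icc (0 : ℝ) 1) :
    IntervalIntegrable (fun a => M.mobility i a * derivWithin (M.cap i) (Icc 0 1) a) volume s t :=
  ((M.continuousOn_mobility_mul i).mono (ordConnected_Icc.uIcc_subset hs ht)).intervalIntegrable

lemma φ_sub {s t : ℝ} (hs : s ∈ Icc (0 : ℝ) 1) (ht : t ∈ Icc (0 : ℝ) 1) :
    M.φ i t - M.φ i s = ∫ a in s..t, M.mobility i a * derivWithin (M.cap i) (Icc 0 1) a :=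
  intervalIntegral.integral_interval_sub_left
    (M.intervalIntegrable_mobility_mul i ⟨le_rfl, zero_le_one⟩ ht)
    (M.intervalIntegrable_mobility_mul i ⟨le_rfl, zero_le_one⟩ hs)

lemma φ_zero : M.φ i 0 = 0 := intervalIntegral.integral_same

lemma mobility_mul_pos {s : ℝ} (hs : s ∈ Ioo (0 : ℝ) 1) :
    0 < M.mobility i s * derivWithin (M.cap i) (Icc 0 1) s :=
  mul_pos (M.mobility_pos i hs) (M.cap_deriv_pos i s hs)

lemma strictMonoOn_φ : StrictMonoOn (M.φ i) (Icc 0 1) := by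
  intro s hs t ht hst
  rw [← sub_pos, M.φ_sub i hs ht]
  refine intervalIntegral.intervalIntegral_pos_of_pos_on
    (M.intervalIntegrable_mobility_mul i hs ht) (fun a ha => ?_) hst
  exact M.mobility_mul_pos i ⟨hs.1.trans_lt ha.1, ha.2.trans_le ht.2⟩

lemma hasDerivAt_φ {s : ℝ} (hs : s ∈ Ioo (0 : ℝ) 1) :
    HasDerivAt (M.φ i) (M.mobility i s * derivWithin (M.cap i) (Icc 0 1) s) s := by
  have hn : Icc (0 : ℝ) 1 ∈ 𝓝 s := Icc_mem_nhds hs.1 hs.2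
  exact intervalIntegral.integral_hasDerivAt_right
    (M.intervalIntegrable_mobility_mul i ⟨le_rfl, zero_le_one⟩ (Ioo_subset_Icc_self hs))
    ((M.continuousOn_mobility_mul i).stronglyMeasurableAtFilter_nhdsWithin measurableSet_Icc s
      |>.filter_mono (by rw [nhdsWithin_eq_nhds.2 hn]))
    ((M.continuousOn_mobility_mul i).continuousAt hn)

lemma continuousOn_φ : ContinuousOn (M.φ i) (Icc 0 1) := by
  have := intervalIntegral.continuousOn_primitive_interval
    (f := fun a => M.mobility i a * derivWithin (M.cap i) (Icc 0 1) a) (μ := volume) (a := 0) (b := 1)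
    (by rw [uIcc_of_le zero_le_one]; exact (M.continuousOn_mobility_mul i).integrableOn_Icc)
  rwa [uIcc_of_le zero_le_one] at this

lemma hasDerivAt_cap {s : ℝ} (hs : s ∈ Ioo (0 : ℝ) 1) :
    HasDerivAt (M.cap i) (derivWithin (M.cap i) (Icc 0 1) s) s :=
  (((M.cap_contDiffOn i).differentiableOn one_ne_zero s
    (Ioo_subset_Icc_self hs)).hasDerivWithinAt).hasDerivAt (Icc_mem_nhds hs.1 hs.2)

lemma capInv_mem {p : ℝ} (hp : p ∈ Icc (M.α i) (M.β i)) :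
    M.capInv i p ∈ Icc (0 : ℝ) 1 ∧ M.cap i (M.capInv i p) = p := by
  have h : p ∈ M.cap i '' Icc 0 1 :=
    intermediate_value_Icc zero_le_one (M.cap_contDiffOn i).continuousOn hp
  exact ⟨Function.invFunOn_mem h, Function.invFunOn_eq h⟩

lemma capInv_cap {s : ℝ} (hs : s ∈ Icc (0 : ℝ) 1) : M.capInv i (M.cap i s) = s :=
  (M.strictMonoOn_cap i).injOn.leftInvOn_invFunOn hs

lemma continuousOn_capInv : ContinuousOn (M.capInv i) (Icc (M.α i) (M.β i)) := by
  obtain ⟨e, he⟩ := exists_orderIso_eqOn_Icc (M.strictMonoOn_cap i) (M.cap_contDiffOn i).continuousOn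
  refine e.symm.continuous.continuousOn.congr fun p hp => ?_
  obtain ⟨h1, h2⟩ := M.capInv_mem i hp
  rw [OrderIso.eq_symm_apply, he _ h1, h2]

end Medium

/-! ### The function Ψ, truncated pressures and capillary graphs -/

namespace Medium

variable {d : ℕ} (M : Medium d 2) (i : Fin 2)

/-- The integrand of `Ψ`. -/
noncomputable def minMobility (a : ℝ) : ℝ :=
  min (M.mobility 0 (M.capInv 0 a)) (M.mobility 1 (M.capInv 1 a))

lemma α_le_αmax : M.α i ≤ M.αmax := by
  fin_cases i
  · exact le_max_left _ _
  · exact le_max_right _ _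

lemma βmin_le_β : M.βmin ≤ M.β i := by
  fin_cases i
  · exact min_le_left _ _
  · exact min_le_right _ _

lemma Icc_subset_Icc_capRange : Icc M.αmax M.βmin ⊆ Icc (M.α i) (M.β i) :=
  Icc_subset_Icc (M.α_le_αmax i) (M.βmin_le_β i)

lemma continuousOn_mobility_capInv :
    ContinuousOn (fun a => M.mobility i (M.capInv i a)) (Icc M.αmax M.βmin) :=
  (M.continuousOn_mobility i).comp ((M.continuousOn_capInv i).mono (M.Icc_subset_Icc_capRange i))
    fun _ hp => (M.capInv_mem i (M.Icc_subset_Icc_capRange i hp)).1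

lemma continuousOn_minMobility : ContinuousOn M.minMobility (Icc M.αmax M.βmin) :=
  ContinuousOn.inf (M.continuousOn_mobility_capInv 0) (M.continuousOn_mobility_capInv 1)

lemma minMobility_le (a : ℝ) : M.minMobility a ≤ M.mobility i (M.capInv i a) := by
  fin_cases i
  · exact min_le_left _ _
  · exact min_le_right _ _

lemma capInv_mem_Ioo {p : ℝ} (hp : p ∈ Ioo M.αmax M.βmin) : M.capInv i p ∈ Ioo (0 : ℝ) 1 := by
  obtain ⟨h1, h2⟩ := M.capInv_mem i (M.Icc_subset_Icc_capRange i (Ioo_subset_Icc_self hp))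
  refine ⟨h1.1.lt_of_ne fun h => ?_, h1.2.lt_of_ne fun h => ?_⟩
  · rw [← h] at h2
    have := M.α_le_αmax i
    rw [α, h2] at this
    exact absurd hp.1 this.not_gt
  · rw [h] at h2
    have := M.βmin_le_β i
    rw [β, h2] at this
    exact absurd hp.2 this.not_gt

lemma minMobility_pos {p : ℝ} (hp : p ∈ Ioo M.αmax M.βmin) : 0 < M.minMobility p :=
  lt_min (M.mobility_pos 0 (M.capInv_mem_Ioo 0 hp)) (M.mobility_pos 1 (M.capInv_mem_Ioo 1 hp))

lemma intervalIntegrable_minMobility {p q : ℝ} (hp : p ∈ Icc M.αmax M.βmin)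
    (hq : q ∈ Icc M.αmax M.βmin) : IntervalIntegrable M.minMobility volume p q :=
  (M.continuousOn_minMobility.mono (ordConnected_Icc.uIcc_subset hp hq)).intervalIntegrable

lemma Ψ_sub (hαβ : M.αmax < M.βmin) {p q : ℝ} (hp : p ∈ Icc M.αmax M.βmin)
    (hq : q ∈ Icc M.αmax M.βmin) : M.Ψ q - M.Ψ p = ∫ a in p..q, M.minMobility a :=
  intervalIntegral.integral_interval_sub_left
    (M.intervalIntegrable_minMobility ⟨le_rfl, hαβ.le⟩ hq)
    (M.intervalIntegrable_minMobility ⟨le_rfl, hαβ.le⟩ hp)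

lemma strictMonoOn_Ψ (hαβ : M.αmax < M.βmin) : StrictMonoOn M.Ψ (Icc M.αmax M.βmin) := by
  intro p hp q hq hpq
  rw [← sub_pos, M.Ψ_sub hαβ hp hq]
  refine intervalIntegral.intervalIntegral_pos_of_pos_on
    (M.intervalIntegrable_minMobility hp hq) (fun a ha => ?_) hpq
  exact M.minMobility_pos ⟨hp.1.trans_lt ha.1, ha.2.trans_le hq.2⟩

lemma hasDerivAt_Ψ (hαβ : M.αmax < M.βmin) {p : ℝ} (hp : p ∈ Ioo M.αmax M.βmin) :
    HasDerivAt M.Ψ (M.minMobility p) p := by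
  have hn : Icc M.αmax M.βmin ∈ 𝓝 p := Icc_mem_nhds hp.1 hp.2
  exact intervalIntegral.integral_hasDerivAt_right
    (M.intervalIntegrable_minMobility ⟨le_rfl, hαβ.le⟩ (Ioo_subset_Icc_self hp))
    (M.continuousOn_minMobility.stronglyMeasurableAtFilter_nhdsWithin measurableSet_Icc p
      |>.filter_mono (by rw [nhdsWithin_eq_nhds.2 hn]))
    (M.continuousOn_minMobility.continuousAt hn)

lemma truncCap_mem (hαβ : M.αmax < M.βmin) (s : ℝ) : M.truncCap i s ∈ Icc M.αmax M.βmin :=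
  ⟨le_min hαβ.le (le_max_left _ _), min_le_left _ _⟩

lemma Ψ_truncCap_mem (hαβ : M.αmax < M.βmin) (s : ℝ) :
    M.Ψ (M.truncCap i s) ∈ Icc 0 (M.Ψ M.βmin) := by
  have h := M.truncCap_mem i hαβ s
  have h0 : M.Ψ M.αmax = 0 := intervalIntegral.integral_same
  rw [← h0]
  exact ⟨(M.strictMonoOn_Ψ hαβ).monotoneOn ⟨le_rfl, hαβ.le⟩ h h.1,
    (M.strictMonoOn_Ψ hαβ).monotoneOn h ⟨hαβ.le, le_rfl⟩ h.2⟩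

lemma truncCap_of_le (hαβ : M.αmax < M.βmin) {s : ℝ} (h : M.cap i s ≤ M.αmax) :
    M.truncCap i s = M.αmax := by
  rw [truncCap, max_eq_left h, min_eq_right hαβ.le]

lemma truncCap_of_ge {s : ℝ} (h : M.βmin ≤ M.cap i s) : M.truncCap i s = M.βmin :=
  min_eq_left (h.trans (le_max_right _ _))

lemma truncCap_of_mem {s : ℝ} (h : M.cap i s ∈ Icc M.αmax M.βmin) :
    M.truncCap i s = M.cap i s := by
  rw [truncCap, max_eq_right h.1, min_eq_right h.2]

/-- Bound the minimum of the mobilities by `λ_i` and substitute `a = π_i(x)`: the increment of `Ψ`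
between the truncated pressures is at most the increment of `φ_i` between the saturations `σ ≤ τ`
realising them, and `s ≤ σ`, `τ ≤ t`. -/
lemma Ψ_truncCap_sub_le (hαβ : M.αmax < M.βmin) {s t : ℝ} (hs : s ∈ Icc (0 : ℝ) 1)
    (ht : t ∈ Icc (0 : ℝ) 1) (hst : s ≤ t) :
    |M.Ψ (M.truncCap i t) - M.Ψ (M.truncCap i s)| ≤ M.φ i t - M.φ i s := by
  have hcap : M.cap i s ≤ M.cap i t := (M.strictMonoOn_cap i).monotoneOn hs ht hst
  set p := M.truncCap i s with hp
  set q := M.truncCap i t with hq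
  have hpm : p ∈ Icc M.αmax M.βmin := M.truncCap_mem i hαβ s
  have hqm : q ∈ Icc M.αmax M.βmin := M.truncCap_mem i hαβ t
  have hpq : p ≤ q := min_le_min le_rfl (max_le_max le_rfl hcap)
  rw [abs_of_nonneg (sub_nonneg.2 ((M.strictMonoOn_Ψ hαβ).monotoneOn hpm hqm hpq))]
  rcases hpq.lt_or_eq with hlt | heq
  swap
  · rw [heq, sub_self, sub_nonneg]
    exact (M.strictMonoOn_φ i).monotoneOn hs ht hst
  -- Truncation lowers a pressure only to the value `β`, and then there is no room for `p < q`. The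
  -- bound on `q` is symmetric.
  have hps : M.cap i s ≤ p := by
    by_contra hcon
    rw [not_le] at hcon
    have h1 : p = M.βmin := by
      rw [hp, truncCap, min_eq_left_iff]
      by_contra h2
      rw [not_le] at h2
      rw [hp, truncCap, min_eq_right h2.le] at hcon
      exact absurd hcon (le_max_right _ _).not_gt
    exact absurd (h1 ▸ hlt) hqm.2.not_gt
  have hqt : q ≤ M.cap i t := by
    by_contra hcon
    rw [not_le] at hcon
    have h1 : q ≤ max M.αmax (M.cap i t) := min_le_right _ _
    rcases le_max_iff.1 h1 with h2 | h2
    · exact absurd (hlt.trans_le h2) hpm.1.not_gt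
    · exact absurd hcon h2.not_gt
  obtain ⟨hσ, hσp⟩ := M.capInv_mem i (M.Icc_subset_Icc_capRange i hpm)
  obtain ⟨hτ, hτq⟩ := M.capInv_mem i (M.Icc_subset_Icc_capRange i hqm)
  set σ := M.capInv i p
  set τ := M.capInv i q
  have hsσ : s ≤ σ := by
    rw [← (M.strictMonoOn_cap i).le_iff_le hs hσ, hσp]; exact hps
  have hτt : τ ≤ t := by
    rw [← (M.strictMonoOn_cap i).le_iff_le hτ ht, hτq]; exact hqt
  have hστ : σ < τ := by
    rw [← (M.strictMonoOn_cap i).lt_iff_lt hσ hτ, hσp, hτq]; exact hlt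
  have hsub : Icc p q ⊆ Icc M.αmax M.βmin := Icc_subset_Icc hpm.1 hqm.2
  have hsub' : Icc σ τ ⊆ Icc (0 : ℝ) 1 := Icc_subset_Icc hσ.1 hτ.2
  have himg : M.cap i '' uIcc σ τ ⊆ Icc p q := by
    rw [uIcc_of_le hστ.le]
    rintro _ ⟨x, hx, rfl⟩
    rw [← hσp, ← hτq]
    exact ⟨(M.strictMonoOn_cap i).monotoneOn hσ (hsub' hx) hx.1,
      (M.strictMonoOn_cap i).monotoneOn (hsub' hx) hτ hx.2⟩
  have hchange := intervalIntegral.integral_comp_mul_deriv'' (f := M.cap i)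
    (f' := derivWithin (M.cap i) (Icc 0 1)) (g := fun a => M.mobility i (M.capInv i a))
    (a := σ) (b := τ)
    ((M.cap_contDiffOn i).continuousOn.mono (by rwa [uIcc_of_le hστ.le]))
    (fun x hx => (M.hasDerivAt_cap i (by
      rw [min_eq_left hστ.le, max_eq_right hστ.le] at hx
      exact ⟨hσ.1.trans_lt hx.1, hx.2.trans_le hτ.2⟩)).hasDerivWithinAt)
    ((M.continuousOn_derivWithin_cap i).mono (by rwa [uIcc_of_le hστ.le]))
    ((M.continuousOn_mobility_capInv i).mono (himg.trans hsub))
  rw [hσp, hτq] at hchange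
  calc M.Ψ q - M.Ψ p = ∫ a in p..q, M.minMobility a := M.Ψ_sub hαβ hpm hqm
    _ ≤ ∫ a in p..q, M.mobility i (M.capInv i a) := by
        refine intervalIntegral.integral_mono_on hpq (M.intervalIntegrable_minMobility hpm hqm)
          ?_ fun a _ => M.minMobility_le i a
        exact ((M.continuousOn_mobility_capInv i).mono
          (ordConnected_Icc.uIcc_subset hpm hqm)).intervalIntegrable
    _ = ∫ a in σ..τ, M.mobility i a * derivWithin (M.cap i) (Icc 0 1) a := by
        rw [← hchange]
        refine intervalIntegral.integral_congr fun x hx => ?_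
        rw [uIcc_of_le hστ.le] at hx
        simp only [Function.comp, M.capInv_cap i (hsub' hx)]
    _ = M.φ i τ - M.φ i σ := (M.φ_sub i hσ hτ).symm
    _ ≤ M.φ i t - M.φ i s := by
        have h1 := (M.strictMonoOn_φ i).monotoneOn hs hσ hsσ
        have h2 := (M.strictMonoOn_φ i).monotoneOn hτ ht hτt
        linarith

lemma abs_Ψ_truncCap_sub_le (hαβ : M.αmax < M.βmin) {s t : ℝ} (hs : s ∈ Icc (0 : ℝ) 1)
    (ht : t ∈ Icc (0 : ℝ) 1) :
    |M.Ψ (M.truncCap i s) - M.Ψ (M.truncCap i t)| ≤ |M.φ i s - M.φ i t| := by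
  rcases le_total s t with h | h
  · rw [abs_sub_comm, abs_sub_comm (M.φ i s)]
    exact (M.Ψ_truncCap_sub_le i hαβ hs ht h).trans (le_abs_self _)
  · exact (M.Ψ_truncCap_sub_le i hαβ ht hs h).trans (le_abs_self _)

/-- `Ψ ∘ π̂_i` is a Lipschitz function of `φ_i`, with finitely many corners. -/
theorem exists_lipschitz_transition (hαβ : M.αmax < M.βmin) :
    ∃ F : ℝ → ℝ, LipschitzWith 1 F ∧ F 0 = 0 ∧
      (∀ s ∈ Icc (0 : ℝ) 1, F (M.φ i s) = M.Ψ (M.truncCap i s)) ∧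
      ∃ S : Set ℝ, S.Finite ∧ ∀ p ∉ S, DifferentiableAt ℝ F p := by
  obtain ⟨e, he⟩ := exists_orderIso_eqOn_Icc (M.strictMonoOn_φ i) (M.continuousOn_φ i)
  -- On the range of `φ_i` this is `Ψ ∘ π̂_i ∘ φ_i⁻¹`. The clamp makes it constant on either side of
  -- that range.
  set F : ℝ → ℝ := fun p => M.Ψ (M.truncCap i (clamp (e.symm p))) with hF
  have hFφ : ∀ s ∈ Icc (0 : ℝ) 1, F (M.φ i s) = M.Ψ (M.truncCap i s) := fun s hs => by
    simp only [hF, ← he s hs, OrderIso.symm_apply_apply, clamp_of_mem hs]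
  have h0 : (0 : ℝ) ∈ Icc (0 : ℝ) 1 := ⟨le_rfl, zero_le_one⟩
  have h1 : (1 : ℝ) ∈ Icc (0 : ℝ) 1 := ⟨zero_le_one, le_rfl⟩
  -- The possible corners are the ends of the range of `φ_i` and the values at which `π_i` reaches
  -- `α` and `β`. Elsewhere `F` is locally constant or a composition of differentiable functions,
  -- the inverse of `φ_i` included since `λ_i π_i' > 0` on `(0,1)`.
  refine ⟨F, ?_, ?_, hFφ, {M.φ i 0, M.φ i 1, M.φ i (M.capInv i M.αmax),
    M.φ i (M.capInv i M.βmin)}, by simp, fun p hp => ?_⟩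
  · refine LipschitzWith.of_dist_le_mul fun p q => ?_
    rw [Real.dist_eq, Real.dist_eq, NNReal.coe_one, one_mul]
    refine (M.abs_Ψ_truncCap_sub_le i hαβ (clamp_mem _) (clamp_mem _)).trans ?_
    -- Conjugated by `e`, the clamp becomes the projection onto `[e 0, e 1]`, which is 1-Lipschitz.
    have hcl : ∀ p, M.φ i (clamp (e.symm p)) = max (e 0) (min (e 1) p) := fun p => by
      rw [← he _ (clamp_mem _), clamp]
      have e1 := e.map_sup 0 (min 1 (e.symm p))
      have e2 := e.map_inf 1 (e.symm p)
      rw [OrderIso.apply_symm_apply] at e2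
      exact e1.trans (by rw [e2])
    rw [hcl, hcl]
    calc |max (e 0) (min (e 1) p) - max (e 0) (min (e 1) q)|
        ≤ |min (e 1) p - min (e 1) q| := by
          simpa [max_comm] using abs_max_sub_max_le_abs (min (e 1) p) (min (e 1) q) (e 0)
      _ ≤ |p - q| := by simpa using abs_min_sub_min_le_max (e 1) p (e 1) q
  · have := hFφ 0 h0
    rw [M.φ_zero i, M.truncCap_of_le i hαβ (M.α_le_αmax i)] at this
    rw [this]
    exact intervalIntegral.integral_same
  · simp only [mem_insert_iff, mem_singleton_iff, not_or] at hp
    obtain ⟨hp0, hp1, hpα, hpβ⟩ := hp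
    obtain ⟨s, rfl⟩ := e.surjective p
    have hec : Tendsto e.symm (𝓝 (e s)) (𝓝 s) := by
      simpa using e.symm.continuous.tendsto (e s)
    have hne : ∀ a ∈ Icc (0 : ℝ) 1, e s ≠ M.φ i a → s ≠ a := by
      rintro a ha h rfl
      exact h (he s ha)
    have hconst : ∀ c : ℝ, (∀ᶠ q in 𝓝 (e s), F q = c) → DifferentiableAt ℝ F (e s) := fun c hc =>
      (differentiableAt_const (𝕜 := ℝ) (E := ℝ) c).congr_of_eventuallyEq hc
    rcases lt_or_gt_of_ne (hne 0 h0 hp0) with hs0 | hs0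
    · refine hconst (M.Ψ (M.truncCap i 0)) ?_
      filter_upwards [hec.eventually (gt_mem_nhds hs0)] with q hq
      simp only [hF, clamp_of_le hq.le]
    rcases lt_or_gt_of_ne (hne 1 h1 hp1) with hs1 | hs1
    swap
    · refine hconst (M.Ψ (M.truncCap i 1)) ?_
      filter_upwards [hec.eventually (lt_mem_nhds hs1)] with q hq
      simp only [hF, clamp_of_ge (le_of_lt hq)]
    have hs : s ∈ Ioo (0 : ℝ) 1 := ⟨hs0, hs1⟩
    have hsI := Ioo_subset_Icc_self hs
    have hin : ∀ᶠ q in 𝓝 (e s), clamp (e.symm q) = e.symm q := by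
      filter_upwards [hec.eventually (Icc_mem_nhds hs0 hs1)] with q hq using clamp_of_mem hq
    have hcapc : Tendsto (fun q => M.cap i (e.symm q)) (𝓝 (e s)) (𝓝 (M.cap i s)) :=
      (M.hasDerivAt_cap i hs).continuousAt.tendsto.comp hec
    have hcapne : ∀ a, a ∈ Icc M.αmax M.βmin → e s ≠ M.φ i (M.capInv i a) → M.cap i s ≠ a := by
      rintro a _ hne rfl
      rw [M.capInv_cap i hsI] at hne
      exact hne (he s hsI)
    rcases lt_or_gt_of_ne (hcapne _ ⟨le_rfl, hαβ.le⟩ hpα) with hα | hα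
    · refine hconst (M.Ψ M.αmax) ?_
      filter_upwards [hin, hcapc.eventually (gt_mem_nhds hα)] with q hq hq2
      simp only [hF, hq, M.truncCap_of_le i hαβ (le_of_lt hq2)]
    rcases lt_or_gt_of_ne (hcapne _ ⟨hαβ.le, le_rfl⟩ hpβ) with hβ | hβ
    swap
    · refine hconst (M.Ψ M.βmin) ?_
      filter_upwards [hin, hcapc.eventually (lt_mem_nhds hβ)] with q hq hq2
      simp only [hF, hq, M.truncCap_of_ge i (le_of_lt hq2)]
    have heq : F =ᶠ[𝓝 (e s)] fun q => M.Ψ (M.cap i (e.symm q)) := by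
      filter_upwards [hin, hcapc.eventually (Icc_mem_nhds hα hβ)] with q hq hq2
      simp only [hF, hq, M.truncCap_of_mem i hq2]
    have hed : HasDerivAt e (M.mobility i s * derivWithin (M.cap i) (Icc 0 1) s) s := by
      refine (M.hasDerivAt_φ i hs).congr_of_eventuallyEq ?_
      filter_upwards [Icc_mem_nhds hs0 hs1] with x hx using he x hx
    have hinv : HasDerivAt e.symm (M.mobility i s * derivWithin (M.cap i) (Icc 0 1) s)⁻¹ (e s) := by
      refine HasDerivAt.of_local_left_inverse e.symm.continuous.continuousAt ?_
        (M.mobility_mul_pos i hs).ne' (.of_forall fun q => e.apply_symm_apply q)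
      rwa [OrderIso.symm_apply_apply]
    refine DifferentiableAt.congr_of_eventuallyEq ?_ heq
    have hΨ : DifferentiableAt ℝ M.Ψ (M.cap i (e.symm (e s))) := by
      rw [OrderIso.symm_apply_apply]
      exact (M.hasDerivAt_Ψ hαβ ⟨hα, hβ⟩).differentiableAt
    have hcap : DifferentiableAt ℝ (M.cap i) (e.symm (e s)) := by
      rw [OrderIso.symm_apply_apply]
      exact (M.hasDerivAt_cap i hs).differentiableAt
    exact hΨ.comp (e s) (hcap.comp (e s) hinv.differentiableAt)

/-- The vertical parts of the graph lie below `α_i ≤ α` or above `β_i ≥ β`, so truncation collapses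
them to `α` or `β`. -/
lemma truncCap_eq_of_mem_capGraph (hαβ : M.αmax < M.βmin) {s p : ℝ}
    (hp : p ∈ M.capGraph i s) : M.truncCap i s = min M.βmin (max M.αmax p) := by
  unfold capGraph at hp
  split_ifs at hp with h0 h1
  · have h2 : p ≤ M.αmax := (mem_Iic.1 hp).trans (M.α_le_αmax i)
    rw [h0, M.truncCap_of_le i hαβ (M.α_le_αmax i), max_eq_left h2, min_eq_right hαβ.le]
  · have h2 : M.βmin ≤ p := (M.βmin_le_β i).trans (mem_Ici.1 hp)
    rw [h1, M.truncCap_of_ge i (M.βmin_le_β i), min_eq_left (h2.trans (le_max_right _ _))]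
  · rw [mem_singleton_iff.1 hp]; rfl

lemma cap_mem_capGraph (s : ℝ) : M.cap i s ∈ M.capGraph i s := by
  unfold capGraph
  split_ifs with h0 h1
  · rw [h0]; exact le_refl (M.α i)
  · rw [h1]; exact le_refl (M.β i)
  · rfl

lemma mem_capGraph_of_le {s p : ℝ} (hs : s ∈ Icc (0 : ℝ) 1) (h : M.cap i s ≤ M.α i)
    (hp : p ≤ M.α i) : p ∈ M.capGraph i s := by
  have h0 : s = 0 := le_antisymm
    (((M.strictMonoOn_cap i).le_iff_le hs ⟨le_rfl, zero_le_one⟩).1 h) hs.1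
  rw [capGraph, if_pos h0]
  exact hp

lemma mem_capGraph_of_ge {s p : ℝ} (hs : s ∈ Icc (0 : ℝ) 1) (h : M.β i ≤ M.cap i s)
    (hp : M.β i ≤ p) : p ∈ M.capGraph i s := by
  have h1 : s = 1 := le_antisymm hs.2
    (((M.strictMonoOn_cap i).le_iff_le ⟨zero_le_one, le_rfl⟩ hs).1 h)
  rw [capGraph, if_neg (by rw [h1]; exact one_ne_zero), if_pos h1]
  exact hp

/-- The graphs of the capillary pressures meet exactly when the truncated capillary pressures are
equal. -/
theorem capGraph_inter_nonempty_iff (hαβ : M.αmax < M.βmin) {s t : ℝ} (hs : s ∈ Icc (0 : ℝ) 1)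
    (ht : t ∈ Icc (0 : ℝ) 1) :
    (M.capGraph 0 s ∩ M.capGraph 1 t).Nonempty ↔ M.truncCap 0 s = M.truncCap 1 t := by
  constructor
  · rintro ⟨p, hp, hq⟩
    rw [M.truncCap_eq_of_mem_capGraph 0 hαβ hp, M.truncCap_eq_of_mem_capGraph 1 hαβ hq]
  · intro h
    have key : ∀ j : Fin 2, ∀ r ∈ Icc (0 : ℝ) 1, ∀ p, M.truncCap j r = p →
        (p = M.αmax ∧ M.cap j r ≤ M.αmax) ∨ (p = M.βmin ∧ M.βmin ≤ M.cap j r) ∨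
          (p ∈ Ioo M.αmax M.βmin ∧ M.cap j r = p) := by
      intro j r hr p hp
      rcases le_or_gt (M.cap j r) M.αmax with h1 | h1
      · exact Or.inl ⟨by rw [← hp, M.truncCap_of_le j hαβ h1], h1⟩
      rcases le_or_gt M.βmin (M.cap j r) with h2 | h2
      · exact Or.inr (Or.inl ⟨by rw [← hp, M.truncCap_of_ge j h2], h2⟩)
      · rw [M.truncCap_of_mem j ⟨h1.le, h2.le⟩] at hp
        exact Or.inr (Or.inr ⟨by rw [← hp]; exact ⟨h1, h2⟩, hp⟩)
    -- Only the three diagonal cases are consistent. When both pressures are at most `α`, the medium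
    -- with `α_i = α` has saturation `0`, and its vertical half-line contains the pressure of the
    -- other medium. The case of `β` is symmetric.
    rcases key 0 s hs _ rfl with ⟨a1, a2⟩ | ⟨a1, a2⟩ | ⟨a1, a2⟩ <;>
    rcases key 1 t ht _ h.symm with ⟨b1, b2⟩ | ⟨b1, b2⟩ | ⟨b1, b2⟩
    · rcases max_choice (M.α 0) (M.α 1) with hm | hm
      · have hm : M.αmax = M.α 0 := hm
        rw [hm] at a2 b2
        exact ⟨M.cap 1 t, M.mem_capGraph_of_le 0 hs a2 b2, M.cap_mem_capGraph 1 t⟩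
      · have hm : M.αmax = M.α 1 := hm
        rw [hm] at a2 b2
        exact ⟨M.cap 0 s, M.cap_mem_capGraph 0 s, M.mem_capGraph_of_le 1 ht b2 a2⟩
    · exact absurd (a1.symm.trans b1) hαβ.ne
    · exact absurd a1 b1.1.ne'
    · exact absurd (b1.symm.trans a1) hαβ.ne
    · rcases min_choice (M.β 0) (M.β 1) with hm | hm
      · have hm : M.βmin = M.β 0 := hm
        rw [hm] at a2 b2
        exact ⟨M.cap 1 t, M.mem_capGraph_of_ge 0 hs a2 b2, M.cap_mem_capGraph 1 t⟩
      · have hm : M.βmin = M.β 1 := hm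
        rw [hm] at a2 b2
        exact ⟨M.cap 0 s, M.cap_mem_capGraph 0 s, M.mem_capGraph_of_ge 1 ht b2 a2⟩
    · exact absurd a1 b1.2.ne
    · exact absurd b1 a1.1.ne'
    · exact absurd b1 a1.2.ne
    · refine ⟨M.cap 0 s, M.cap_mem_capGraph 0 s, ?_⟩
      have := M.cap_mem_capGraph 1 t
      rwa [b2, ← a2] at this

end Medium

/-! ### Sides and intersections of hyperplanes -/

section Hyperplanes

variable {V : Type*} [NormedAddCommGroup V] [InnerProductSpace ℝ V] [FiniteDimensional ℝ V]

/-- Every neighbourhood of a point of a hyperplane meets both sides of the hyperplane. -/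
lemma exists_mem_side {a : V} (ha : a ≠ 0) {b : ℝ} {O : Set V} (hO : IsOpen O) {y : V} (hy : y ∈ O)
    (hyb : inner ℝ a y = b) {K : Set ℝ} (hK : IsSide K) : ∃ z ∈ O, z ∈ side a b K := by
  have hc : Continuous fun s : ℝ => y + s • a := by fun_prop
  have hO' : IsOpen ((fun s : ℝ => y + s • a) ⁻¹' O) := hO.preimage hc
  obtain ⟨ε, hε, hεO⟩ := Metric.isOpen_iff.1 hO' 0 (by simpa using hy)
  have hin : ∀ s : ℝ, inner ℝ a (y + s • a) - b = s * ‖a‖ ^ 2 := fun s => by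
    rw [inner_add_right, inner_smul_right, real_inner_self_eq_norm_sq, hyb]; ring
  have key : ∀ s : ℝ, |s| < ε → s ∈ K → ∃ z ∈ O, z ∈ side a b K := fun s hs hsK =>
    ⟨y + s • a, hεO (by simpa using hs), by
      simp only [side, mem_ofPred_eq, hin]
      exact (hK.mul_mem_iff (pow_pos (norm_pos_iff.2 ha) 2) _).2 hsK⟩
  have h2 : |ε / 2| < ε := by rw [abs_of_pos (by positivity)]; linarith
  rcases hK with rfl | rfl | rfl
  · exact key (ε / 2) h2 (by simp only [mem_Ioi]; positivity)
  · exact key (-(ε / 2)) (by rwa [abs_neg]) (by simp only [mem_Iio]; linarith)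
  · exact key (ε / 2) h2 (mem_univ _)

lemma isPreconnected_side_inter_ball (a : V) (b : ℝ) {K : Set ℝ} (hK : IsSide K) (x : V) (r : ℝ) :
    IsPreconnected (side a b K ∩ Metric.ball x r) := by
  have hKc : Convex ℝ K := by
    rcases hK with rfl | rfl | rfl
    exacts [convex_Ioi 0, convex_Iio 0, convex_univ]
  refine (Convex.inter ?_ (convex_ball x r)).isPreconnected
  intro y hy z hz s t hs ht hst
  have := hKc hy hz hs ht hst
  simp only [side, mem_ofPred_eq, inner_add_right, inner_smul_right]
  simp only [smul_eq_mul] at this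
  convert this using 1
  have : b = (s + t) * b := by rw [hst, one_mul]
  linarith

/-- The inclusion makes `a'` orthogonal to `aᗮ`, hence a nonzero multiple of `a`. The same
hyperplane may thus be listed several times with different equations. -/
lemma hyperplane_eq_of_subset {a a' : V} (ha : a ≠ 0) (ha' : a' ≠ 0) {b b' : ℝ}
    (h : {x : V | inner ℝ a x = b} ⊆ {x | inner ℝ a' x = b'}) :
    {x : V | inner ℝ a' x = b'} ⊆ {x | inner ℝ a x = b} := by
  have hna : ‖a‖ ^ 2 ≠ 0 := pow_ne_zero _ (norm_ne_zero_iff.2 ha)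
  set p : V := (b / ‖a‖ ^ 2) • a with hp
  have hpb : inner ℝ a p = b := by
    rw [hp, inner_smul_right, real_inner_self_eq_norm_sq]; field_simp
  have hpb' : inner ℝ a' p = b' := h hpb
  have horth : a' ∈ (ℝ ∙ a)ᗮᗮ := by
    rw [Submodule.mem_orthogonal]
    intro y hy
    have hy0 : inner ℝ a y = 0 := (Submodule.mem_orthogonal_singleton_iff_inner_right).1 hy
    have h1 : inner ℝ a' (p + y) = b' := h (by
      simp only [mem_ofPred_eq]
      rw [inner_add_right, hpb, hy0, add_zero])
    rw [inner_add_right, hpb'] at h1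
    rw [real_inner_comm]
    linarith
  rw [Submodule.orthogonal_orthogonal, Submodule.mem_span_singleton] at horth
  obtain ⟨t, rfl⟩ := horth
  have ht : t ≠ 0 := fun h0 => ha' (by rw [h0, zero_smul])
  intro x hx
  have h1 : inner ℝ (t • a) x = inner ℝ (t • a) p := by rw [hpb']; exact hx
  rw [inner_smul_left, inner_smul_left] at h1
  have h2 := mul_left_cancel₀ (by simpa using ht) h1
  rw [mem_ofPred_eq, h2, hpb]

variable [MeasurableSpace V] [BorelSpace V]

/-- Two distinct hyperplanes meet in a set of codimension two. -/
lemma ae_hyperplane_notMem {a a' : V} (ha : a ≠ 0) {b b' : ℝ}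
    (h : ¬ {x : V | inner ℝ a x = b} ⊆ {x | inner ℝ a' x = b'}) :
    ∀ᵐ x ∂((Measure.hausdorffMeasure ((Module.finrank ℝ V : ℝ) - 1)).restrict
      {x : V | inner ℝ a x = b}), inner ℝ a' x ≠ b' := by
  rw [ae_hyperplane_iff ha]
  by_cases hex : ∃ y₁ : (ℝ ∙ a)ᗮ, inner ℝ a' (flat ha b (y₁, 0)) = b'
  swap
  · push Not at hex
    exact ae_of_all _ hex
  obtain ⟨y₁, hy₁⟩ := hex
  obtain ⟨x₀, hx₀, hx₀'⟩ := not_subset.1 h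
  rw [← range_flat_zero ha b] at hx₀
  obtain ⟨y₀, rfl⟩ := hx₀
  let ℓ : (ℝ ∙ a)ᗮ →ₗ[ℝ] ℝ := (innerₛₗ ℝ a').comp (ℝ ∙ a)ᗮ.subtype
  have hℓ : ∀ y : (ℝ ∙ a)ᗮ, inner ℝ a' (flat ha b (y, 0)) = ℓ (y - y₁) + b' := by
    intro y
    rw [← hy₁]
    simp only [flat, affineHomeo_apply, flatEquiv_apply, zero_smul, add_zero, inner_add_right, ℓ,
      LinearMap.comp_apply, innerₛₗ_apply_apply, Submodule.subtype_apply, Submodule.coe_sub,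
      inner_sub_right]
    ring
  have hker : LinearMap.ker ℓ ≠ ⊤ := by
    intro htop
    have h1 : y₀ - y₁ ∈ LinearMap.ker ℓ := htop ▸ Submodule.mem_top
    exact hx₀' (by
      simp only [mem_ofPred_eq]
      rw [hℓ, LinearMap.mem_ker.1 h1, zero_add])
  have h0 := Measure.addHaar_submodule (volume : Measure (ℝ ∙ a)ᗮ) (LinearMap.ker ℓ) hker
  have h1 : ∀ᵐ z : (ℝ ∙ a)ᗮ, z ∉ (LinearMap.ker ℓ : Set (ℝ ∙ a)ᗮ) := measure_eq_zero_iff_ae_notMem.1 h0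
  have h2 := (measurePreserving_sub_right (volume : Measure (ℝ ∙ a)ᗮ) y₁).quasiMeasurePreserving.ae h1
  filter_upwards [h2] with y hy hyb
  rw [hℓ] at hyb
  exact hy (LinearMap.mem_ker.2 (by linarith))

end Hyperplanes

/-! ### Local geometry of the interface -/

namespace Medium

variable {d : ℕ} (M : Medium d 2)

lemma isOpen_sub (i : Fin 2) : IsOpen (M.sub i) := (M.sub_polygonal i).isOpen

lemma disjoint_sub : Disjoint (M.sub 0) (M.sub 1) := M.sub_disjoint 0 1 zero_ne_one

lemma closure_Ω : closure M.Ω = closure (M.sub 0) ∪ closure (M.sub 1) := by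
  rw [← M.iUnion_closure]
  ext x
  simp [mem_iUnion, Fin.exists_fin_two]

lemma mem_frontier_sub {x : Space d} (i : Fin 2) (h : x ∈ closure (M.sub i)) (h' : x ∉ M.sub i) :
    x ∈ frontier (M.sub i) := by
  rw [(M.isOpen_sub i).frontier_eq]; exact ⟨h, h'⟩

/-- The absence of slits is used here: `Ω_i` is the interior of its closure, so points of `Ω`
outside the closure of `Ω_i`, which belong to the closure of `Ω_j`, accumulate at `x`. -/
lemma mem_closure_sub_of_notMem {i j : Fin 2} (hij : closure M.Ω ⊆ closure (M.sub i) ∪ closure (M.sub j))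
    {x : Space d} (hx : x ∈ M.Ω) (hxi : x ∉ M.sub i) : x ∈ closure (M.sub j) := by
  rw [← (M.sub_polygonal i).interior_closure] at hxi
  have h1 : x ∈ closure (closure (M.sub i))ᶜ := by
    rw [closure_compl]; exact hxi
  rw [← closure_closure, mem_closure_iff]
  intro O hO hxO
  obtain ⟨y, ⟨hyO, hyΩ⟩, hyi⟩ := mem_closure_iff.1 h1 (O ∩ M.Ω)
    (hO.inter M.polygonal.isOpen) ⟨hxO, hx⟩
  exact ⟨y, hyO, (hij (subset_closure hyΩ)).resolve_left hyi⟩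

/-- The medium is the union of the two subdomains and of the interface. -/
lemma mem_sub_or_interface {x : Space d} (hx : x ∈ M.Ω) :
    x ∈ M.sub 0 ∨ x ∈ M.sub 1 ∨ x ∈ M.interface 0 1 := by
  by_cases h0 : x ∈ M.sub 0
  · exact Or.inl h0
  by_cases h1 : x ∈ M.sub 1
  · exact Or.inr (Or.inl h1)
  have c1 := M.mem_closure_sub_of_notMem (i := 0) (j := 1) M.closure_Ω.subset hx h0
  have c0 := M.mem_closure_sub_of_notMem (i := 1) (j := 0)
    (by rw [union_comm]; exact M.closure_Ω.subset) hx h1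
  exact Or.inr (Or.inr ⟨⟨M.mem_frontier_sub 0 c0 h0, M.mem_frontier_sub 1 c1 h1⟩, hx⟩)

lemma exists_hyperplanes : ∃ H : Finset (Space d × ℝ), (∀ h ∈ H, h.1 ≠ 0) ∧
    ∀ i, frontier (M.sub i) ⊆ ⋃ h ∈ H, {x : Space d | inner ℝ h.1 x = h.2} := by
  classical
  obtain ⟨H₀, h₀, h₀'⟩ := (M.sub_polygonal 0).flat_boundary
  obtain ⟨H₁, h₁, h₁'⟩ := (M.sub_polygonal 1).flat_boundary
  refine ⟨H₀ ∪ H₁, fun h hh => ?_, fun i => ?_⟩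
  · rcases Finset.mem_union.1 hh with hh | hh
    exacts [h₀ h hh, h₁ h hh]
  · fin_cases i
    · exact h₀'.trans (biUnion_subset_biUnion_left fun h hh => Finset.mem_union_left _ hh)
    · exact h₁'.trans (biUnion_subset_biUnion_left fun h hh => Finset.mem_union_right _ hh)

/-- Near a generic point of the interface, the two subdomains are the two sides of a hyperplane. -/
theorem ae_interface_sides {H : Finset (Space d × ℝ)} (hH : ∀ h ∈ H, h.1 ≠ 0)
    (hf : ∀ i, frontier (M.sub i) ⊆ ⋃ h ∈ H, {x : Space d | inner ℝ h.1 x = h.2})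
    {h : Space d × ℝ} (hh : h ∈ H) :
    ∀ᵐ x ∂((Measure.hausdorffMeasure ((d : ℝ) - 1)).restrict {x : Space d | inner ℝ h.1 x = h.2}),
      x ∈ M.interface 0 1 → ∃ r > 0, ∃ K : Fin 2 → Set ℝ, (∀ i, IsSide (K i)) ∧
        ∀ i, M.sub i ∩ Metric.ball x r = side h.1 h.2 (K i) ∩ Metric.ball x r := by
  have ha := hH h hh
  -- A generic point of the hyperplane lies on no other hyperplane of `H`. This persists in a small
  -- ball, so that there the boundaries of the subdomains lie in this hyperplane alone.
  have hgen : ∀ᵐ x ∂((Measure.hausdorffMeasure ((d : ℝ) - 1)).restrict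
      {x : Space d | inner ℝ h.1 x = h.2}), ∀ k ∈ H,
      ¬ {x : Space d | inner ℝ h.1 x = h.2} ⊆ {x | inner ℝ k.1 x = k.2} → inner ℝ k.1 x ≠ k.2 := by
    rw [Filter.eventually_all_finset]
    intro k hk
    by_cases hs : {x : Space d | inner ℝ h.1 x = h.2} ⊆ {x | inner ℝ k.1 x = k.2}
    · exact ae_of_all _ fun x hx => absurd hs hx
    · have := ae_hyperplane_notMem ha hs
      rw [finrank_euclideanSpace_fin] at this
      filter_upwards [this] with x hx _ using hx
  have hmem : ∀ᵐ x ∂((Measure.hausdorffMeasure ((d : ℝ) - 1)).restrict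
      {x : Space d | inner ℝ h.1 x = h.2}), inner ℝ h.1 x = h.2 :=
    ae_restrict_mem (isClosed_eq (by fun_prop) continuous_const).measurableSet
  filter_upwards [hgen, hmem] with x hx hxh hxΓ
  have hnear : ∀ᶠ y in 𝓝 x, ∀ k ∈ H,
      ¬ {x : Space d | inner ℝ h.1 x = h.2} ⊆ {x | inner ℝ k.1 x = k.2} → inner ℝ k.1 y ≠ k.2 := by
    rw [Filter.eventually_all_finset]
    intro k hk
    by_cases hs : {x : Space d | inner ℝ h.1 x = h.2} ⊆ {x | inner ℝ k.1 x = k.2}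
    · exact .of_forall fun x hx => absurd hs hx
    · have hc : ContinuousAt (fun y : Space d => inner ℝ k.1 y) x := by fun_prop
      filter_upwards [hc.eventually_ne (hx k hk hs)] with y hy _ using hy
  obtain ⟨r, hr, hball⟩ := Metric.eventually_nhds_iff_ball.1
    (hnear.and (M.polygonal.isOpen.mem_nhds hxΓ.2))
  have hfr : ∀ i, ∀ y ∈ Metric.ball x r, y ∈ frontier (M.sub i) → inner ℝ h.1 y = h.2 := by
    intro i y hy hyf
    obtain ⟨k, hk, hyk⟩ := mem_iUnion₂.1 (hf i hyf)
    by_cases hs : {x : Space d | inner ℝ h.1 x = h.2} ⊆ {x | inner ℝ k.1 x = k.2}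
    · exact hyperplane_eq_of_subset ha (hH k hk) hs hyk
    · exact absurd hyk ((hball y hy).1 k hk hs)
  have hpos : IsSide (Ioi 0) := Or.inl rfl
  have hneg : IsSide (Iio 0) := Or.inr (Or.inl rfl)
  -- An open half ball is connected and covered by the two disjoint open subdomains, so it lies in
  -- one of them. The condition `0 ∉ K` excludes the whole ball.
  have hhalf : ∀ K : Set ℝ, IsSide K → (0 : ℝ) ∉ K →
      side h.1 h.2 K ∩ Metric.ball x r ⊆ M.sub 0 ∨ side h.1 h.2 K ∩ Metric.ball x r ⊆ M.sub 1 := by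
    intro K hK h0
    refine (isPreconnected_side_inter_ball h.1 h.2 hK x r).subset_or_subset
      (M.isOpen_sub 0) (M.isOpen_sub 1) M.disjoint_sub ?_
    rintro y ⟨hy1, hy2⟩
    rcases M.mem_sub_or_interface (hball y hy2).2 with h1 | h1 | h1
    · exact Or.inl h1
    · exact Or.inr h1
    · have h3 := hfr 0 y hy2 h1.1.1
      simp only [side, mem_ofPred_eq, h3, sub_self] at hy1
      exact absurd hy1 h0
  have hsides : ∀ y : Space d, inner ℝ h.1 y = h.2 ∨ y ∈ side h.1 h.2 (Ioi 0) ∨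
      y ∈ side h.1 h.2 (Iio 0) := by
    intro y
    rcases lt_trichotomy (inner ℝ h.1 y) h.2 with h1 | h1 | h1
    · exact Or.inr (Or.inr (sub_neg.2 h1))
    · exact Or.inl h1
    · exact Or.inr (Or.inl (sub_pos.2 h1))
  have hdisj : ∀ i j : Fin 2, i ≠ j → ∀ y, y ∈ M.sub i → y ∈ M.sub j → False :=
    fun i j hij y h1 h2 => disjoint_left.1 (M.sub_disjoint i j hij) h1 h2
  -- a subdomain that avoids one side near `x` is contained in the other side
  have hone : ∀ i j : Fin 2, i ≠ j → ∀ K K' : Set ℝ, IsSide K' →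
      (∀ y : Space d, inner ℝ h.1 y = h.2 ∨ y ∈ side h.1 h.2 K ∨ y ∈ side h.1 h.2 K') →
      side h.1 h.2 K' ∩ Metric.ball x r ⊆ M.sub j →
      M.sub i ∩ Metric.ball x r ⊆ side h.1 h.2 K ∩ Metric.ball x r := by
    rintro i j hij K K' hK' hcover hsub y ⟨hyi, hyb⟩
    refine ⟨?_, hyb⟩
    rcases hcover y with h1 | h1 | h1
    · obtain ⟨z, ⟨hz1, hz2⟩, hz3⟩ := exists_mem_side ha
        ((M.isOpen_sub i).inter Metric.isOpen_ball) ⟨hyi, hyb⟩ h1 hK'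
      exact (hdisj i j hij z hz1 (hsub ⟨hz3, hz2⟩)).elim
    · exact h1
    · exact (hdisj i j hij y hyi (hsub ⟨h1, hyb⟩)).elim
  have hswap : ∀ y : Space d, inner ℝ h.1 y = h.2 ∨ y ∈ side h.1 h.2 (Iio 0) ∨
      y ∈ side h.1 h.2 (Ioi 0) := fun y => (hsides y).imp_right Or.symm
  -- the two sides are not in the same subdomain
  have hnot : ∀ i j : Fin 2, i ≠ j → x ∈ frontier (M.sub j) →
      side h.1 h.2 (Ioi 0) ∩ Metric.ball x r ⊆ M.sub i →
      side h.1 h.2 (Iio 0) ∩ Metric.ball x r ⊆ M.sub i → False := by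
    intro i j hij hxj h1 h2
    obtain ⟨y, hyb, hyj⟩ := mem_closure_iff.1 (frontier_subset_closure hxj) _
      Metric.isOpen_ball (Metric.mem_ball_self hr)
    have h3 := hone j i hij.symm (Iio 0) (Ioi 0) hpos hswap h1 ⟨hyj, hyb⟩
    exact hdisj i j hij y (h2 h3) hyj
  rcases hhalf (Ioi 0) hpos (by simp) with hp | hp <;>
  rcases hhalf (Iio 0) hneg (by simp) with hm | hm
  · exact (hnot 0 1 zero_ne_one hxΓ.1.2 hp hm).elim
  · refine ⟨r, hr, ![Ioi 0, Iio 0], fun i => ?_, fun i => ?_⟩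
    · fin_cases i
      exacts [hpos, hneg]
    · fin_cases i
      · exact Subset.antisymm (hone 0 1 zero_ne_one _ _ hneg hsides hm)
          fun y hy => ⟨hp hy, hy.2⟩
      · exact Subset.antisymm (hone 1 0 one_ne_zero _ _ hpos hswap hp)
          fun y hy => ⟨hm hy, hy.2⟩
  · refine ⟨r, hr, ![Iio 0, Ioi 0], fun i => ?_, fun i => ?_⟩
    · fin_cases i
      exacts [hneg, hpos]
    · fin_cases i
      · exact Subset.antisymm (hone 0 1 zero_ne_one _ _ hpos hswap hp)
          fun y hy => ⟨hm hy, hy.2⟩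
      · exact Subset.antisymm (hone 1 0 one_ne_zero _ _ hneg hsides hm)
          fun y hy => ⟨hp hy, hy.2⟩
  · exact (hnot 1 0 one_ne_zero hxΓ.1.1 hp hm).elim

end Medium

/-! ### Null sets, gluing over disjoint open sets, weak gradients -/

section General

variable {V : Type*} [NormedAddCommGroup V] [InnerProductSpace ℝ V] [FiniteDimensional ℝ V]
  [MeasurableSpace V] [BorelSpace V]

lemma volume_hyperplane {a : V} (ha : a ≠ 0) (b : ℝ) :
    volume {x : V | inner ℝ a x = b} = 0 := by
  set p : V := (b / ‖a‖ ^ 2) • a with hp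
  have hna : ‖a‖ ^ 2 ≠ 0 := pow_ne_zero _ (norm_ne_zero_iff.2 ha)
  have hpb : inner ℝ a p = b := by
    rw [hp, inner_smul_right, real_inner_self_eq_norm_sq]; field_simp
  have : {x : V | inner ℝ a x = b} = (fun x => x + -p) ⁻¹' ((ℝ ∙ a)ᗮ : Submodule ℝ V) := by
    ext x
    simp only [mem_ofPred_eq, mem_preimage, SetLike.mem_coe,
      Submodule.mem_orthogonal_singleton_iff_inner_right, inner_add_right, inner_neg_right, hpb]
    exact ⟨fun h => by rw [h]; ring, fun h => by linarith⟩
  rw [this, measure_preimage_add_right]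
  refine Measure.addHaar_submodule _ _ fun htop => ha ?_
  have hmem : a ∈ (ℝ ∙ a)ᗮ := htop ▸ Submodule.mem_top
  exact inner_self_eq_zero.1 (Submodule.mem_orthogonal_singleton_iff_inner_right.1 hmem)

lemma LebLim.congr_on {n : ℕ} {S : Set V} (hS : MeasurableSet S) {v w : V → ℝ} {x : V} {c : ℝ}
    (hvw : EqOn v w S) (h : LebLim volume n S v x c) : LebLim volume n S w x c := by
  refine Asymptotics.IsLittleO.congr_left h fun r =>
    setIntegral_congr_fun (hS.inter Metric.isOpen_ball.measurableSet) fun y hy => ?_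
  simp only [hvw hy.1]

lemma lebLim_of_null {n : ℕ} {S : Set V} (hS : volume S = 0) (v : V → ℝ) (x : V) (c : ℝ) :
    LebLim volume n S v x c := by
  refine (Asymptotics.isLittleO_zero _ _).congr_left fun r => ?_
  rw [Measure.restrict_eq_zero.2 (measure_mono_null inter_subset_left hS), integral_zero_measure]

lemma HasWeakDeriv.congr_on {μ : Measure V} {U : Set V} {v w g k : V → ℝ} {e : V}
    (h : HasWeakDeriv μ U v g e) (hv : ∀ᵐ x ∂μ, x ∈ U → v x = w x)
    (hg : ∀ᵐ x ∂μ, x ∈ U → g x = k x) : HasWeakDeriv μ U w k e := by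
  intro θ h1 h2 h3
  have e1 : ∫ x, v x * fderiv ℝ θ x e ∂μ = ∫ x, w x * fderiv ℝ θ x e ∂μ := by
    refine integral_congr_ae ?_
    filter_upwards [hv] with x hx
    by_cases hxU : x ∈ U
    · rw [hx hxU]
    · have : x ∉ tsupport (fderiv ℝ θ) := fun hx' => hxU (h3 (tsupport_fderiv_subset ℝ hx'))
      simp [image_eq_zero_of_notMem_tsupport this]
  have e2 : ∫ x, g x * θ x ∂μ = ∫ x, k x * θ x ∂μ := by
    refine integral_congr_ae ?_
    filter_upwards [hg] with x hx
    by_cases hxU : x ∈ U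
    · rw [hx hxU]
    · rw [image_eq_zero_of_notMem_tsupport fun hx' => hxU (h3 hx'), mul_zero, mul_zero]
  rw [← e1, ← e2]
  exact h θ h1 h2 h3

/-- The part of a test function in one of two disjoint open sets is a test function. -/
lemma contDiff_indicator_of_tsupport_subset {U U' : Set V} (hU : IsOpen U) (hU' : IsOpen U')
    (hd : Disjoint U U') {θ : V → ℝ} (h1 : ContDiff ℝ ∞ θ) (h2 : HasCompactSupport θ)
    (h3 : tsupport θ ⊆ U ∪ U') :
    ContDiff ℝ ∞ (U.indicator θ) ∧ HasCompactSupport (U.indicator θ) ∧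
      tsupport (U.indicator θ) ⊆ U := by
  have hsub : tsupport (U.indicator θ) ⊆ tsupport θ :=
    closure_mono (by rw [support_indicator]; exact inter_subset_right)
  refine ⟨contDiff_iff_contDiffAt.2 fun x => ?_, h2.mono' ((subset_tsupport _).trans hsub),
    fun x hx => ?_⟩
  · by_cases hx : x ∈ tsupport θ
    · rcases h3 hx with h | h
      · refine h1.contDiffAt.congr_of_eventuallyEq ?_
        filter_upwards [hU.mem_nhds h] with y hy using indicator_of_mem hy _
      · refine contDiffAt_const (c := (0 : ℝ)).congr_of_eventuallyEq ?_
        filter_upwards [hU'.mem_nhds h] with y hy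
        exact indicator_of_notMem (fun hyU => disjoint_left.1 hd hyU hy) _
    · refine contDiffAt_const (c := (0 : ℝ)).congr_of_eventuallyEq ?_
      filter_upwards [(isClosed_tsupport θ).isOpen_compl.mem_nhds hx] with y hy
      exact (indicator_apply_eq_zero).2 fun _ => image_eq_zero_of_notMem_tsupport hy
  · rcases h3 (hsub hx) with h | h
    · exact h
    · obtain ⟨y, hyU', hy⟩ := mem_closure_iff.1 hx U' hU' h
      rw [support_indicator] at hy
      exact (disjoint_left.1 hd hy.1 hyU').elim

lemma HasWeakDeriv.union {U U' : Set V} (hU : IsOpen U) (hU' : IsOpen U') (hd : Disjoint U U')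
    {v g : V → ℝ} {e : V} (hv : Integrable v) (hg : Integrable g)
    (h : HasWeakDeriv volume U v g e) (h' : HasWeakDeriv volume U' v g e) :
    HasWeakDeriv volume (U ∪ U') v g e := by
  intro θ h1 h2 h3
  obtain ⟨a1, a2, a3⟩ := contDiff_indicator_of_tsupport_subset hU hU' hd h1 h2 h3
  obtain ⟨b1, b2, b3⟩ := contDiff_indicator_of_tsupport_subset hU' hU hd.symm h1 h2
    (by rwa [union_comm])
  have hsum : θ = fun x => U.indicator θ x + U'.indicator θ x := by
    rw [← indicator_union_of_disjoint hd]
    exact (indicator_eq_self.2 ((subset_tsupport θ).trans h3)).symm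
  have hi : ∀ {θ : V → ℝ}, ContDiff ℝ ∞ θ → HasCompactSupport θ →
      Integrable (fun x => v x * fderiv ℝ θ x e) ∧ Integrable (fun x => g x * θ x) := by
    intro θ h1 h2
    obtain ⟨C, -, hC⟩ := exists_bound_of_hasCompactSupport h1.continuous h2
    have hc : Continuous (fun x => fderiv ℝ θ x e) :=
      (h1.continuous_fderiv (by simp)).clm_apply continuous_const
    obtain ⟨C', -, hC'⟩ := exists_bound_of_hasCompactSupport hc
      ((h2.fderiv (𝕜 := ℝ)).comp_left (g := fun (L : V →L[ℝ] ℝ) => L e) rfl)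
    exact ⟨hv.mul_bdd hc.aestronglyMeasurable (ae_of_all _ hC'),
      hg.mul_bdd h1.continuous.aestronglyMeasurable (ae_of_all _ hC)⟩
  have hfd : ∀ x, fderiv ℝ θ x e
      = fderiv ℝ (U.indicator θ) x e + fderiv ℝ (U'.indicator θ) x e := by
    intro x
    conv_lhs => rw [hsum]
    rw [fderiv_fun_add (a1.differentiable (by simp) x) (b1.differentiable (by simp) x)]
    rfl
  have e1 := h _ a1 a2 a3
  have e2 := h' _ b1 b2 b3
  have e3 : ∫ x, g x * θ x = ∫ x, (g x * U.indicator θ x + g x * U'.indicator θ x) := by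
    refine integral_congr_ae (ae_of_all _ fun x => ?_)
    simp only
    rw [← mul_add]
    exact congrArg (g x * ·) (congrFun hsum x)
  simp_rw [hfd, mul_add]
  rw [e3, integral_add (hi a1 a2).1 (hi b1 b2).1, integral_add (hi a1 a2).2 (hi b1 b2).2, e1, e2]
  ring

end General

variable {d : ℕ}

/-- Pairing the vector identity with every `e` reduces it to directional derivatives, and extension
by zero makes all functions globally integrable. -/
lemma hasWeakGradient_iff {U : Set (Space d)} (hU : IsOpen U) {v : Space d → ℝ}
    {G : Space d → Space d} (hv : IntegrableOn v U) (hG : IntegrableOn G U) :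
    HasWeakGradient U v G ↔ ∀ e, HasWeakDeriv volume U (U.indicator v)
      (U.indicator fun x => inner ℝ (G x) e) e := by
  have key : ∀ θ : Space d → ℝ, ContDiff ℝ ∞ θ → HasCompactSupport θ → ∀ e : Space d,
      inner ℝ e (∫ x in U, v x • gradient θ x) = ∫ x, U.indicator v x * fderiv ℝ θ x e ∧
      inner ℝ e (∫ x in U, θ x • G x) = ∫ x, U.indicator (fun x => inner ℝ (G x) e) x * θ x := by
    intro θ h1 h2 e
    have hc : Continuous (gradient θ) :=
      (InnerProductSpace.toDual ℝ (Space d)).symm.continuous.comp (h1.continuous_fderiv (by simp))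
    obtain ⟨C, -, hC⟩ := exists_bound_of_hasCompactSupport h1.continuous h2
    obtain ⟨C', -, hC'⟩ := exists_bound_of_hasCompactSupport hc
      ((h2.fderiv (𝕜 := ℝ)).comp_left
        (g := (InnerProductSpace.toDual ℝ (Space d)).symm) (map_zero _))
    have i1 : IntegrableOn (fun x => v x • gradient θ x) U :=
      hv.smul_bdd C' hc.aestronglyMeasurable (ae_of_all _ hC')
    have i2 : IntegrableOn (fun x => θ x • G x) U :=
      hG.bdd_smul C h1.continuous.aestronglyMeasurable (ae_of_all _ hC)
    rw [← integral_inner i1, ← integral_inner i2, ← integral_indicator hU.measurableSet,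
      ← integral_indicator hU.measurableSet]
    constructor <;> congr 1 <;> ext x <;> by_cases hx : x ∈ U <;>
      simp [hx, inner_smul_right, inner_gradient_right, real_inner_comm, mul_comm]
  constructor
  · intro h e θ h1 h2 h3
    obtain ⟨k1, k2⟩ := key θ h1 h2 e
    rw [← k1, ← k2, h θ h1 h2 h3, inner_neg_right]
  · intro h θ h1 h2 h3
    refine ext_inner_left ℝ fun e => ?_
    obtain ⟨k1, k2⟩ := key θ h1 h2 e
    rw [inner_neg_right, k1, k2, h e θ h1 h2 h3]

lemma side_univ {V : Type*} [NormedAddCommGroup V] [InnerProductSpace ℝ V] (a : V) (b : ℝ) :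
    side a b univ = univ := eq_univ_of_forall fun _ => mem_univ _

/-! ### Equivalence of the two transmission conditions at a fixed time -/

namespace Medium

variable {d : ℕ} (M : Medium d 2)

/-- The function `Ψ(π̂_i(s))` on `Ω_i`, for a saturation field `s` on `Ω`. -/
noncomputable def pot (s : Space d → ℝ) (x : Space d) : ℝ :=
  ∑ i, (M.sub i).indicator (fun x => M.Ψ (M.truncCap i (s x))) x

/-- The function `φ_i(s)` on `Ω_i`, extended by zero. -/
noncomputable def part (i : Fin 2) (s : Space d → ℝ) : Space d → ℝ :=
  (M.sub i).indicator fun x => M.φ i (s x)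

/-- The gradient of `F_i(φ_i(s))` on `Ω_i`, when `G i` is the gradient of `φ_i(s)` there. -/
noncomputable def chainGrad (F : Fin 2 → ℝ → ℝ) (s : Space d → ℝ) (G : Fin 2 → Space d → Space d)
    (x : Space d) : Space d :=
  ∑ i, (M.sub i).indicator (fun x => deriv (F i) (M.φ i (s x)) • G i x) x

lemma sum_indicator_of_mem {E : Type*} [AddCommMonoid E] (f : Fin 2 → Space d → E) {i : Fin 2}
    {x : Space d} (hx : x ∈ M.sub i) : ∑ j, (M.sub j).indicator (f j) x = f i x := by
  rw [Finset.sum_eq_single i, indicator_of_mem hx]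
  · intro j _ hj
    exact indicator_of_notMem (fun h => disjoint_left.1 (M.sub_disjoint j i hj) h hx) _
  · simp

lemma sum_indicator_of_notMem {E : Type*} [AddCommMonoid E] (f : Fin 2 → Space d → E)
    {x : Space d} (hx : ∀ i, x ∉ M.sub i) : ∑ j, (M.sub j).indicator (f j) x = 0 :=
  Finset.sum_eq_zero fun j _ => indicator_of_notMem (hx j) _

variable {M} {s : Space d → ℝ}

lemma abs_pot_le (hαβ : M.αmax < M.βmin) (x : Space d) : |M.pot s x| ≤ M.Ψ M.βmin := by
  have h0 := M.Ψ_truncCap_mem 0 hαβ 0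
  by_cases hx : ∃ i, x ∈ M.sub i
  · obtain ⟨i, hi⟩ := hx
    have h1 := M.Ψ_truncCap_mem i hαβ (s x)
    rw [pot, M.sum_indicator_of_mem _ hi, abs_of_nonneg h1.1]
    exact h1.2
  · rw [pot, M.sum_indicator_of_notMem _ (not_exists.1 hx), abs_zero]
    exact h0.1.trans h0.2

lemma ae_mem_Icc_of_mem_sub (hs : ∀ᵐ x ∂(volume.restrict M.Ω), s x ∈ Icc (0 : ℝ) 1) (i : Fin 2) :
    ∀ᵐ x, x ∈ M.sub i → s x ∈ Icc (0 : ℝ) 1 := by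
  filter_upwards [(ae_restrict_iff' M.polygonal.isOpen.measurableSet).1 hs] with x hx hxi
  exact hx (M.sub_subset i hxi)

lemma integrable_part (hφ : ∀ i, IntegrableOn (fun x => M.φ i (s x)) (M.sub i)) (i : Fin 2) :
    Integrable (M.part i s) :=
  (integrable_indicator_iff (M.isOpen_sub i).measurableSet).2 (hφ i)

lemma pot_ae_eq {F : Fin 2 → ℝ → ℝ} (hF0 : ∀ i, F i 0 = 0)
    (hF : ∀ i, ∀ s ∈ Icc (0 : ℝ) 1, F i (M.φ i s) = M.Ψ (M.truncCap i s))
    (hs : ∀ᵐ x ∂(volume.restrict M.Ω), s x ∈ Icc (0 : ℝ) 1) :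
    M.pot s =ᵐ[volume] fun x => ∑ i, F i (M.part i s x) := by
  filter_upwards [ae_mem_Icc_of_mem_sub hs 0, ae_mem_Icc_of_mem_sub hs 1] with x h0 h1
  refine Finset.sum_congr rfl fun i _ => ?_
  have hi : x ∈ M.sub i → s x ∈ Icc (0 : ℝ) 1 := by
    fin_cases i
    exacts [h0, h1]
  by_cases hx : x ∈ M.sub i
  · rw [indicator_of_mem hx, part, indicator_of_mem hx, hF i _ (hi hx)]
  · rw [indicator_of_notMem hx, part, indicator_of_notMem hx, hF0]

lemma integrable_pot {F : Fin 2 → ℝ → ℝ} (hFL : ∀ i, LipschitzWith 1 (F i))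
    (hF0 : ∀ i, F i 0 = 0)
    (hF : ∀ i, ∀ s ∈ Icc (0 : ℝ) 1, F i (M.φ i s) = M.Ψ (M.truncCap i s))
    (hs : ∀ᵐ x ∂(volume.restrict M.Ω), s x ∈ Icc (0 : ℝ) 1)
    (hφ : ∀ i, IntegrableOn (fun x => M.φ i (s x)) (M.sub i)) : Integrable (M.pot s) := by
  refine (integrable_finsetSum _ fun i _ => ?_).congr (pot_ae_eq hF0 hF hs).symm
  exact memLp_one_iff_integrable.1
    ((hFL i).comp_memLp (hF0 i) (memLp_one_iff_integrable.2 (integrable_part hφ i)))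

lemma integrable_chainGrad {F : Fin 2 → ℝ → ℝ} (hFL : ∀ i, LipschitzWith 1 (F i))
    {G : Fin 2 → Space d → Space d} (hG : ∀ i, IntegrableOn (G i) (M.sub i))
    (hφ : ∀ i, IntegrableOn (fun x => M.φ i (s x)) (M.sub i)) :
    Integrable (M.chainGrad F s G) := by
  refine integrable_finsetSum _ fun i _ => ?_
  rw [integrable_indicator_iff (M.isOpen_sub i).measurableSet]
  refine Integrable.bdd_smul (φ := fun x => deriv (F i) (M.φ i (s x))) (hG i) 1 ?_
    (ae_of_all _ fun x => ?_)
  · exact ((measurable_deriv (F i)).comp_aemeasurable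
      (hφ i).aestronglyMeasurable.aemeasurable).aestronglyMeasurable
  · simpa using norm_deriv_le_of_lipschitz (x₀ := M.φ i (s x)) (hFL i)

lemma hasWeakDeriv_pot_sub {F : Fin 2 → ℝ → ℝ} (hFL : ∀ i, LipschitzWith 1 (F i))
    (hF0 : ∀ i, F i 0 = 0)
    (hF : ∀ i, ∀ s ∈ Icc (0 : ℝ) 1, F i (M.φ i s) = M.Ψ (M.truncCap i s))
    (hFd : ∀ i, ∃ S : Set ℝ, S.Finite ∧ ∀ p ∉ S, DifferentiableAt ℝ (F i) p)
    (hs : ∀ᵐ x ∂(volume.restrict M.Ω), s x ∈ Icc (0 : ℝ) 1)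
    (hφ : ∀ i, IntegrableOn (fun x => M.φ i (s x)) (M.sub i))
    {G : Fin 2 → Space d → Space d} (hG : ∀ i, IntegrableOn (G i) (M.sub i))
    (hw : ∀ i, HasWeakGradient (M.sub i) (fun x => M.φ i (s x)) (G i)) (i : Fin 2) (e : Space d) :
    HasWeakDeriv volume (M.sub i) (M.pot s) (fun x => inner ℝ (M.chainGrad F s G x) e) e := by
  obtain ⟨S, hS, hd⟩ := hFd i
  have hgi : Integrable ((M.sub i).indicator fun x => inner ℝ (G i x) e) :=
    (integrable_indicator_iff (M.isOpen_sub i).measurableSet).2 ((hG i).inner_const e)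
  have h1 := HasWeakDeriv.comp_lipschitz (M.isOpen_sub i)
    (M.sub_polygonal i).isBounded.measure_lt_top.ne
    ((hasWeakGradient_iff (M.isOpen_sub i) (hφ i) (hG i)).1 (hw i) e)
    (integrable_part hφ i) hgi (hFL i) (hF0 i) hS hd
  refine h1.congr_on ?_ (ae_of_all _ fun x hx => ?_)
  · filter_upwards [ae_mem_Icc_of_mem_sub hs i] with x hx hxi
    rw [pot, M.sum_indicator_of_mem _ hxi, indicator_of_mem hxi, hF i _ (hx hxi)]
  · rw [chainGrad, M.sum_indicator_of_mem _ hx, indicator_of_mem hx, indicator_of_mem hx,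
      real_inner_smul_left]

/-- The trace of `Ψ(π̂_i(s))` on the boundary of `Ω_i`. -/
lemma lebLim_pot_sub (hαβ : M.αmax < M.βmin)
    (hs : ∀ᵐ x ∂(volume.restrict M.Ω), s x ∈ Icc (0 : ℝ) 1)
    (hφ : ∀ i, IntegrableOn (fun x => M.φ i (s x)) (M.sub i)) {i : Fin 2} {x : Space d} {c : ℝ}
    (hc : c ∈ Icc (0 : ℝ) 1) (h : LebLim volume d (M.sub i) (M.part i s) x (M.φ i c)) :
    LebLim volume d (M.sub i) (M.pot s) x (M.Ψ (M.truncCap i c)) := by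
  refine h.of_le (M.isOpen_sub i).measurableSet le_rfl (integrable_part hφ i) ?_
  filter_upwards [ae_mem_Icc_of_mem_sub hs i] with y hy hyi
  rw [pot, M.sum_indicator_of_mem _ hyi, part, indicator_of_mem hyi]
  exact M.abs_Ψ_truncCap_sub_le i hαβ (hy hyi) hc

lemma volume_interface {i j : Fin 2} : volume (M.interface i j) = 0 := by
  obtain ⟨H, hH, hf⟩ := M.exists_hyperplanes
  refine measure_mono_null (fun x hx => hf i hx.1.1) ?_
  exact (measure_biUnion_null_iff H.countable_toSet).2 fun h hh => volume_hyperplane (hH h hh) h.2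

lemma measurableSet_interface (i j : Fin 2) : MeasurableSet (M.interface i j) :=
  (isClosed_frontier.measurableSet.inter isClosed_frontier.measurableSet).inter
    M.polygonal.isOpen.measurableSet

/-- A function with the same trace from both sides at a point of `Ω` has a Lebesgue limit. -/
lemma lebLim_univ_of_sub {v : Space d → ℝ} (hv : Integrable v) {x : Space d} (hx : x ∈ M.Ω) {c : ℝ}
    (h : ∀ i, LebLim volume d (M.sub i) v x c) : LebLim volume d univ v x c := by
  obtain ⟨r, hr, hball⟩ := Metric.isOpen_iff.1 M.polygonal.isOpen x hx
  have hdisj : ∀ i, Disjoint (M.sub i) (M.interface 0 1) := by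
    intro i
    have : Disjoint (M.sub i) (frontier (M.sub i)) := by
      rw [(M.isOpen_sub i).frontier_eq]; exact disjoint_sdiff_right
    refine this.mono_right fun y hy => ?_
    fin_cases i
    exacts [hy.1.1, hy.1.2]
  have h1 := ((h 0).union M.disjoint_sub (M.isOpen_sub 1).measurableSet hv (h 1)).union
    (disjoint_union_left.2 ⟨hdisj 0, hdisj 1⟩) (M.measurableSet_interface 0 1) hv
    (lebLim_of_null M.volume_interface v x c)
  refine h1.congr_set hr ?_
  refine Subset.antisymm (inter_subset_inter_left _ (subset_univ _)) fun y hy => ⟨?_, hy.2⟩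
  rcases M.mem_sub_or_interface (hball hy.2) with h | h | h
  exacts [Or.inl (Or.inl h), Or.inl (Or.inr h), Or.inr h]

/-- If the capillary pressures are connected on the interface, then `Ψ(π̂_i(s))` has a weak gradient
in the whole medium. -/
theorem hasWeakGradient_pot (hαβ : M.αmax < M.βmin) {F : Fin 2 → ℝ → ℝ}
    (hFL : ∀ i, LipschitzWith 1 (F i)) (hF0 : ∀ i, F i 0 = 0)
    (hF : ∀ i, ∀ s ∈ Icc (0 : ℝ) 1, F i (M.φ i s) = M.Ψ (M.truncCap i s))
    (hFd : ∀ i, ∃ S : Set ℝ, S.Finite ∧ ∀ p ∉ S, DifferentiableAt ℝ (F i) p)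
    (hs : ∀ᵐ x ∂(volume.restrict M.Ω), s x ∈ Icc (0 : ℝ) 1)
    (hφ : ∀ i, IntegrableOn (fun x => M.φ i (s x)) (M.sub i))
    {G : Fin 2 → Space d → Space d} (hG : ∀ i, IntegrableOn (G i) (M.sub i))
    (hw : ∀ i, HasWeakGradient (M.sub i) (fun x => M.φ i (s x)) (G i))
    (hΓ : ∀ᵐ x ∂((Measure.hausdorffMeasure ((d : ℝ) - 1)).restrict (M.interface 0 1)),
      ∃ c₀ c₁ : ℝ, (c₀ ∈ Icc (0 : ℝ) 1 ∧ IsTraceAt (M.sub 0) (fun y => M.φ 0 (s y)) x (M.φ 0 c₀)) ∧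
        (c₁ ∈ Icc (0 : ℝ) 1 ∧ IsTraceAt (M.sub 1) (fun y => M.φ 1 (s y)) x (M.φ 1 c₁)) ∧
        (M.capGraph 0 c₀ ∩ M.capGraph 1 c₁).Nonempty) :
    HasWeakGradient M.Ω (M.pot s) (M.chainGrad F s G) := by
  have hpi := integrable_pot hFL hF0 hF hs hφ
  have hgi := integrable_chainGrad hFL hG hφ
  have hsub := fun i e => hasWeakDeriv_pot_sub hFL hF0 hF hFd hs hφ hG hw i e
  obtain ⟨H, hH, hf⟩ := M.exists_hyperplanes
  -- The hyperplanes carrying the boundaries also cut through the subdomains. There a limit exists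
  -- because the potential is weakly differentiable in a neighbourhood; on the interface it exists
  -- because the two traces agree.
  have hlim : ∀ h ∈ H, ∀ᵐ x ∂((Measure.hausdorffMeasure ((d : ℝ) - 1)).restrict
      {x : Space d | inner ℝ h.1 x = h.2}), x ∈ M.Ω → ∃ c, LebLim volume d univ (M.pot s) x c := by
    intro h hh
    have hin : ∀ i, ∀ᵐ x ∂((Measure.hausdorffMeasure ((d : ℝ) - 1)).restrict
        {x : Space d | inner ℝ h.1 x = h.2}), x ∈ M.sub i →
          ∃ c, LebLim volume d univ (M.pot s) x c := by
      intro i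
      have := (hsub i h.1).ae_hyperplane_exists_lebLim (hH h hh) h.2 hpi (hgi.inner_const h.1)
        (K := univ) (Or.inr (Or.inr rfl))
      simp only [finrank_euclideanSpace_fin, side_univ, univ_inter] at this
      filter_upwards [this] with x hx hxi
      exact hx (Metric.isOpen_iff.1 (M.isOpen_sub i) x hxi)
    have hΓ' : ∀ᵐ x ∂((Measure.hausdorffMeasure ((d : ℝ) - 1)).restrict
        {x : Space d | inner ℝ h.1 x = h.2}), x ∈ M.interface 0 1 →
          ∃ c, LebLim volume d univ (M.pot s) x c := by
      filter_upwards [ae_restrict_of_ae ((ae_restrict_iff' (M.measurableSet_interface 0 1)).1 hΓ)]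
        with x hx hxΓ
      obtain ⟨c₀, c₁, ⟨h0, t0⟩, ⟨h1, t1⟩, hne⟩ := hx hxΓ
      have heq := (M.capGraph_inter_nonempty_iff hαβ h0 h1).1 hne
      refine ⟨M.Ψ (M.truncCap 0 c₀), lebLim_univ_of_sub hpi hxΓ.2 fun i => ?_⟩
      have conv : ∀ i, ∀ c ∈ Icc (0 : ℝ) 1,
          IsTraceAt (M.sub i) (fun y => M.φ i (s y)) x (M.φ i c) →
          LebLim volume d (M.sub i) (M.pot s) x (M.Ψ (M.truncCap i c)) := fun i c hc ht =>
        lebLim_pot_sub hαβ hs hφ hc (ht.lebLim.congr_on (M.isOpen_sub i).measurableSet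
          fun y hy => (indicator_of_mem hy _).symm)
      fin_cases i
      · exact conv 0 c₀ h0 t0
      · have := conv 1 c₁ h1 t1
        rwa [← heq] at this
    filter_upwards [hin 0, hin 1, hΓ'] with x h0 h1 h2 hx
    rcases M.mem_sub_or_interface hx with h | h | h
    exacts [h0 h, h1 h, h2 h]
  rw [hasWeakGradient_iff M.polygonal.isOpen hpi.integrableOn hgi.integrableOn]
  intro e
  have hstart : HasWeakDeriv volume (M.Ω \ ⋃ h ∈ H, {x : Space d | inner ℝ h.1 x = h.2}) (M.pot s)
      (fun x => inner ℝ (M.chainGrad F s G x) e) e := by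
    refine HasWeakDeriv.mono (HasWeakDeriv.union (M.isOpen_sub 0) (M.isOpen_sub 1) M.disjoint_sub
      hpi (hgi.inner_const e) (hsub 0 e) (hsub 1 e)) fun x hx => ?_
    rcases M.mem_sub_or_interface hx.1 with h | h | h
    exacts [Or.inl h, Or.inr h, (hx.2 (hf 0 h.1.1)).elim]
  -- Off all the hyperplanes the medium is covered by the subdomains. The hyperplanes are then put
  -- back one at a time, each being removable by `hlim`.
  have hind : ∀ H' : Finset (Space d × ℝ), H' ⊆ H →
      HasWeakDeriv volume (M.Ω \ ⋃ h ∈ H', {x : Space d | inner ℝ h.1 x = h.2}) (M.pot s)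
        (fun x => inner ℝ (M.chainGrad F s G x) e) e →
      HasWeakDeriv volume M.Ω (M.pot s) (fun x => inner ℝ (M.chainGrad F s G x) e) e := by
    classical
    intro H'
    induction H' using Finset.induction_on with
    | empty => intro _ h; simpa using h
    | insert h H' _ ih =>
      intro hsubH hd
      have hh : h ∈ H := hsubH (Finset.mem_insert_self _ _)
      refine ih ((Finset.subset_insert _ _).trans hsubH) ?_
      refine HasWeakDeriv.of_diff_hyperplane' (hH h hh) h.2 ?_ hpi (hgi.inner_const e)
        (M.abs_pot_le hαβ) ?_
      · rwa [sdiff_sdiff, union_comm,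
          ← Finset.set_biUnion_insert h H' fun h => {x : Space d | inner ℝ h.1 x = h.2}]
      · rw [finrank_euclideanSpace_fin]
        filter_upwards [hlim h hh] with x hx hxm using hx hxm.1
  refine (hind H subset_rfl hstart).congr_on (ae_of_all _ fun x hx => ?_)
    (ae_of_all _ fun x hx => ?_)
  · rw [indicator_of_mem hx]
  · rw [indicator_of_mem hx]

/-- If `Ψ(π̂_i(s))` has a weak gradient in the whole medium, then the capillary pressures are
connected on the interface. -/
theorem ae_interface_exists_trace (hαβ : M.αmax < M.βmin)
    (hs : ∀ᵐ x ∂(volume.restrict M.Ω), s x ∈ Icc (0 : ℝ) 1)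
    (hφ : ∀ i, IntegrableOn (fun x => M.φ i (s x)) (M.sub i))
    {G : Fin 2 → Space d → Space d} (hG : ∀ i, IntegrableOn (G i) (M.sub i))
    (hw : ∀ i, HasWeakGradient (M.sub i) (fun x => M.φ i (s x)) (G i))
    {Gp : Space d → Space d} (hp : IntegrableOn (M.pot s) M.Ω) (hGp : IntegrableOn Gp M.Ω)
    (hwp : HasWeakGradient M.Ω (M.pot s) Gp) :
    ∀ᵐ x ∂((Measure.hausdorffMeasure ((d : ℝ) - 1)).restrict (M.interface 0 1)),
      ∃ c₀ c₁ : ℝ, (c₀ ∈ Icc (0 : ℝ) 1 ∧ IsTraceAt (M.sub 0) (fun y => M.φ 0 (s y)) x (M.φ 0 c₀)) ∧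
        (c₁ ∈ Icc (0 : ℝ) 1 ∧ IsTraceAt (M.sub 1) (fun y => M.φ 1 (s y)) x (M.φ 1 c₁)) ∧
        (M.capGraph 0 c₀ ∩ M.capGraph 1 c₁).Nonempty := by
  obtain ⟨H, hH, hf⟩ := M.exists_hyperplanes
  have hΩm := M.polygonal.isOpen.measurableSet
  have hpi : Integrable (M.Ω.indicator (M.pot s)) := (integrable_indicator_iff hΩm).2 hp
  have hmono : M.interface 0 1 ⊆ ⋃ h ∈ H, {x : Space d | inner ℝ h.1 x = h.2} :=
    fun x hx => hf 0 hx.1.1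
  rw [ae_restrict_iff' (M.measurableSet_interface 0 1)]
  suffices hmain : ∀ h ∈ H, ∀ᵐ x ∂((Measure.hausdorffMeasure ((d : ℝ) - 1)).restrict
      {x : Space d | inner ℝ h.1 x = h.2}), x ∈ M.interface 0 1 →
      ∃ c₀ c₁ : ℝ, (c₀ ∈ Icc (0 : ℝ) 1 ∧ IsTraceAt (M.sub 0) (fun y => M.φ 0 (s y)) x (M.φ 0 c₀)) ∧
        (c₁ ∈ Icc (0 : ℝ) 1 ∧ IsTraceAt (M.sub 1) (fun y => M.φ 1 (s y)) x (M.φ 1 c₁)) ∧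
        (M.capGraph 0 c₀ ∩ M.capGraph 1 c₁).Nonempty by
    have hm : ∀ h : Space d × ℝ, MeasurableSet {x : Space d | inner ℝ h.1 x = h.2} :=
      fun h => (isClosed_eq (by fun_prop) continuous_const).measurableSet
    have hall : ∀ᵐ x ∂(Measure.hausdorffMeasure ((d : ℝ) - 1) : Measure (Space d)), ∀ h ∈ H,
        inner ℝ h.1 x = h.2 → x ∈ M.interface 0 1 →
        ∃ c₀ c₁ : ℝ, (c₀ ∈ Icc (0 : ℝ) 1 ∧
          IsTraceAt (M.sub 0) (fun y => M.φ 0 (s y)) x (M.φ 0 c₀)) ∧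
          (c₁ ∈ Icc (0 : ℝ) 1 ∧ IsTraceAt (M.sub 1) (fun y => M.φ 1 (s y)) x (M.φ 1 c₁)) ∧
          (M.capGraph 0 c₀ ∩ M.capGraph 1 c₁).Nonempty := by
      rw [Filter.eventually_all_finset]
      intro h hh
      exact (ae_restrict_iff' (hm h)).1 (hmain h hh)
    filter_upwards [hall] with x hx hxΓ
    obtain ⟨h, hh, hxh⟩ := mem_iUnion₂.1 (hmono hxΓ)
    exact hx h hh hxh hxΓ
  intro h hh
  have ha := hH h hh
  have htr : ∀ i, ∀ K, IsSide K → ∀ᵐ x ∂((Measure.hausdorffMeasure ((d : ℝ) - 1)).restrict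
      {x : Space d | inner ℝ h.1 x = h.2}), (∃ r > 0, side h.1 h.2 K ∩ Metric.ball x r ⊆ M.sub i) →
        ∃ c, LebLim volume d (side h.1 h.2 K) (M.part i s) x c := by
    intro i K hK
    have := HasWeakDeriv.ae_hyperplane_exists_lebLim ha h.2
      ((hasWeakGradient_iff (M.isOpen_sub i) (hφ i) (hG i)).1 (hw i) h.1) (integrable_part hφ i)
      ((integrable_indicator_iff (M.isOpen_sub i).measurableSet).2 ((hG i).inner_const h.1)) hK
    rwa [finrank_euclideanSpace_fin] at this
  -- The side occupied by `Ω_i` depends on the point, so one null set must serve for all sides.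
  -- There are only three.
  have htr' : ∀ᵐ x ∂((Measure.hausdorffMeasure ((d : ℝ) - 1)).restrict
      {x : Space d | inner ℝ h.1 x = h.2}), ∀ i, ∀ K, IsSide K →
        (∃ r > 0, side h.1 h.2 K ∩ Metric.ball x r ⊆ M.sub i) →
        ∃ c, LebLim volume d (side h.1 h.2 K) (M.part i s) x c := by
    rw [ae_all_iff]
    intro i
    filter_upwards [htr i _ (Or.inl rfl), htr i _ (Or.inr (Or.inl rfl)),
      htr i _ (Or.inr (Or.inr rfl))] with x h1 h2 h3 K hK
    rcases hK with rfl | rfl | rfl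
    exacts [h1, h2, h3]
  have hfull := HasWeakDeriv.ae_hyperplane_exists_lebLim ha h.2
      ((hasWeakGradient_iff M.polygonal.isOpen hp hGp).1 hwp h.1) hpi
      ((integrable_indicator_iff hΩm).2 (hGp.inner_const h.1)) (K := univ) (Or.inr (Or.inr rfl))
  rw [finrank_euclideanSpace_fin] at hfull
  simp only [side_univ, univ_inter] at hfull
  have hmem : ∀ᵐ x ∂((Measure.hausdorffMeasure ((d : ℝ) - 1)).restrict
      {x : Space d | inner ℝ h.1 x = h.2}), inner ℝ h.1 x = h.2 :=
    ae_restrict_mem (isClosed_eq (by fun_prop) continuous_const).measurableSet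
  filter_upwards [htr', hfull, M.ae_interface_sides hH hf hh, hmem] with x h1 h2 h3 hxh hxΓ
  obtain ⟨r, hr, K, hK, hKs⟩ := h3 hxΓ
  obtain ⟨c, hc⟩ := h2 (Metric.isOpen_iff.1 M.polygonal.isOpen x hxΓ.2)
  -- The one-sided limit of `φ_i(s)` lies in the range of `φ_i`, hence is `φ_i(c')`. The potential
  -- then has the limit `Ψ(π̂_i(c'))` from `Ω_i`, and also the restriction of its full limit `c`;
  -- the density of the half ball forces equality.
  have hside : ∀ i, ∃ c' ∈ Icc (0 : ℝ) 1,
      IsTraceAt (M.sub i) (fun y => M.φ i (s y)) x (M.φ i c') ∧ M.Ψ (M.truncCap i c') = c := by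
    intro i
    obtain ⟨κ, hκ, hvol⟩ := exists_le_volume_side_inter_ball ha (hK i) hxh
    rw [finrank_euclideanSpace_fin] at hvol
    have hdens : ∀ᶠ ρ in 𝓝[>] (0 : ℝ), κ * ρ ^ d ≤ volume.real (M.sub i ∩ Metric.ball x ρ) := by
      filter_upwards [Ioo_mem_nhdsGT hr] with ρ hρ
      have hb : Metric.ball x r ∩ Metric.ball x ρ = Metric.ball x ρ :=
        inter_eq_right.2 (Metric.ball_subset_ball hρ.2.le)
      rw [← hb, ← inter_assoc, hKs i, inter_assoc, hb]
      exact hvol ρ hρ.1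
    obtain ⟨g, hg⟩ := h1 i (K i) (hK i) ⟨r, hr, by rw [← hKs i]; exact inter_subset_left⟩
    have hg := hg.congr_set hr (hKs i).symm
    have hmono := (M.strictMonoOn_φ i).monotoneOn
    have hgm : g ∈ Icc (M.φ i 0) (M.φ i 1) := by
      refine hg.mem_Icc (M.isOpen_sub i).measurableSet (integrable_part hφ i) hκ hdens
        (hmono ⟨le_rfl, zero_le_one⟩ ⟨zero_le_one, le_rfl⟩ zero_le_one) ?_
      filter_upwards [ae_mem_Icc_of_mem_sub hs i] with y hy hyi
      rw [part, indicator_of_mem hyi]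
      exact ⟨hmono ⟨le_rfl, zero_le_one⟩ (hy hyi) (hy hyi).1,
        hmono (hy hyi) ⟨zero_le_one, le_rfl⟩ (hy hyi).2⟩
    obtain ⟨c', hc', rfl⟩ := intermediate_value_Icc zero_le_one (M.continuousOn_φ i) hgm
    refine ⟨c', hc', ?_, ?_⟩
    · exact (hg.congr_on (M.isOpen_sub i).measurableSet
        fun y hy => indicator_of_mem hy _).isTraceAt hκ hdens
    · have e1 := lebLim_pot_sub hαβ hs hφ hc' hg
      have e2 := e1.congr_on (M.isOpen_sub i).measurableSet (w := M.Ω.indicator (M.pot s))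
        fun y hy => (indicator_of_mem (M.sub_subset i hy) _).symm
      refine e2.unique hpi hκ hdens ?_
      exact hc.of_le (M.isOpen_sub i).measurableSet (subset_univ _) hpi
        (ae_of_all _ fun y _ => le_rfl)
  obtain ⟨c₀, h0, t0, e0⟩ := hside 0
  obtain ⟨c₁, h1', t1, e1⟩ := hside 1
  refine ⟨c₀, c₁, ⟨h0, t0⟩, ⟨h1', t1⟩, (M.capGraph_inter_nonempty_iff hαβ h0 h1').2 ?_⟩
  exact (M.strictMonoOn_Ψ hαβ).injOn (M.truncCap_mem 0 hαβ c₀) (M.truncCap_mem 1 hαβ c₁)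
    (e0.trans e1.symm)

end Medium

/-! ### Time slices and the space-time statements -/

section Slices

variable {d : ℕ} {U : Set (Space d)} {T : ℝ}

lemma volume_restrict_prod_Ioo (U : Set (Space d)) (T : ℝ) :
    (volume.restrict (U ×ˢ Ioo 0 T) : Measure (Space d × ℝ))
      = (volume.restrict U).prod (volume.restrict (Ioo 0 T)) :=
  (Measure.prod_restrict U (Ioo 0 T)).symm

lemma ae_slice {p : Space d × ℝ → Prop} (h : ∀ᵐ q ∂(volume.restrict (U ×ˢ Ioo 0 T)), p q) :
    ∀ᵐ t ∂(volume.restrict (Ioo 0 T)), ∀ᵐ x ∂(volume.restrict U), p (x, t) := by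
  rw [volume_restrict_prod_Ioo] at h
  exact Measure.ae_ae_of_ae_prod (Measure.measurePreserving_swap.quasiMeasurePreserving.ae h)

lemma integrableOn_slice {E : Type*} [NormedAddCommGroup E] (hU : volume U ≠ ⊤)
    {f : Space d × ℝ → E} (h : MemLp f 2 (volume.restrict (U ×ˢ Ioo 0 T))) :
    ∀ᵐ t ∂(volume.restrict (Ioo 0 T)), IntegrableOn (fun x => f (x, t)) U := by
  rw [volume_restrict_prod_Ioo] at h
  have : Fact (volume U < ⊤) := ⟨hU.lt_top⟩
  exact (h.integrable one_le_two).prod_left_ae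

end Slices

namespace Medium

variable {d : ℕ} {M : Medium d 2} {u : Space d × ℝ → ℝ}

lemma volume_sub_ne_top (i : Fin 2) : volume (M.sub i) ≠ ⊤ :=
  (M.sub_polygonal i).isBounded.measure_lt_top.ne

/-- A sum of square integrable functions on the subdomains is square integrable. -/
lemma memLp_sum_indicator {E : Type*} [NormedAddCommGroup E] {f : Fin 2 → Space d × ℝ → E}
    (hf : ∀ i, MemLp (f i) 2 (volume.restrict (M.sub i ×ˢ Ioo 0 M.T))) :
    MemLp (fun p : Space d × ℝ => ∑ i, (M.sub i).indicator (fun x => f i (x, p.2)) p.1) 2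
      (volume.restrict (M.Ω ×ˢ Ioo 0 M.T)) := by
  refine memLp_finsetSum _ fun i _ => ?_
  have h1 : (fun p : Space d × ℝ => (M.sub i).indicator (fun x => f i (x, p.2)) p.1)
      = (M.sub i ×ˢ (univ : Set ℝ)).indicator (f i) := by
    ext p
    by_cases hp : p.1 ∈ M.sub i
    · rw [indicator_of_mem hp, indicator_of_mem (mk_mem_prod hp (mem_univ _))]
    · rw [indicator_of_notMem hp, indicator_of_notMem fun h => hp (mem_prod.1 h).1]
  have hm : MeasurableSet (M.sub i ×ˢ (univ : Set ℝ)) :=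
    (M.isOpen_sub i).measurableSet.prod MeasurableSet.univ
  rw [h1, memLp_indicator_iff_restrict hm, Measure.restrict_restrict hm, prod_inter_prod,
    univ_inter, inter_eq_left.2 (M.sub_subset i)]
  exact hf i

/-- Each slice of `M.w u` is a `pot`. Its gradient is given by an explicit formula, measurable in
space and time, and `|F_i'| ≤ 1` makes it square integrable along with `G i`. -/
theorem memL2H1_w (hαβ : M.αmax < M.βmin) (hu : M.IsSaturation u)
    {G : Fin 2 → Space d × ℝ → Space d} (hG : ∀ i, IsL2H1 (M.sub i) M.T (M.φu u i) (G i))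
    (hΓ : M.GraphCondition u 0 1) : MemL2H1 M.Ω M.T (M.w u) := by
  choose F hFL hF0 hF hFd using fun i => M.exists_lipschitz_transition i hαβ
  refine ⟨fun p => M.chainGrad F (fun x => u (x, p.2)) (fun i x => G i (x, p.2)) p.1, ?_, ?_, ?_⟩
  · refine M.memLp_sum_indicator (f := fun i p => M.Ψ (M.truncCap i (u p))) fun i => ?_
    refine MemLp.ae_eq ?_ ((hFL i).comp_memLp (hF0 i) (hG i).memLp)
    have hsub : M.sub i ×ˢ Ioo 0 M.T ⊆ M.Ω ×ˢ Ioo 0 M.T := prod_mono (M.sub_subset i) le_rfl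
    filter_upwards [ae_restrict_of_ae_restrict_of_subset hsub hu.2] with p hp using hF i _ hp
  · refine M.memLp_sum_indicator (f := fun i p => deriv (F i) (M.φ i (u p)) • G i p) fun i => ?_
    refine (hG i).memLp_grad.of_le ?_ (ae_of_all _ fun p => ?_)
    · exact ((measurable_deriv (F i)).comp_aemeasurable
        (hG i).memLp.aestronglyMeasurable.aemeasurable).aestronglyMeasurable.smul
          (hG i).memLp_grad.aestronglyMeasurable
    · rw [norm_smul]
      refine mul_le_of_le_one_left (norm_nonneg _) ?_
      simpa using norm_deriv_le_of_lipschitz (x₀ := M.φ i (u p)) (hFL i)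
  · have h1 := ae_all_iff.2 fun i => integrableOn_slice (M.volume_sub_ne_top i) (hG i).memLp
    have h2 := ae_all_iff.2 fun i => integrableOn_slice (M.volume_sub_ne_top i) (hG i).memLp_grad
    have h3 := ae_all_iff.2 fun i => (hG i).hasWeakGradient
    filter_upwards [h1, h2, h3, ae_slice hu.2, hΓ] with t h1 h2 h3 h4 h5
    exact hasWeakGradient_pot (s := fun x => u (x, t)) hαβ hFL hF0 hF hFd h4 h1 h2 h3 h5

/-- On almost every time slice the functions and gradients are integrable over sets of finite
volume, so the statement at fixed time applies. -/
theorem graphCondition_of_memL2H1_w (hαβ : M.αmax < M.βmin) (hu : M.IsSaturation u)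
    {G : Fin 2 → Space d × ℝ → Space d} (hG : ∀ i, IsL2H1 (M.sub i) M.T (M.φu u i) (G i))
    (hw : MemL2H1 M.Ω M.T (M.w u)) : M.GraphCondition u 0 1 := by
  obtain ⟨Gw, hw⟩ := hw
  have hΩ : volume M.Ω ≠ ⊤ := M.polygonal.isBounded.measure_lt_top.ne
  have h1 := ae_all_iff.2 fun i => integrableOn_slice (M.volume_sub_ne_top i) (hG i).memLp
  have h2 := ae_all_iff.2 fun i => integrableOn_slice (M.volume_sub_ne_top i) (hG i).memLp_grad
  have h3 := ae_all_iff.2 fun i => (hG i).hasWeakGradient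
  filter_upwards [h1, h2, h3, ae_slice hu.2, integrableOn_slice hΩ hw.memLp,
    integrableOn_slice hΩ hw.memLp_grad, hw.hasWeakGradient] with t h1 h2 h3 h4 h5 h6 h7
  exact ae_interface_exists_trace (s := fun x => u (x, t)) hαβ h4 h1 h2 h3 h5 h6 h7

lemma GraphCondition.symm {i j : Fin 2} (h : M.GraphCondition u i j) :
    M.GraphCondition u j i := by
  have hΓ : M.interface j i = M.interface i j := by
    rw [interface, interface, inter_comm (frontier (M.sub j))]
  rw [GraphCondition, hΓ]
  filter_upwards [h] with t ht
  filter_upwards [ht] with x ⟨si, sj, h1, h2, h3⟩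
  exact ⟨sj, si, h2, h1, by rwa [inter_comm]⟩

end Medium

end TwoPhaseFlow

/-! ### The equivalence of the two notions of weak solution -/

theorem mainTheorem6 {d : ℕ} (M : TwoPhaseFlow.Medium d 2)
    (hαβ : max (M.α 0) (M.α 1) < min (M.β 0) (M.β 1))
    (u : EuclideanSpace ℝ (Fin d) × ℝ → ℝ) :
    M.IsWeakSolution u ↔ M.IsTruncatedWeakSolution u := by
  constructor
  · intro h
    obtain ⟨G, hG, -⟩ := h.solves
    exact ⟨h.isSaturation, TwoPhaseFlow.Medium.memL2H1_w hαβ h.isSaturation hG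
      (h.graphCondition 0 1 zero_ne_one), h.solves⟩
  · intro h
    obtain ⟨G, hG, -⟩ := h.solves
    have h01 := TwoPhaseFlow.Medium.graphCondition_of_memL2H1_w hαβ h.isSaturation hG h.memL2H1
    refine ⟨h.isSaturation, fun i j hij => ?_, h.solves⟩
    fin_cases i <;> fin_cases j
    exacts [(hij rfl).elim, h01, h01.symm, (hij rfl).elim]
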